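/- Let $d\in\mathbb N$, $0\le\alpha<d-1$, $p\in[1,\infty]$ and $q\in\left(\tfrac{d}{d-1-\alpha},\infty\right]$ with Hölder dual $q'$, $\tfrac1q+\tfrac1{q'}=1$. Let $K:\mathbb R^d\to\mathbb R^d$ be differentiable on $\mathbb R^d\setminus\{0\}$ with $$\operatorname{div}K=0,\qquad |K(x)|\le C_K|x|^{-\alpha},\qquad |\nabla K(x)|\le C_K|x|^{-\alpha-1}\qquad (x\ne0).$$ For every $N$ let $\lambda_N>0$ and $X_1^0,\dots,X_N^0,V_1^0,\dots,V_N^0\in\mathbb R^d$ (depending on $N$) be given, and consider $$\dot X_i=V_i,\qquad \dot V_i=\lambda_N\Big(-V_i+\frac1N\sum_{j\ne i}K(X_i-X_j)\Big),\qquad X_i(0)=X_i^0,\quad V_i(0)=V_i^0 .$$ Set $\rho_N(t)=\frac1N\sum_i\delta_{X_i(t)}$ and $d_{\min}(0)=\min_{i\ne j}|X_i^0-X_j^0|$ ($=\infty$ if $N<2$), and let $\mathcal W_p$ be the $p$-Wasserstein distance. Let $\rho^0$ be a probability measure on $\mathbb R^d$ with density in $L^q(\mathbb R^d)$, $\|\rho^0\|_{L^q}\le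 M$. Assume $$\lim_{N\to\infty}\Big(\mathcal W_p(\rho_N(0),\rho^0)+\frac1{\lambda_N}\Big)^{\theta}\Big(1+\frac1{N^{1/d}d_{\min}(0)}\Big)=0,\qquad \theta=\frac{p\,(d-\alpha-1)}{(\alpha+1)(d+pq')}$$ (with $\theta=\frac{d-\alpha-1}{(\alpha+1)q'}$ if $p=\infty$), and, for all $N$, $$|V_i^0-V_j^0|\le\frac{\lambda_N}{2}|X_i^0-X_j^0|\quad(1\le i,j\le N),\qquad N^{-1/p}\,|V^0|_p\le C_V,$$ where $|V^0|_p=\big(\sum_i|V_i^0|^p\big)^{1/p}$ for $p<\infty$, and $|V^0|_\infty=\max_i|V_i^0|$ with $N^{-1/\infty}=1$. Then there is a constant $C>0$ depending only on $d,\alpha,p,q,C_K,M,C_V$ such that the following holds. Let $T\ge0$ and let $\rho$ be a weak solution on $[0,T]$ (the narrowly continuous representative, with values in the probability measures and $\rho\in L^\infty(0,T;L^q)$) of $$\partial_t\rho+(K*\rho)\cdot\nabla\rho=0,\qquad \rho(0)=\rho^0 .$$ Then there is $N_0$ such that for all $N\ge N_0$ the particle system has a collision-free solution on $[0,T]$,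 and every such solution satisfies, for all $t\in[0,T]$, $$\mathcal W_p(\rho_N(t),\rho(t))\le C\Big(\mathcal W_p(\rho_N(0),\rho^0)+\frac1{\lambda_N}\Big)e^{Ct}.$$ -/

import Mathlib

open MeasureTheory Filter Topology
open scoped ENNReal ContDiff

namespace MeanField

/-- The Wasserstein distance of order `p ∈ [1, ∞]`: the infimum over all couplings `γ` of `μ` and
`ν` of the `L^p(γ)` norm of `x - y` (so the essential supremum of `|x - y|` for `p = ∞`). -/
noncomputable def wasserstein {d : ℕ} (p : ℝ≥0∞)
    (μ ν : Measure (EuclideanSpace ℝ (Fin d))) : ℝ≥0∞ :=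
  ⨅ (γ : Measure (EuclideanSpace ℝ (Fin d) × EuclideanSpace ℝ (Fin d)))
    (_ : γ.map Prod.fst = μ) (_ : γ.map Prod.snd = ν),
    eLpNorm (fun z => z.1 - z.2) p γ

/-- The empirical measure `(1/N) ∑ i, δ_{X i}` of `N` points. -/
noncomputable def empiricalMeasure {d N : ℕ} (X : Fin N → EuclideanSpace ℝ (Fin d)) :
    Measure (EuclideanSpace ℝ (Fin d)) :=
  (N : ℝ≥0∞)⁻¹ • ∑ i, Measure.dirac (X i)

/-- The minimal distance `min_{i ≠ j} |X i - X j|` (which is `∞` for fewer than two points). -/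
noncomputable def minDist {d N : ℕ} (X : Fin N → EuclideanSpace ℝ (Fin d)) : ℝ≥0∞ :=
  ⨅ (i : Fin N) (j : Fin N) (_ : i ≠ j), edist (X i) (X j)

/-- Divergence-free interaction kernels, differentiable away from the origin, with
`|K(x)| ≤ C |x|^{-α}` and `|∇K(x)| ≤ C |x|^{-α-1}` for `x ≠ 0`.
The value of `K` at the origin is arbitrary. -/
structure IsKernel {d : ℕ} (α C : ℝ)
    (K : EuclideanSpace ℝ (Fin d) → EuclideanSpace ℝ (Fin d)) : Prop where
  differentiableAt : ∀ x, x ≠ 0 → DifferentiableAt ℝ K x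
  div_eq_zero : ∀ x, x ≠ 0 →
    LinearMap.trace ℝ (EuclideanSpace ℝ (Fin d)) (fderiv ℝ K x : _ →ₗ[ℝ] _) = 0
  norm_le : ∀ x, x ≠ 0 → ‖K x‖ ≤ C * ‖x‖ ^ (-α)
  norm_fderiv_le : ∀ x, x ≠ 0 → ‖fderiv ℝ K x‖ ≤ C * ‖x‖ ^ (-α - 1)

/-- `μ` has a density with respect to Lebesgue measure whose `L^q` norm is at most `M`. -/
def HasDensityBound {d : ℕ} (q : ℝ≥0∞) (M : ℝ) (μ : Measure (EuclideanSpace ℝ (Fin d))) : Prop :=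
  ∃ f : EuclideanSpace ℝ (Fin d) → ℝ≥0∞, AEMeasurable f volume ∧
    eLpNorm f q volume ≤ ENNReal.ofReal M ∧ μ = volume.withDensity f

/-- The mean-field velocity `(K * μ)(x) = ∫ K(x - y) dμ(y)`. -/
noncomputable def meanVelocity {d : ℕ}
    (K : EuclideanSpace ℝ (Fin d) → EuclideanSpace ℝ (Fin d))
    (μ : Measure (EuclideanSpace ℝ (Fin d))) (x : EuclideanSpace ℝ (Fin d)) :
    EuclideanSpace ℝ (Fin d) :=
  ∫ y, K (x - y) ∂μ

/-- Weak solutions on `[0, T]`, in `L^∞(0, T; L^q)` and with values in the probability measures,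
of the transport equation `∂ₜρ + (K * ρ) · ∇ρ = 0`, `ρ(0) = ρ⁰`, for a divergence-free `K`.
As usual `ρ` denotes the narrowly continuous representative, and the equation is tested with
`φ ∈ C_c^∞` and integrated in time. -/
structure IsWeakSolution {d : ℕ} (q : ℝ≥0∞)
    (K : EuclideanSpace ℝ (Fin d) → EuclideanSpace ℝ (Fin d))
    (ρ₀ : Measure (EuclideanSpace ℝ (Fin d))) (T : ℝ)
    (ρ : ℝ → Measure (EuclideanSpace ℝ (Fin d))) : Prop where
  isProbabilityMeasure : ∀ t ∈ Set.Icc 0 T, IsProbabilityMeasure (ρ t)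
  densityBound : ∃ M : ℝ, ∀ t ∈ Set.Icc 0 T, HasDensityBound q M (ρ t)
  continuousOn : ∀ φ : BoundedContinuousFunction (EuclideanSpace ℝ (Fin d)) ℝ,
    ContinuousOn (fun t => ∫ x, φ x ∂(ρ t)) (Set.Icc 0 T)
  initial : ρ 0 = ρ₀
  weak_eq : ∀ φ : EuclideanSpace ℝ (Fin d) → ℝ, ContDiff ℝ ∞ φ → HasCompactSupport φ →
    ∀ t ∈ Set.Icc 0 T,
      ∫ x, φ x ∂(ρ t) = ∫ x, φ x ∂ρ₀ +
        ∫ s in (0 : ℝ)..t, ∫ x, fderiv ℝ φ x (meanVelocity K (ρ s) x) ∂(ρ s)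

/-- Collision-free solutions on `[0, T]` of
`X_i' = V_i`, `V_i' = lam (-V_i + (1/N) ∑_{j ≠ i} K(X_i - X_j))` with data `X₀`, `V₀`. -/
structure IsParticleSolution {d N : ℕ}
    (K : EuclideanSpace ℝ (Fin d) → EuclideanSpace ℝ (Fin d)) (lam : ℝ)
    (X₀ V₀ : Fin N → EuclideanSpace ℝ (Fin d)) (T : ℝ)
    (X V : ℝ → Fin N → EuclideanSpace ℝ (Fin d)) : Prop where
  initial_pos : X 0 = X₀
  initial_vel : V 0 = V₀
  no_collision : ∀ t ∈ Set.Icc 0 T, ∀ i j, i ≠ j → X t i ≠ X t j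
  deriv_pos : ∀ t ∈ Set.Icc 0 T, ∀ i,
    HasDerivWithinAt (fun s => X s i) (V t i) (Set.Icc 0 T) t
  deriv_vel : ∀ t ∈ Set.Icc 0 T, ∀ i,
    HasDerivWithinAt (fun s => V s i)
      (lam • (-V t i + (N : ℝ)⁻¹ • ∑ j ∈ Finset.univ.erase i, K (X t i - X t j)))
      (Set.Icc 0 T) t

/-- The Hölder dual exponent `q'` of `q ∈ (1, ∞]`, i.e. `1/q + 1/q' = 1` (`q' = 1` for `q = ∞`). -/
noncomputable def dualExponent (q : ℝ≥0∞) : ℝ := (1 - (q⁻¹).toReal)⁻¹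

/-- The exponent `p (d - α - 1) / ((α + 1) (d + p q'))`, with numerator and denominator divided
by `p`, so that `p = ∞` gives the limit `(d - α - 1) / ((α + 1) q')`. -/
noncomputable def rateExponent (d : ℕ) (α : ℝ) (p q : ℝ≥0∞) : ℝ :=
  (d - α - 1) / ((α + 1) * (d * (p⁻¹).toReal + dualExponent q))

end MeanField

/-!
The particle system is compared with the limit through a coupling `Γ` of the labels `i` with the
initial measure `ρ⁰`, of cost close to `𝒲_p(ρ_N(0), ρ⁰)`. A weak solution `ρ` is transported by
the flow `Φ` of its velocity `u = K * ρ` (`MeanField.IsWeakSolution.exists_flow`), so that `Γ`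
couples `ρ_N(t)` with `ρ(t)` at the cost `η(t)`, the norm of `X_i(t) - Φ_t(y)` in `L^p(Γ)`, and it
is enough to show that `η` grows at most exponentially.

**The limit equation.** The condition on `q` gives `q' (α + 1) < d`, so the weight `|x| ^ (-α-1)`,
which bounds the gradient of `K`, has bounded potential for measures with density in `L^q`, and
`u` is bounded and Lipschitz. A measure-valued solution of the continuity equation for such a
field is the image of its initial value under the flow (`MeanField.IsContinuitySolution.eq_map`);
the proof transports test functions backwards by the explicit Euler scheme with mollified fields.
Applied to Lebesgue measure, which is stationary since `u` is weakly divergence free, this gives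
Liouville's theorem, and hence the bound `M` for the density of `ρ(t)` at all times.

**Stability.** The positions `A_i = X_i + V_i / λ` move with the velocity `F_i = (1/N) ∑ K(X_i -
X_j)`, and the friction keeps `V_i` bounded. By the kernel estimate `|K(a) - K(b)| ≤ c |a - b|
(|a| ^ (-α-1) + |b| ^ (-α-1))` and a Schur test, `F_i - u(Φ_t(y))` is bounded in `L^p(Γ)` by a
multiple of `η`, provided that the kernel sums `S_i = (1/N) ∑_j |X_i - X_j| ^ (-α-1)` stay bounded
(`MeanField.IsLabelCoupling.eLpNorm_particleForce_sub_le`). Gronwall's inequality gives `η(t) ≤ C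
(𝒲_p(ρ_N(0), ρ⁰) + 1/λ) exp (C t)` (`MeanField.IsTrajectory.eLpNorm_displacement_le`).

**Kernel sums.** Let `R` be a scale such that `Γ` displaces only the mass `R ^ (d/q')` by more
than `R / 2`; Chebyshev's inequality provides it in terms of `η`. Pairs at distance more than `R`
are compared with the potential of `ρ(t)`. At most of the order of `N R ^ (d/q')` particles are at
distance less than `R` from a given one, and their contribution is estimated by packing, using the
minimal distance (`MeanField.exists_average_weight_le`). The exponent `θ` in the hypothesis is the
one for which the resulting excess is small. Bounded kernel sums also keep the minimal distance
from shrinking faster than exponentially, since for large `λ` the cone `|V_i - V_j| ≤ (λ/2) |X_i -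
X_j|` is invariant (`MeanField.IsTrajectory.norm_sub_ge`). These estimates close by a continuity
argument (`MeanField.IsWellPrepared.sum_weight_le_of_isTrajectory`), and the lower bound for the
distances also gives existence, through a truncated kernel
(`MeanField.IsWellPrepared.exists_isTrajectory_ne`).
-/


namespace MeanField

/-! ### Singular kernels -/

/-- The weight `‖x‖ ^ (-α - 1)`, the size of the gradient of the kernel; it vanishes at the origin
since `0 ^ y = 0` for `y ≠ 0`. -/
noncomputable def weight {E : Type*} [NormedAddCommGroup E] (α : ℝ) (x : E) : ℝ :=
  ‖x‖ ^ (-α - 1)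

/-- The quantitative properties of the kernel that drive the estimates, valid on the whole space:
the origin and segments through it are covered because `k 0 = 0`. -/
structure SingularKernel {E : Type*} [NormedAddCommGroup E] (α c : ℝ) (k : E → E) : Prop where
  exponent_nonneg : 0 ≤ α
  const_nonneg : 0 ≤ c
  norm_le : ∀ a, ‖k a‖ ≤ c * (‖a‖ * weight α a)
  norm_sub_le : ∀ a b, ‖k a - k b‖ ≤ c * (‖a - b‖ * (weight α a + weight α b))

section Weight

variable {E : Type*} [NormedAddCommGroup E] {α : ℝ}

lemma weight_nonneg (x : E) : 0 ≤ weight α x := Real.rpow_nonneg (norm_nonneg _) _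

lemma weight_zero (hα : 0 ≤ α) : weight α (0 : E) = 0 := by
  rw [weight, norm_zero, Real.zero_rpow (by linarith)]

lemma weight_neg (x : E) : weight α (-x) = weight α x := by rw [weight, norm_neg, weight]

lemma norm_mul_weight {x : E} (hx : x ≠ 0) : ‖x‖ * weight α x = ‖x‖ ^ (-α) := by
  have h : 0 < ‖x‖ := norm_pos_iff.2 hx
  rw [weight, show -α - 1 = -α + (-1) by ring, Real.rpow_add h, Real.rpow_neg_one]
  field_simp

lemma weight_le_of_le_norm (hα : 0 ≤ α) {x : E} {s : ℝ} (hs : 0 < s) (h : s ≤ ‖x‖) :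
    weight α x ≤ s ^ (-α - 1) :=
  Real.rpow_le_rpow_of_nonpos hs h (by linarith)

lemma norm_mul_weight_le (hα : 0 ≤ α) (x : E) : ‖x‖ * weight α x ≤ 1 + weight α x := by
  rcases le_total ‖x‖ 1 with h | h
  · have := weight_nonneg (α := α) x
    nlinarith
  · have hx : x ≠ 0 := by rw [← norm_pos_iff]; linarith
    rw [norm_mul_weight hx]
    have : ‖x‖ ^ (-α) ≤ 1 := Real.rpow_le_one_of_one_le_of_nonpos h (by linarith)
    linarith [weight_nonneg (α := α) x]

/-- Doubling: the weight at a point controls the weight at a point that is at most `3/2` times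
as far away. -/
lemma weight_le_of_norm_le (hα : 0 ≤ α) {x y : E} (hx : x ≠ 0) (hy : y ≠ 0)
    (h : ‖y‖ ≤ 3 / 2 * ‖x‖) :
    weight α x ≤ (3 / 2 : ℝ) ^ (α + 1) * weight α y := by
  have hx' : 0 < ‖x‖ := norm_pos_iff.2 hx
  have hy' : 0 < ‖y‖ := norm_pos_iff.2 hy
  have h1 : weight α x ≤ (‖y‖ * (3 / 2)⁻¹) ^ (-α - 1) :=
    weight_le_of_le_norm hα (by positivity) (by linarith)
  refine h1.trans (le_of_eq ?_)
  rw [Real.mul_rpow hy'.le (by norm_num), weight, Real.inv_rpow (by norm_num), mul_comm,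
    ← Real.rpow_neg (by norm_num)]
  congr 2; ring

lemma measurable_weight [MeasurableSpace E] [OpensMeasurableSpace E] :
    Measurable (weight α : E → ℝ) := measurable_norm.pow_const _

lemma continuousAt_weight {x : E} (hx : x ≠ 0) : ContinuousAt (weight α) x :=
  continuous_norm.continuousAt.rpow_const (Or.inl (norm_ne_zero_iff.2 hx))

end Weight

namespace SingularKernel

variable {E : Type*} [NormedAddCommGroup E] {α c : ℝ} {k : E → E}

lemma map_zero (hk : SingularKernel α c k) : k 0 = 0 := by
  simpa using hk.norm_le 0

lemma norm_le_one_add (hk : SingularKernel α c k) (a : E) : ‖k a‖ ≤ c * (1 + weight α a) :=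
  (hk.norm_le a).trans
    (mul_le_mul_of_nonneg_left (norm_mul_weight_le hk.exponent_nonneg a) hk.const_nonneg)

lemma continuousAt (hk : SingularKernel α c k) {x : E} (hx : x ≠ 0) : ContinuousAt k x := by
  rw [ContinuousAt, tendsto_iff_norm_sub_tendsto_zero]
  have h : Tendsto (fun y => c * (‖y - x‖ * (weight α y + weight α x))) (𝓝 x)
      (𝓝 (c * (‖x - x‖ * (weight α x + weight α x)))) := by
    refine Tendsto.const_mul _ (Tendsto.mul ?_ ?_)
    · exact (continuous_id.sub continuous_const).norm.continuousAt
    · exact (continuousAt_weight hx).tendsto.add_const _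
  rw [sub_self, norm_zero, zero_mul, mul_zero] at h
  exact squeeze_zero (fun y => norm_nonneg _) (fun y => hk.norm_sub_le y x) h

lemma continuousOn (hk : SingularKernel α c k) : ContinuousOn k {0}ᶜ :=
  fun _ hx => (hk.continuousAt hx).continuousWithinAt

lemma measurable [MeasurableSpace E] [BorelSpace E] (hk : SingularKernel α c k) :
    Measurable k := by
  exact measurable_of_measurable_on_compl_singleton 0
    (continuousOn_iff_continuous_domRestrict.1 hk.continuousOn).measurable

/-- The kernel multiplied by a Lipschitz cutoff that vanishes for `‖x‖ ≤ δ / 2` and equals `1` for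
`‖x‖ ≥ δ`. -/
noncomputable def truncate [NormedSpace ℝ E] (δ : ℝ) (k : E → E) (x : E) : E :=
  min 1 (max 0 (2 * ‖x‖ / δ - 1)) • k x

section Truncate

variable [NormedSpace ℝ E] {δ : ℝ}

lemma truncate_eq (hδ : 0 < δ) {x : E} (hx : δ ≤ ‖x‖) : truncate δ k x = k x := by
  have h : (1 : ℝ) ≤ 2 * ‖x‖ / δ - 1 := by
    rw [le_sub_iff_add_le, le_div_iff₀ hδ]; linarith
  rw [truncate, max_eq_right (by linarith), min_eq_left h, one_smul]

lemma truncate_eq_zero (hδ : 0 < δ) {x : E} (hx : ‖x‖ ≤ δ / 2) : truncate δ k x = 0 := by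
  have h : 2 * ‖x‖ / δ - 1 ≤ 0 := by
    rw [sub_nonpos, div_le_iff₀ hδ]; linarith
  rw [truncate, max_eq_left h, min_eq_right zero_le_one, zero_smul]

lemma norm_truncate_le (x : E) : ‖truncate δ k x‖ ≤ ‖k x‖ := by
  rw [truncate, norm_smul, Real.norm_eq_abs, abs_of_nonneg (by positivity)]
  exact mul_le_of_le_one_left (norm_nonneg _) (min_le_left _ _)

lemma norm_truncate_le_const (hk : SingularKernel α c k) (hδ : 0 < δ) (x : E) :
    ‖truncate δ k x‖ ≤ c * (1 + (δ / 2) ^ (-α - 1)) := by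
  rcases le_total ‖x‖ (δ / 2) with h | h
  · rw [truncate_eq_zero hδ h, norm_zero]
    have := hk.const_nonneg
    positivity
  · refine (norm_truncate_le x).trans ((hk.norm_le_one_add x).trans ?_)
    have := weight_le_of_le_norm hk.exponent_nonneg (half_pos hδ) h
    exact mul_le_mul_of_nonneg_left (by linarith) hk.const_nonneg

/-- The truncated kernel is globally Lipschitz. -/
lemma exists_lipschitzWith_truncate (hk : SingularKernel α c k) (hδ : 0 < δ) :
    ∃ L, LipschitzWith L (truncate δ k) := by
  set w : ℝ := (δ / 2) ^ (-α - 1)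
  have hw : 0 ≤ w := by positivity
  have hc := hk.const_nonneg
  have hχ : ∀ x y : E, |min 1 (max 0 (2 * ‖x‖ / δ - 1)) - min 1 (max 0 (2 * ‖y‖ / δ - 1))|
      ≤ 2 / δ * ‖x - y‖ := by
    intro x y
    have h1 : |min 1 (max 0 (2 * ‖x‖ / δ - 1)) - min 1 (max 0 (2 * ‖y‖ / δ - 1))|
        ≤ |(2 * ‖x‖ / δ - 1) - (2 * ‖y‖ / δ - 1)| := by
      refine (abs_min_sub_min_le_max _ _ _ _).trans ?_
      rw [sub_self, abs_zero, max_eq_right (abs_nonneg _)]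
      refine (abs_max_sub_max_le_max _ _ _ _).trans ?_
      rw [sub_self, abs_zero, max_eq_right (abs_nonneg _)]
    refine h1.trans ?_
    rw [show (2 * ‖x‖ / δ - 1) - (2 * ‖y‖ / δ - 1) = 2 / δ * (‖x‖ - ‖y‖) by ring, abs_mul,
      abs_of_pos (by positivity)]
    exact mul_le_mul_of_nonneg_left (abs_norm_sub_norm_le x y) (by positivity)
  set L : ℝ := c * (2 * w) + 2 / δ * (c * (1 + w))
  have key : ∀ x y : E, δ / 2 ≤ ‖y‖ → ‖truncate δ k x - truncate δ k y‖ ≤ L * ‖x - y‖ := by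
    intro x y hy
    have hwy : weight α y ≤ w := weight_le_of_le_norm hk.exponent_nonneg (half_pos hδ) hy
    have hky : ‖k y‖ ≤ c * (1 + w) :=
      (hk.norm_le_one_add y).trans (mul_le_mul_of_nonneg_left (by linarith) hc)
    have e : truncate δ k x - truncate δ k y
        = min 1 (max 0 (2 * ‖x‖ / δ - 1)) • (k x - k y)
          + (min 1 (max 0 (2 * ‖x‖ / δ - 1)) - min 1 (max 0 (2 * ‖y‖ / δ - 1))) • k y := by
      simp only [truncate, smul_sub, sub_smul]; abel
    have e1 : ‖min 1 (max 0 (2 * ‖x‖ / δ - 1)) • (k x - k y)‖ ≤ c * (2 * w) * ‖x - y‖ := by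
      rcases le_total ‖x‖ (δ / 2) with h | h
      · have h0 : 2 * ‖x‖ / δ - 1 ≤ 0 := by
          rw [sub_nonpos, div_le_iff₀ hδ]; linarith
        rw [max_eq_left h0, min_eq_right zero_le_one, zero_smul, norm_zero]
        positivity
      · have hwx : weight α x ≤ w := weight_le_of_le_norm hk.exponent_nonneg (half_pos hδ) h
        rw [norm_smul, Real.norm_eq_abs, abs_of_nonneg (by positivity)]
        calc min 1 (max 0 (2 * ‖x‖ / δ - 1)) * ‖k x - k y‖ ≤ 1 * ‖k x - k y‖ :=
              mul_le_mul_of_nonneg_right (min_le_left _ _) (norm_nonneg _)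
          _ ≤ c * (‖x - y‖ * (weight α x + weight α y)) := by
              rw [one_mul]; exact hk.norm_sub_le x y
          _ ≤ c * (‖x - y‖ * (w + w)) := by gcongr
          _ = _ := by ring
    rw [e]
    refine (norm_add_le _ _).trans ?_
    rw [norm_smul (_ - _), Real.norm_eq_abs]
    calc _ ≤ c * (2 * w) * ‖x - y‖ + 2 / δ * ‖x - y‖ * (c * (1 + w)) :=
          add_le_add e1 (mul_le_mul (hχ x y) hky (norm_nonneg _) (by positivity))
      _ = _ := by ring
  have hL : 0 ≤ L := by positivity
  refine ⟨L.toNNReal, LipschitzWith.of_dist_le_mul fun x y => ?_⟩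
  rw [dist_eq_norm, dist_eq_norm, Real.coe_toNNReal _ hL]
  rcases le_total (δ / 2) ‖y‖ with hy | hy
  · exact key x y hy
  rcases le_total (δ / 2) ‖x‖ with hx | hx
  · rw [norm_sub_rev, norm_sub_rev x]; exact key y x hx
  · rw [truncate_eq_zero hδ hx, truncate_eq_zero hδ hy, sub_self, norm_zero]
    positivity

lemma norm_sub_truncate_le (hk : SingularKernel α c k) (hδ : 0 < δ) (x : E) :
    ‖k x - truncate δ k x‖ ≤ c * δ * weight α x := by
  have hw := weight_nonneg (α := α) x
  have hc := hk.const_nonneg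
  rcases le_total δ ‖x‖ with h | h
  · rw [truncate_eq hδ h, sub_self, norm_zero]; positivity
  · have h1 : ‖k x - truncate δ k x‖ ≤ ‖k x‖ := by
      have : k x - truncate δ k x = (1 - min 1 (max 0 (2 * ‖x‖ / δ - 1))) • k x := by
        rw [sub_smul, one_smul, truncate]
      rw [this, norm_smul, Real.norm_eq_abs, abs_of_nonneg (by simp)]
      refine mul_le_of_le_one_left (norm_nonneg _) ?_
      have : (0 : ℝ) ≤ min 1 (max 0 (2 * ‖x‖ / δ - 1)) := by positivity
      linarith
    calc _ ≤ c * (‖x‖ * weight α x) := h1.trans (hk.norm_le x)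
      _ ≤ c * (δ * weight α x) := by gcongr
      _ = _ := by ring

end Truncate

end SingularKernel

/-- The kernel with its (irrelevant) value at the origin set to `0`. -/
noncomputable def puncture {E : Type*} [Zero E] (K : E → E) (x : E) : E :=
  open Classical in if x = 0 then 0 else K x

lemma puncture_of_ne {E : Type*} [Zero E] (K : E → E) {x : E} (hx : x ≠ 0) :
    puncture K x = K x := if_neg hx

lemma puncture_zero {E : Type*} [Zero E] (K : E → E) : puncture K 0 = 0 := if_pos rfl

/-- Away from the origin the gradient bound integrates along segments; when the segment comes close
to the origin, `‖a - b‖` is comparable with the larger norm and the size bound is enough. -/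
theorem IsKernel.singularKernel {d : ℕ} {α C : ℝ}
    {K : EuclideanSpace ℝ (Fin d) → EuclideanSpace ℝ (Fin d)} (hα : 0 ≤ α)
    (hK : IsKernel α C K) :
    SingularKernel α (|C| * ((2 : ℝ) ^ (α + 1) + 4)) (puncture K) := by
  have h2 : (0 : ℝ) < (2 : ℝ) ^ (α + 1) := by positivity
  have hC := abs_nonneg C
  have hw := fun x : EuclideanSpace ℝ (Fin d) => weight_nonneg (α := α) x
  have hle : ∀ a, ‖puncture K a‖ ≤ |C| * (‖a‖ * weight α a) := by
    intro a
    by_cases ha : a = 0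
    · simp [ha, puncture_zero]
    · rw [puncture_of_ne K ha, norm_mul_weight ha]
      exact (hK.norm_le a ha).trans (by gcongr; exact le_abs_self C)
  have key : ∀ a b : EuclideanSpace ℝ (Fin d), ‖a‖ ≤ ‖b‖ → ‖puncture K a - puncture K b‖ ≤
      |C| * ((2 : ℝ) ^ (α + 1) + 4) * (‖a - b‖ * (weight α a + weight α b)) := by
    intro a b hab
    by_cases ha : a = 0
    · subst ha
      rw [puncture_zero, zero_sub, norm_neg, zero_sub, norm_neg, weight_zero hα, zero_add]
      refine (hle b).trans ?_
      have := mul_nonneg hC (mul_nonneg (norm_nonneg b) (hw b))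
      nlinarith
    have ha' : 0 < ‖a‖ := norm_pos_iff.2 ha
    rcases le_total ‖a - b‖ (‖a‖ / 2) with h | h
    · have hseg : ∀ x ∈ segment ℝ a b, ‖a‖ / 2 ≤ ‖x‖ := by
        intro x hx
        have h1 : x ∈ Metric.closedBall a (‖a‖ / 2) :=
          (convex_closedBall a _).segment_subset (Metric.mem_closedBall_self (by positivity))
            (by rwa [Metric.mem_closedBall, dist_comm, dist_eq_norm]) hx
        rw [Metric.mem_closedBall, dist_eq_norm] at h1
        have := norm_sub_norm_le a x
        rw [norm_sub_rev] at this
        linarith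
      have hne : ∀ x ∈ segment ℝ a b, x ≠ 0 := fun x hx => by
        rw [← norm_pos_iff]; linarith [hseg x hx]
      have hmv := (convex_segment a b).norm_image_sub_le_of_norm_hasFDerivWithin_le
        (𝕜 := ℝ) (f := K) (f' := fderiv ℝ K) (C := |C| * ((2 : ℝ) ^ (α + 1) * weight α a))
        (fun x hx => (hK.differentiableAt x (hne x hx)).hasFDerivAt.hasFDerivWithinAt)
        (fun x hx => ?_) (right_mem_segment ℝ a b) (left_mem_segment ℝ a b)
      · rw [puncture_of_ne K ha, puncture_of_ne K (hne b (right_mem_segment ℝ a b))]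
        refine hmv.trans ?_
        have e1 : 0 ≤ |C| * ‖a - b‖ * weight α a := by have := hw a; positivity
        have e2 : 0 ≤ |C| * ‖a - b‖ * weight α b := by have := hw b; positivity
        nlinarith [mul_nonneg h2.le e2]
      · refine (hK.norm_fderiv_le x (hne x hx)).trans ?_
        have e : ‖x‖ ^ (-α - 1) ≤ (2 : ℝ) ^ (α + 1) * weight α a := by
          refine (weight_le_of_le_norm hα (half_pos ha') (hseg x hx)).trans (le_of_eq ?_)
          rw [Real.div_rpow ha'.le (by norm_num), weight, div_eq_mul_inv,
            ← Real.rpow_neg (by norm_num), mul_comm]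
          congr 2; ring
        exact mul_le_mul (le_abs_self C) e (by positivity) hC
    · have hb : ‖b‖ ≤ 3 * ‖a - b‖ := by
        have := norm_sub_norm_le b a
        rw [norm_sub_rev] at this
        linarith
      refine (norm_sub_le _ _).trans ((add_le_add (hle a) (hle b)).trans ?_)
      have e1 : ‖a‖ * weight α a ≤ 2 * ‖a - b‖ * weight α a :=
        mul_le_mul_of_nonneg_right (by linarith) (hw a)
      have e2 : ‖b‖ * weight α b ≤ 3 * ‖a - b‖ * weight α b :=
        mul_le_mul_of_nonneg_right hb (hw b)
      have e3 : 0 ≤ ‖a - b‖ * weight α a := mul_nonneg (norm_nonneg _) (hw a)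
      have e4 : 0 ≤ ‖a - b‖ * weight α b := mul_nonneg (norm_nonneg _) (hw b)
      rw [← mul_add, mul_assoc]
      refine mul_le_mul_of_nonneg_left ?_ hC
      nlinarith
  refine ⟨hα, by positivity, fun a => ?_, fun a b => ?_⟩
  · refine (hle a).trans ?_
    have := mul_nonneg hC (mul_nonneg (norm_nonneg a) (hw a))
    nlinarith
  · rcases le_total ‖a‖ ‖b‖ with h | h
    · exact key a b h
    · rw [norm_sub_rev, norm_sub_rev a, add_comm (weight α a)]; exact key b a h

/-! ### Measures with bounded density -/

/-- The form in which a bound `M` on the `L^q` norm of the density of `μ` is used, with `r` the dual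
exponent of `q`: `∫ h dμ ≤ M ‖h‖_{L^r}` for all `h ≥ 0`. Unlike the density itself, it passes
to the image under a volume preserving map without inverting that map. -/
def DensityBound {E : Type*} [MeasureSpace E] (r M : ℝ) (μ : Measure E) : Prop :=
  ∀ h : E → ℝ≥0∞, Measurable h →
    ∫⁻ x, h x ∂μ ≤ ENNReal.ofReal M * (∫⁻ x, h x ^ r) ^ (1 / r)

lemma one_le_dualExponent {q : ℝ≥0∞} (hq : 1 < q) : 1 ≤ dualExponent q := by
  have h1 : (q⁻¹).toReal < 1 := by
    have : q⁻¹ < 1 := ENNReal.inv_lt_one.2 hq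
    simpa using (ENNReal.toReal_lt_toReal this.ne_top ENNReal.one_ne_top).2 this
  have h0 : 0 ≤ (q⁻¹).toReal := ENNReal.toReal_nonneg
  exact (one_le_inv₀ (by linarith)).2 (by linarith)

lemma HasDensityBound.densityBound {d : ℕ} {q : ℝ≥0∞} {M : ℝ}
    {μ : Measure (EuclideanSpace ℝ (Fin d))} (hq : 1 < q) (h : HasDensityBound q M μ) :
    DensityBound (dualExponent q) M μ := by
  obtain ⟨f, hf, hfM, rfl⟩ := h
  intro g hg
  rw [lintegral_withDensity_eq_lintegral_mul₀ hf hg.aemeasurable]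
  by_cases hqt : q = ⊤
  · subst hqt
    have hr : dualExponent (⊤ : ℝ≥0∞) = 1 := by simp [dualExponent]
    simp only [hr, ENNReal.rpow_one, div_one]
    rw [← lintegral_const_mul _ hg]
    refine lintegral_mono_ae ?_
    rw [eLpNorm_exponent_top] at hfM
    filter_upwards [ae_le_eLpNormEssSup (f := f) (μ := volume)] with x hx
    exact mul_le_mul_left (hx.trans hfM) _
  · have hq1 : 1 < q.toReal := by
      simpa using (ENNReal.toReal_lt_toReal ENNReal.one_ne_top hqt).2 hq
    have hconj : q.toReal.HolderConjugate (dualExponent q) := by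
      rw [Real.holderConjugate_iff]
      refine ⟨hq1, ?_⟩
      rw [dualExponent, inv_inv, ENNReal.toReal_inv]
      ring
    refine (ENNReal.lintegral_mul_le_Lp_mul_Lq volume hconj hf hg.aemeasurable).trans ?_
    refine mul_le_mul_left ?_ _
    rw [eLpNorm_eq_lintegral_rpow_enorm_toReal (by positivity) hqt] at hfM
    simpa using hfM

lemma DensityBound.map {E : Type*} [MeasureSpace E] {r M : ℝ} {μ : Measure E} {φ : E → E}
    (hμ : DensityBound r M μ) (hφ : MeasurePreserving φ) : DensityBound r M (μ.map φ) := by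
  intro h hh
  rw [lintegral_map hh hφ.measurable]
  refine (hμ _ (hh.comp hφ.measurable)).trans (le_of_eq ?_)
  simp only [Function.comp_apply]
  rw [hφ.lintegral_comp (f := fun x => h x ^ r) (hh.pow_const r)]

section Integrals

variable {E : Type*} [NormedAddCommGroup E] [InnerProductSpace ℝ E] [FiniteDimensional ℝ E]
  [MeasurableSpace E] [BorelSpace E]

local notation "dim" => Module.finrank ℝ E

lemma DensityBound.absolutelyContinuous {r M : ℝ} {μ : Measure E} (hr : 0 < r)
    (hμ : DensityBound r M μ) : μ ≪ volume := by
  refine Measure.AbsolutelyContinuous.mk fun s hs h0 => ?_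
  have := hμ (s.indicator 1) (measurable_one.indicator hs)
  rw [lintegral_indicator_one hs] at this
  have h2 : ∀ x, (s.indicator (1 : E → ℝ≥0∞) x) ^ r = s.indicator 1 x := by
    intro x
    by_cases hx : x ∈ s <;> simp [hx, hr]
  simp only [h2] at this
  rw [lintegral_indicator_one hs, h0, ENNReal.zero_rpow_of_pos (by positivity), mul_zero] at this
  exact le_antisymm this bot_le

lemma lintegral_norm_rpow_unit_ball_lt_top [Nontrivial E] {a : ℝ} (ha : a < dim) :
    ∫⁻ x in Metric.ball (0 : E) 1, ENNReal.ofReal (‖x‖ ^ (-a)) < ⊤ := by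
  have h : IntegrableOn (fun x : E => ‖x‖ ^ (-a)) (Metric.ball 0 1) := by
    rw [integrableOn_fun_norm_addHaar volume (f := fun y => y ^ (-a))]
    have h1 : IntegrableOn (fun y : ℝ => y ^ ((dim : ℝ) - 1 - a)) (Set.Ioo 0 1) := by
      have := (intervalIntegral.intervalIntegrable_rpow' (a := 0) (b := 1)
        (r := (dim : ℝ) - 1 - a) (by linarith))
      rw [intervalIntegrable_iff_integrableOn_Ioo_of_le zero_le_one] at this
      exact this
    refine h1.congr_fun (fun y hy => ?_) measurableSet_Ioo
    have hd : 1 ≤ dim := Module.finrank_pos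
    simp only [smul_eq_mul]
    rw [← Real.rpow_natCast, ← Real.rpow_add hy.1, Nat.cast_sub hd]
    congr 1; push_cast; ring
  have h2 := h.2
  rw [HasFiniteIntegral] at h2
  refine lt_of_le_of_lt (lintegral_mono fun x => ?_) h2
  rw [Real.enorm_eq_ofReal (by positivity)]

lemma lintegral_norm_rpow_ball {a s : ℝ} (hs : 0 < s) :
    ∫⁻ x in Metric.ball (0 : E) s, ENNReal.ofReal (‖x‖ ^ (-a))
      = ENNReal.ofReal (s ^ ((dim : ℝ) - a)) *
        ∫⁻ x in Metric.ball (0 : E) 1, ENNReal.ofReal (‖x‖ ^ (-a)) := by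
  have hmap := Measure.map_addHaar_smul (volume : Measure E) hs.ne'
  have hvol : (volume : Measure E)
      = ENNReal.ofReal (s ^ dim) • Measure.map (fun x : E => s • x) volume := by
    have : Measure.map (fun x : E => s • x) volume = Measure.map (s • ·) (volume : Measure E) := rfl
    rw [this, hmap, smul_smul, ← ENNReal.ofReal_mul (by positivity), abs_of_pos (by positivity),
      mul_inv_cancel₀ (by positivity), ENNReal.ofReal_one, one_smul]
  have hmeas : Measurable fun x : E => ENNReal.ofReal (‖x‖ ^ (-a)) := by fun_prop
  rw [← lintegral_indicator measurableSet_ball, ← lintegral_indicator measurableSet_ball]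
  conv_lhs => rw [hvol]
  rw [lintegral_smul_measure, lintegral_map (hmeas.indicator measurableSet_ball) (by fun_prop),
    smul_eq_mul, ← lintegral_const_mul _ (hmeas.indicator measurableSet_ball),
    ← lintegral_const_mul' _ _ ENNReal.ofReal_ne_top]
  congr 1 with x
  by_cases hx : x ∈ Metric.ball (0 : E) 1
  · have hx' : s • x ∈ Metric.ball (0 : E) s := by
      rw [mem_ball_zero_iff] at hx ⊢
      rw [norm_smul, Real.norm_eq_abs, abs_of_pos hs]; nlinarith
    rw [Set.indicator_of_mem hx, Set.indicator_of_mem hx', ← ENNReal.ofReal_mul (by positivity),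
      ← ENNReal.ofReal_mul (by positivity)]
    congr 1
    rw [norm_smul, Real.norm_eq_abs, abs_of_pos hs, Real.mul_rpow hs.le (norm_nonneg _),
      ← mul_assoc, ← Real.rpow_natCast, ← Real.rpow_add hs]
    rfl
  · have hx' : s • x ∉ Metric.ball (0 : E) s := by
      rw [mem_ball_zero_iff] at hx ⊢
      rw [norm_smul, Real.norm_eq_abs, abs_of_pos hs]; nlinarith
    rw [Set.indicator_of_notMem hx, Set.indicator_of_notMem hx', mul_zero, mul_zero]

/-- The mass of the kernel weight is bounded uniformly over all probability measures with the given
density bound. -/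
theorem exists_lintegral_weight_le [Nontrivial E] {α r : ℝ} (M : ℝ) (hα : 0 ≤ α) (hr : 1 ≤ r)
    (hdim : r * (α + 1) < dim) :
    ∃ C : ℝ, 0 ≤ C ∧ ∀ μ : Measure E, IsProbabilityMeasure μ → DensityBound r M μ →
      ∀ x, ∫⁻ y, ENNReal.ofReal (weight α (x - y)) ∂μ ≤ ENNReal.ofReal C := by
  set I := ∫⁻ x in Metric.ball (0 : E) 1, ENNReal.ofReal (‖x‖ ^ (-(r * (α + 1))))
  have hI : I < ⊤ := lintegral_norm_rpow_unit_ball_lt_top hdim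
  have hfin : ENNReal.ofReal M * I ^ (1 / r) + 1 ≠ ⊤ := by
    have : I ^ (1 / r) ≠ ⊤ := ENNReal.rpow_ne_top_of_nonneg (by positivity) hI.ne
    exact ENNReal.add_ne_top.2 ⟨ENNReal.mul_ne_top ENNReal.ofReal_ne_top this, ENNReal.one_ne_top⟩
  refine ⟨(ENNReal.ofReal M * I ^ (1 / r) + 1).toReal, ENNReal.toReal_nonneg, fun μ _ hμ x => ?_⟩
  rw [ENNReal.ofReal_toReal hfin]
  have hw : Measurable fun y : E => ENNReal.ofReal (weight α (x - y)) :=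
    (measurable_weight.comp (measurable_const.sub measurable_id)).ennreal_ofReal
  have hsplit : ∀ y : E, ENNReal.ofReal (weight α (x - y)) ≤
      (Metric.ball x 1).indicator (fun y => ENNReal.ofReal (weight α (x - y))) y + 1 := by
    intro y
    by_cases hy : y ∈ Metric.ball x 1
    · rw [Set.indicator_of_mem hy]; exact le_self_add
    · rw [Set.indicator_of_notMem hy, zero_add, ← ENNReal.ofReal_one]
      refine ENNReal.ofReal_le_ofReal ?_
      have h1 : 1 ≤ ‖x - y‖ := by
        rw [Metric.mem_ball, dist_comm, dist_eq_norm] at hy; linarith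
      simpa using weight_le_of_le_norm hα one_pos h1
  calc ∫⁻ y, ENNReal.ofReal (weight α (x - y)) ∂μ
      ≤ ∫⁻ y, ((Metric.ball x 1).indicator (fun y => ENNReal.ofReal (weight α (x - y))) y + 1) ∂μ :=
        lintegral_mono hsplit
    _ = ∫⁻ y, (Metric.ball x 1).indicator (fun y => ENNReal.ofReal (weight α (x - y))) y ∂μ + 1 := by
        rw [lintegral_add_right _ measurable_const]; simp
    _ ≤ _ := by
        refine add_le_add_left ((hμ _ (hw.indicator measurableSet_ball)).trans ?_) _
        refine mul_le_mul_right (ENNReal.rpow_le_rpow (le_of_eq ?_) (by positivity)) _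
        rw [← lintegral_sub_left_eq_self _ x]
        simp only [I]
        rw [← lintegral_indicator measurableSet_ball]
        congr 1 with y
        by_cases hy : y ∈ Metric.ball (0 : E) 1
        · have hy' : x - y ∈ Metric.ball x 1 := by simpa [dist_eq_norm] using hy
          rw [Set.indicator_of_mem hy, Set.indicator_of_mem hy', sub_sub_cancel,
            ENNReal.ofReal_rpow_of_nonneg (weight_nonneg _) (by positivity), weight,
            ← Real.rpow_mul (norm_nonneg _)]
          congr 2; ring
        · have hy' : x - y ∉ Metric.ball x 1 := by simpa [dist_eq_norm] using hy
          rw [Set.indicator_of_notMem hy, Set.indicator_of_notMem hy',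
            ENNReal.zero_rpow_of_pos (by positivity)]

/-- Density bounds give a Frostman-type bound on the mass of balls. -/
theorem exists_measure_ball_le {r : ℝ} (M : ℝ) (hr : 1 ≤ r) :
    ∃ C : ℝ, 0 ≤ C ∧ ∀ μ : Measure E, DensityBound r M μ →
      ∀ x, ∀ s > 0, μ (Metric.ball x s) ≤ ENNReal.ofReal (C * s ^ ((dim : ℝ) / r)) := by
  have hfin : ENNReal.ofReal M * volume (Metric.ball (0 : E) 1) ^ (1 / r) ≠ ⊤ :=
    ENNReal.mul_ne_top ENNReal.ofReal_ne_top
      (ENNReal.rpow_ne_top_of_nonneg (by positivity) measure_ball_lt_top.ne)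
  refine ⟨(ENNReal.ofReal M * volume (Metric.ball (0 : E) 1) ^ (1 / r)).toReal,
    ENNReal.toReal_nonneg, fun μ hμ x s hs => ?_⟩
  rw [ENNReal.ofReal_mul ENNReal.toReal_nonneg, ENNReal.ofReal_toReal hfin]
  have h := hμ ((Metric.ball x s).indicator 1) (measurable_one.indicator measurableSet_ball)
  have h2 : ∀ y, ((Metric.ball x s).indicator (1 : E → ℝ≥0∞) y) ^ r
      = (Metric.ball x s).indicator 1 y := by
    intro y
    by_cases hx : y ∈ Metric.ball x s
    · simp [Set.indicator_of_mem hx]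
    · rw [Set.indicator_of_notMem hx, ENNReal.zero_rpow_of_pos (by linarith)]
  simp only [h2] at h
  rw [lintegral_indicator_one measurableSet_ball, lintegral_indicator_one measurableSet_ball,
    Measure.addHaar_ball_of_pos volume x hs, ENNReal.mul_rpow_of_nonneg _ _ (by positivity)] at h
  refine h.trans (le_of_eq ?_)
  rw [mul_assoc, mul_comm (ENNReal.ofReal _ ^ _), ENNReal.ofReal_rpow_of_nonneg (by positivity)
    (by positivity), ← Real.rpow_natCast, ← Real.rpow_mul hs.le, mul_one_div]

/-- Bathtub principle for the weight: among sets of given volume a ball centred at the singularity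
has the largest weight. -/
theorem exists_setLIntegral_weight_le [Nontrivial E] {α : ℝ} (hα : 0 ≤ α) (hdim : α + 1 < dim) :
    ∃ C : ℝ, 0 ≤ C ∧ ∀ (A : Set E) (v : ℝ), 0 < v → volume A ≤ ENNReal.ofReal v → ∀ x : E,
      ∫⁻ y in A, ENNReal.ofReal (weight α (x - y))
        ≤ ENNReal.ofReal (C * v ^ (1 - (α + 1) / dim)) := by
  set I := ∫⁻ x in Metric.ball (0 : E) 1, ENNReal.ofReal (‖x‖ ^ (-(α + 1)))
  have hI : I < ⊤ := lintegral_norm_rpow_unit_ball_lt_top hdim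
  refine ⟨I.toReal + 1, by positivity, fun A v hv hA x => ?_⟩
  have hdpos : (0 : ℝ) < dim := by linarith
  set s : ℝ := v ^ (1 / (dim : ℝ))
  have hs : 0 < s := by positivity
  have hsv : s ^ (dim : ℝ) = v := by
    rw [← Real.rpow_mul hv.le, one_div_mul_cancel hdpos.ne', Real.rpow_one]
  have he : s ^ ((dim : ℝ) - (α + 1)) = v ^ (1 - (α + 1) / dim) := by
    rw [← Real.rpow_mul hv.le]
    congr 1; field_simp
  have hw : Measurable fun y : E => ENNReal.ofReal (weight α (x - y)) :=
    (measurable_weight.comp (measurable_const.sub measurable_id)).ennreal_ofReal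
  have hsplit : ∀ y : E, ENNReal.ofReal (weight α (x - y)) ≤
      (Metric.ball x s).indicator (fun y => ENNReal.ofReal (weight α (x - y))) y
        + ENNReal.ofReal (s ^ (-α - 1)) := by
    intro y
    by_cases hy : y ∈ Metric.ball x s
    · rw [Set.indicator_of_mem hy]; exact le_self_add
    · rw [Set.indicator_of_notMem hy, zero_add]
      refine ENNReal.ofReal_le_ofReal ?_
      have h1 : s ≤ ‖x - y‖ := by
        rw [Metric.mem_ball, dist_comm, dist_eq_norm] at hy; linarith
      exact weight_le_of_le_norm hα hs h1
  have hball : ∫⁻ y, (Metric.ball x s).indicator (fun y => ENNReal.ofReal (weight α (x - y))) y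
      = ENNReal.ofReal (s ^ ((dim : ℝ) - (α + 1))) * I := by
    rw [← lintegral_norm_rpow_ball hs, ← lintegral_indicator measurableSet_ball,
      ← lintegral_sub_left_eq_self _ x]
    congr 1 with y
    by_cases hy : y ∈ Metric.ball (0 : E) s
    · have hy' : x - y ∈ Metric.ball x s := by simpa [dist_eq_norm] using hy
      rw [Set.indicator_of_mem hy, Set.indicator_of_mem hy', sub_sub_cancel, weight]
      congr 2; ring
    · have hy' : x - y ∉ Metric.ball x s := by simpa [dist_eq_norm] using hy
      rw [Set.indicator_of_notMem hy, Set.indicator_of_notMem hy']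
  calc ∫⁻ y in A, ENNReal.ofReal (weight α (x - y))
      ≤ ∫⁻ y in A, ((Metric.ball x s).indicator (fun y => ENNReal.ofReal (weight α (x - y))) y
        + ENNReal.ofReal (s ^ (-α - 1))) := lintegral_mono hsplit
    _ = (∫⁻ y in A, (Metric.ball x s).indicator (fun y => ENNReal.ofReal (weight α (x - y))) y)
        + ENNReal.ofReal (s ^ (-α - 1)) * volume A := by
        rw [lintegral_add_right _ measurable_const]; simp
    _ ≤ ENNReal.ofReal (s ^ ((dim : ℝ) - (α + 1))) * I
        + ENNReal.ofReal (s ^ (-α - 1)) * ENNReal.ofReal v := by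
        refine add_le_add (hball ▸ setLIntegral_le_lintegral _ _) (mul_le_mul_right hA _)
    _ = _ := by
        rw [← ENNReal.ofReal_mul (by positivity)]
        have e2 : s ^ (-α - 1) * v = s ^ ((dim : ℝ) - (α + 1)) := by
          rw [← hsv, ← Real.rpow_add hs]; congr 1; ring
        rw [e2, he, add_mul, one_mul, ENNReal.ofReal_add (by positivity) (by positivity),
          ENNReal.ofReal_mul ENNReal.toReal_nonneg, ENNReal.ofReal_toReal hI.ne, mul_comm I]

end Integrals

/-! ### The mean-field velocity -/

/-- The potential of `μ` with respect to the kernel weight is at most `C`. -/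
def WeightBound {E : Type*} [NormedAddCommGroup E] [MeasurableSpace E] (α C : ℝ) (μ : Measure E) :
    Prop := ∀ x, ∫⁻ y, ENNReal.ofReal (weight α (x - y)) ∂μ ≤ ENNReal.ofReal C

namespace WeightBound

variable {d : ℕ} {α C c : ℝ} {μ : Measure (EuclideanSpace ℝ (Fin d))}
  {k : EuclideanSpace ℝ (Fin d) → EuclideanSpace ℝ (Fin d)}

lemma integrable_weight (h : WeightBound α C μ) (x : EuclideanSpace ℝ (Fin d)) :
    Integrable (fun y => weight α (x - y)) μ := by
  refine ⟨(measurable_weight.comp (measurable_const.sub measurable_id)).aestronglyMeasurable, ?_⟩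
  refine lt_of_le_of_lt (lintegral_mono fun y => ?_) ((h x).trans_lt ENNReal.ofReal_lt_top)
  rw [Real.enorm_eq_ofReal (weight_nonneg _)]

lemma integral_weight_le (hC : 0 ≤ C) (h : WeightBound α C μ) (x : EuclideanSpace ℝ (Fin d)) :
    ∫ y, weight α (x - y) ∂μ ≤ C := by
  rw [integral_eq_lintegral_of_nonneg_ae (ae_of_all _ fun y => weight_nonneg _)
    (h.integrable_weight x).aestronglyMeasurable]
  exact ENNReal.toReal_le_of_le_ofReal hC (h x)

variable [IsProbabilityMeasure μ]

lemma integrable_kernel (h : WeightBound α C μ) (hk : SingularKernel α c k)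
    (x : EuclideanSpace ℝ (Fin d)) : Integrable (fun y => k (x - y)) μ := by
  refine Integrable.mono' (g := fun y => c * (1 + weight α (x - y)))
    (((integrable_const 1).add (h.integrable_weight x)).const_mul c) ?_
    (ae_of_all _ fun y => hk.norm_le_one_add _)
  exact (hk.measurable.comp (measurable_const.sub measurable_id)).aestronglyMeasurable

lemma norm_meanVelocity_le (hC : 0 ≤ C) (h : WeightBound α C μ) (hk : SingularKernel α c k)
    (x : EuclideanSpace ℝ (Fin d)) : ‖meanVelocity k μ x‖ ≤ c * (1 + C) := by
  have hi : Integrable (fun y => c * (1 + weight α (x - y))) μ :=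
    ((integrable_const 1).add (h.integrable_weight x)).const_mul c
  refine (norm_integral_le_of_norm_le hi (ae_of_all _ fun y => hk.norm_le_one_add _)).trans ?_
  rw [integral_const_mul, integral_add (integrable_const 1) (h.integrable_weight x)]
  have := h.integral_weight_le hC x
  refine mul_le_mul_of_nonneg_left ?_ hk.const_nonneg
  simpa using this

lemma norm_meanVelocity_sub_le (hC : 0 ≤ C) (h : WeightBound α C μ) (hk : SingularKernel α c k)
    (x x' : EuclideanSpace ℝ (Fin d)) :
    ‖meanVelocity k μ x - meanVelocity k μ x'‖ ≤ 2 * c * C * ‖x - x'‖ := by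
  rw [meanVelocity, meanVelocity, ← integral_sub (h.integrable_kernel hk x)
    (h.integrable_kernel hk x')]
  have hi : Integrable (fun y => c * (‖x - x'‖ * (weight α (x - y) + weight α (x' - y)))) μ :=
    (((h.integrable_weight x).add (h.integrable_weight x')).const_mul _).const_mul _
  refine (norm_integral_le_of_norm_le hi (ae_of_all _ fun y => ?_)).trans ?_
  · have := hk.norm_sub_le (x - y) (x' - y)
    rwa [sub_sub_sub_cancel_right] at this
  · rw [integral_const_mul, integral_const_mul, integral_add (h.integrable_weight x)
      (h.integrable_weight x')]
    have h1 := h.integral_weight_le hC x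
    have h2 := h.integral_weight_le hC x'
    have := hk.const_nonneg
    calc _ ≤ c * (‖x - x'‖ * (C + C)) := by gcongr
      _ = _ := by ring

lemma lipschitzWith_meanVelocity (hC : 0 ≤ C) (h : WeightBound α C μ)
    (hk : SingularKernel α c k) :
    LipschitzWith (2 * c * C).toNNReal (meanVelocity k μ) := by
  refine LipschitzWith.of_dist_le_mul fun x y => ?_
  have := hk.const_nonneg
  rw [dist_eq_norm, dist_eq_norm, Real.coe_toNNReal _ (by positivity)]
  exact h.norm_meanVelocity_sub_le hC hk x y

end WeightBound

variable {d : ℕ}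

lemma meanVelocity_puncture {K : EuclideanSpace ℝ (Fin d) → EuclideanSpace ℝ (Fin d)}
    {μ : Measure (EuclideanSpace ℝ (Fin d))} (hd : 0 < d) (hμ : μ ≪ volume) :
    meanVelocity (puncture K) μ = meanVelocity K μ := by
  have : Nonempty (Fin d) := ⟨⟨0, hd⟩⟩
  funext x
  refine integral_congr_ae ?_
  have h0 : ∀ᵐ y ∂μ, y ≠ x := hμ.ae_le (Measure.ae_ne volume x)
  filter_upwards [h0] with y hy
  exact puncture_of_ne K (sub_ne_zero.2 hy.symm)

/-- For a narrowly continuous family of measures with uniformly bounded potential the velocity at a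
fixed point is continuous in time: it is the uniform limit of the velocities for the truncated
kernels, which are bounded and continuous. -/
theorem continuousOn_meanVelocity {α c C T : ℝ}
    {k : EuclideanSpace ℝ (Fin d) → EuclideanSpace ℝ (Fin d)} (hk : SingularKernel α c k)
    {ρ : ℝ → Measure (EuclideanSpace ℝ (Fin d))} (hC : 0 ≤ C)
    (hprob : ∀ t ∈ Set.Icc 0 T, IsProbabilityMeasure (ρ t))
    (hρ : ∀ t ∈ Set.Icc 0 T, WeightBound α C (ρ t))
    (hcont : ∀ φ : BoundedContinuousFunction (EuclideanSpace ℝ (Fin d)) ℝ,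
      ContinuousOn (fun t => ∫ x, φ x ∂(ρ t)) (Set.Icc 0 T))
    (x : EuclideanSpace ℝ (Fin d)) :
    ContinuousOn (fun t => meanVelocity k (ρ t) x) (Set.Icc 0 T) := by
  have hc := hk.const_nonneg
  refine continuousOn_of_uniform_approx_of_continuousOn fun u hu => ?_
  obtain ⟨ε, hε, hεu⟩ := Metric.mem_uniformity_dist.1 hu
  set δ : ℝ := ε / (c * C + 1)
  have hδ : 0 < δ := by positivity
  obtain ⟨L, hL⟩ := hk.exists_lipschitzWith_truncate hδ
  have hint : ∀ t ∈ Set.Icc 0 T,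
      Integrable (fun y => SingularKernel.truncate δ k (x - y)) (ρ t) := by
    intro t ht
    have := hprob t ht
    refine Integrable.of_bound (C := c * (1 + (δ / 2) ^ (-α - 1)))
      (hL.continuous.comp (continuous_const.sub continuous_id)).aestronglyMeasurable
      (ae_of_all _ fun y => hk.norm_truncate_le_const hδ _)
  refine ⟨fun t => ∫ y, SingularKernel.truncate δ k (x - y) ∂(ρ t), ?_, fun t ht => hεu ?_⟩
  · have hcoord : ∀ i : Fin d, ContinuousOn
        (fun t => (∫ y, SingularKernel.truncate δ k (x - y) ∂(ρ t)) i) (Set.Icc 0 T) := by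
      intro i
      have hb : ∀ y, ‖SingularKernel.truncate δ k (x - y) i‖ ≤ c * (1 + (δ / 2) ^ (-α - 1)) :=
        fun y => (PiLp.norm_apply_le _ i).trans (hk.norm_truncate_le_const hδ _)
      have hcts : Continuous fun y => SingularKernel.truncate δ k (x - y) i :=
        (EuclideanSpace.proj i).continuous.comp
          (hL.continuous.comp (continuous_const.sub continuous_id))
      refine (hcont (BoundedContinuousFunction.ofNormedAddCommGroup _ hcts _ hb)).congr
        fun t ht => ?_
      exact ((EuclideanSpace.proj (𝕜 := ℝ) i).integral_comp_comm (hint t ht)).symm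
    have := continuousOn_pi.2 hcoord
    exact (PiLp.continuous_toLp 2 _).comp_continuousOn this
  · have := hprob t ht
    rw [dist_eq_norm, meanVelocity, ← integral_sub ((hρ t ht).integrable_kernel hk x) (hint t ht)]
    refine lt_of_le_of_lt (norm_integral_le_of_norm_le
      (((hρ t ht).integrable_weight x).const_mul (c * δ))
      (ae_of_all _ fun y => hk.norm_sub_truncate_le hδ _)) ?_
    rw [integral_const_mul]
    have h1 := (hρ t ht).integral_weight_le hC x
    calc _ ≤ c * δ * C := by gcongr
      _ = ε * (c * C / (c * C + 1)) := by simp only [δ]; ring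
      _ < ε * 1 := by
        refine mul_lt_mul_of_pos_left ?_ hε
        rw [div_lt_one (by positivity)]; linarith
      _ = ε := mul_one ε

/-! ### The velocity is weakly divergence free -/

section DivergenceFree

variable {d : ℕ} {α C : ℝ} {K : EuclideanSpace ℝ (Fin d) → EuclideanSpace ℝ (Fin d)}

lemma integrableOn_weight (hα : 0 ≤ α) (hd : α + 1 < d) (R : ℝ) :
    IntegrableOn (weight α) (Metric.ball (0 : EuclideanSpace ℝ (Fin d)) R) := by
  rcases le_or_gt R 0 with hR | hR
  · rw [Metric.ball_eq_empty.2 hR]; exact integrableOn_empty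
  have hd0 : 0 < d := by
    have : (0 : ℝ) < d := by linarith
    exact_mod_cast this
  have : Nonempty (Fin d) := ⟨⟨0, hd0⟩⟩
  refine ⟨measurable_weight.aestronglyMeasurable, ?_⟩
  have h := lintegral_norm_rpow_ball (E := EuclideanSpace ℝ (Fin d)) (a := α + 1) hR
  have hI := lintegral_norm_rpow_unit_ball_lt_top (E := EuclideanSpace ℝ (Fin d)) (a := α + 1)
    (by simpa using hd)
  refine lt_of_le_of_lt (lintegral_mono fun x => ?_)
    (h.trans_lt (ENNReal.mul_lt_top ENNReal.ofReal_lt_top hI))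
  rw [Real.enorm_eq_ofReal (weight_nonneg _), weight, show -α - 1 = -(α + 1) by ring]

lemma SingularKernel.integrable_fderiv_apply {c : ℝ}
    {k : EuclideanSpace ℝ (Fin d) → EuclideanSpace ℝ (Fin d)} (hk : SingularKernel α c k)
    (hd : α + 1 < d) {φ : EuclideanSpace ℝ (Fin d) → ℝ} (hφ : ContDiff ℝ ∞ φ)
    (hc : HasCompactSupport φ) : Integrable fun x => fderiv ℝ φ x (k x) := by
  have hφ' : Continuous (fderiv ℝ φ) := hφ.continuous_fderiv (by simp)
  obtain ⟨A, hA⟩ := hφ'.bounded_above_of_compact_support (hc.fderiv ℝ)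
  have hA0 : 0 ≤ A := (norm_nonneg _).trans (hA 0)
  obtain ⟨R, hR⟩ := hc.isBounded.subset_ball (0 : EuclideanSpace ℝ (Fin d))
  have hsupp : Function.support (fun x => fderiv ℝ φ x (k x)) ⊆ Metric.ball 0 R := by
    intro x hx
    refine hR (support_fderiv_subset ℝ (f := φ) fun h => hx ?_)
    simp [h]
  rw [← integrableOn_iff_integrable_of_support_subset hsupp]
  refine Integrable.mono' (g := fun x => A * (c * (1 + weight α x))) ?_ ?_
    (ae_of_all _ fun x => ?_)
  · refine (Integrable.const_mul (Integrable.add ?_ ?_) c).const_mul A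
    · exact integrableOn_const measure_ball_lt_top.ne
    · exact integrableOn_weight hk.exponent_nonneg hd R
  · exact ((ContinuousLinearMap.id ℝ (EuclideanSpace ℝ (Fin d) →L[ℝ] ℝ)).aestronglyMeasurable_comp₂
      hφ'.aestronglyMeasurable hk.measurable.aestronglyMeasurable)
  · refine (ContinuousLinearMap.le_opNorm _ _).trans ?_
    exact mul_le_mul (hA x) (hk.norm_le_one_add x) (norm_nonneg _) hA0

/-- Integration by parts against a test function supported away from the singularity. -/
lemma IsKernel.integral_fderiv_eq_zero_of_notMem_tsupport (hα : 0 ≤ α) (hK : IsKernel α C K)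
    {ψ : EuclideanSpace ℝ (Fin d) → ℝ} (hψ : ContDiff ℝ ∞ ψ) (hc : HasCompactSupport ψ)
    (h0 : (0 : EuclideanSpace ℝ (Fin d)) ∉ tsupport ψ) :
    ∫ x, fderiv ℝ ψ x (K x) = 0 := by
  set b := EuclideanSpace.basisFun (Fin d) ℝ
  have hne : ∀ x ∈ tsupport ψ, x ≠ 0 := fun x hx h => h0 (h ▸ hx)
  have hKd : ∀ x ∈ tsupport ψ, DifferentiableAt ℝ K x := fun x hx =>
    hK.differentiableAt x (hne x hx)
  have hKi : ∀ i, ∀ x ∈ tsupport ψ, HasFDerivAt (fun y => K y i)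
      ((EuclideanSpace.proj (𝕜 := ℝ) i).comp (fderiv ℝ K x)) x := fun i x hx =>
    (EuclideanSpace.proj (𝕜 := ℝ) i).hasFDerivAt.comp x (hKd x hx).hasFDerivAt
  have hKcont : ContinuousOn K (tsupport ψ) := fun x hx =>
    (hKd x hx).continuousAt.continuousWithinAt
  have hψ1 : Differentiable ℝ ψ := hψ.differentiable (by simp)
  have hψ' : Continuous (fderiv ℝ ψ) := hψ.continuous_fderiv (by simp)
  have hcomp : IsCompact (tsupport ψ) := hc
  have hmeas := (isClosed_tsupport ψ).measurableSet
  -- functions vanishing off the support and bounded and measurable on it are integrable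
  have hint : ∀ f : EuclideanSpace ℝ (Fin d) → ℝ, (∀ x ∉ tsupport ψ, f x = 0) →
      IntegrableOn f (tsupport ψ) → Integrable f := by
    intro f hf hfi
    rw [← integrableOn_univ]
    exact (integrableOn_iff_integrable_of_support_subset (f := f) (s := tsupport ψ) (fun x hx => by
      by_contra h; exact hx (hf x h))).1 hfi |>.integrableOn
  have hz : ∀ x ∉ tsupport ψ, fderiv ℝ ψ x = 0 := fun x hx => by
    by_contra h
    exact hx (support_fderiv_subset ℝ (f := ψ) h)
  have hz' : ∀ x ∉ tsupport ψ, ψ x = 0 := fun x hx => image_eq_zero_of_notMem_tsupport hx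
  have hcoord : ∀ i, ContinuousOn (fun x => K x i) (tsupport ψ) := fun i =>
    (EuclideanSpace.proj (𝕜 := ℝ) i).continuous.comp_continuousOn hKcont
  have i1 : ∀ i, Integrable fun x => fderiv ℝ ψ x (b i) * K x i := fun i => by
    refine hint _ (fun x hx => by simp [hz x hx]) ?_
    refine ContinuousOn.integrableOn_compact hcomp (ContinuousOn.mul ?_ (hcoord i))
    exact (hψ'.clm_apply continuous_const).continuousOn
  have i2 : ∀ i, Integrable fun x => ψ x * K x i := fun i => by
    refine hint _ (fun x hx => by simp [hz' x hx]) ?_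
    exact ContinuousOn.integrableOn_compact hcomp (hψ.continuous.continuousOn.mul (hcoord i))
  obtain ⟨δ, hδ, hδψ⟩ : ∃ δ > 0, ∀ x ∈ tsupport ψ, δ ≤ ‖x‖ := by
    obtain ⟨δ, hδ, h⟩ := Metric.isOpen_iff.1 (isClosed_tsupport ψ).isOpen_compl 0 h0
    refine ⟨δ, hδ, fun x hx => ?_⟩
    by_contra hlt
    exact h (by simpa using not_le.1 hlt) hx
  obtain ⟨B, hB⟩ := hcomp.exists_bound_of_continuousOn hψ.continuous.continuousOn
  have i3 : ∀ i, Integrable fun x => ψ x * (fderiv ℝ K x (b i)) i := fun i => by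
    refine hint _ (fun x hx => by simp [hz' x hx]) ?_
    have hm : Measurable fun x => (fderiv ℝ K x (b i)) i :=
      (EuclideanSpace.proj (𝕜 := ℝ) i).continuous.measurable.comp (measurable_fderiv_apply_const ..)
    refine Measure.integrableOn_of_bounded (M := |B| * (|C| * δ ^ (-α - 1)))
      hcomp.measure_lt_top.ne (hψ.continuous.measurable.mul hm).aestronglyMeasurable ?_
    filter_upwards [ae_restrict_mem hmeas] with x hx
    rw [norm_mul]
    refine mul_le_mul ((hB x hx).trans (le_abs_self B)) ?_ (norm_nonneg _) (abs_nonneg B)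
    refine (PiLp.norm_apply_le _ i).trans ((ContinuousLinearMap.le_opNorm _ _).trans ?_)
    rw [b.norm_eq_one, mul_one]
    refine (hK.norm_fderiv_le x (hne x hx)).trans ?_
    exact mul_le_mul (le_abs_self C)
      (weight_le_of_le_norm hα hδ (hδψ x hx)) (by positivity) (abs_nonneg C)
  have hparts : ∀ i, ∫ x, fderiv ℝ ψ x (b i) * K x i = - ∫ x, ψ x * (fderiv ℝ K x (b i)) i := by
    intro i
    have h := integral_bilinear_hasLineDerivAt_right_eq_neg_left_of_integrable
      (μ := (volume : Measure (EuclideanSpace ℝ (Fin d)))) (f := ψ)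
      (f' := fun x => fderiv ℝ ψ x (b i)) (g := fun x => K x i)
      (g' := fun x => (fderiv ℝ K x (b i)) i) (v := b i) (B := ContinuousLinearMap.mul ℝ ℝ)
      (i1 i) (i3 i) (i2 i) (fun x _ => (hψ1 x).hasFDerivAt.hasLineDerivAt _)
      (fun x hx => (hKi i x hx).hasLineDerivAt _)
    simp only [ContinuousLinearMap.mul_apply'] at h
    rw [h, neg_neg]
  have hsum : ∀ x, fderiv ℝ ψ x (K x) = ∑ i, fderiv ℝ ψ x (b i) * K x i := by
    intro x
    conv_lhs => rw [← b.sum_repr (K x)]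
    rw [map_sum]
    refine Finset.sum_congr rfl fun i _ => ?_
    rw [map_smul, smul_eq_mul, mul_comm]
    rfl
  simp_rw [hsum]
  rw [integral_finsetSum _ fun i _ => i1 i]
  simp_rw [hparts]
  rw [Finset.sum_neg_distrib, ← integral_finsetSum _ fun i _ => i3 i, neg_eq_zero]
  refine integral_eq_zero_of_ae (ae_of_all _ fun x => ?_)
  change ∑ i, ψ x * (fderiv ℝ K x (b i)) i = 0
  by_cases hx : x ∈ tsupport ψ
  · have := hK.div_eq_zero x (hne x hx)
    rw [LinearMap.trace_eq_sum_inner _ b] at this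
    rw [← Finset.mul_sum]
    refine mul_eq_zero_of_right _ (this ▸ Finset.sum_congr rfl fun i _ => ?_)
    simp [b, EuclideanSpace.inner_single_left]
  · simp [hz' x hx]

/-- A divergence-free kernel of order `|x| ^ (-α)`, `α + 1 < d`, is weakly divergence free across
its singularity: cutting off a ball of radius `ε` costs `ε ^ (d - 1 - α)`. -/
theorem IsKernel.integral_fderiv_eq_zero (hα : 0 ≤ α) (hd : α + 1 < d) (hK : IsKernel α C K)
    {φ : EuclideanSpace ℝ (Fin d) → ℝ} (hφ : ContDiff ℝ ∞ φ) (hc : HasCompactSupport φ) :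
    ∫ x, fderiv ℝ φ x (puncture K x) = 0 := by
  have hk := hK.singularKernel hα
  have hd0 : 0 < d := by
    have : (0 : ℝ) < d := by linarith
    exact_mod_cast this
  have hne : Nonempty (Fin d) := ⟨⟨0, hd0⟩⟩
  set c := |C| * ((2 : ℝ) ^ (α + 1) + 4)
  have hc0 := hk.const_nonneg
  have hφ' : Continuous (fderiv ℝ φ) := hφ.continuous_fderiv (by simp)
  obtain ⟨A, hA⟩ := hφ'.bounded_above_of_compact_support (hc.fderiv ℝ)
  obtain ⟨A', hA'⟩ := hφ.continuous.bounded_above_of_compact_support hc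
  let χ : ContDiffBump (0 : EuclideanSpace ℝ (Fin d)) :=
    { rIn := 1, rOut := 2, rIn_pos := one_pos, rIn_lt_rOut := one_lt_two }
  have hχ : ContDiff ℝ ∞ χ := χ.contDiff
  obtain ⟨D, hD⟩ := (hχ.continuous_fderiv (by simp)).bounded_above_of_compact_support
    (χ.hasCompactSupport.fderiv ℝ)
  have hA0 : 0 ≤ A := (norm_nonneg _).trans (hA 0)
  have hA0' : 0 ≤ A' := (norm_nonneg _).trans (hA' 0)
  have hD0 : 0 ≤ D := (norm_nonneg _).trans (hD 0)
  set I := ∫⁻ x in Metric.ball (0 : EuclideanSpace ℝ (Fin d)) 1,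
    ENNReal.ofReal (‖x‖ ^ (-(α + 1)))
  have hI : I < ⊤ := lintegral_norm_rpow_unit_ball_lt_top (by simpa using hd)
  -- the error of the cutoff at scale `ε`
  have key : ∀ ε : ℝ, 0 < ε → ε ≤ 1 → ‖∫ x, fderiv ℝ φ x (puncture K x)‖ ≤
      (A + A' * D) * (2 * c) * (2 * ε) ^ ((d : ℝ) - (α + 1)) * I.toReal := by
    intro ε hε hε1
    set η : EuclideanSpace ℝ (Fin d) → ℝ := fun x => χ (ε⁻¹ • x)
    have hη : ContDiff ℝ ∞ η := hχ.comp (contDiff_const_smul _)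
    have hηd : ∀ x, fderiv ℝ η x = ε⁻¹ • fderiv ℝ χ (ε⁻¹ • x) := by
      intro x
      exact fderiv_comp_smul _
    have hηbd : ∀ x, ‖fderiv ℝ η x‖ ≤ ε⁻¹ * D := fun x => by
      rw [hηd, norm_smul, Real.norm_eq_abs, abs_of_pos (by positivity)]
      exact mul_le_mul_of_nonneg_left (hD _) (by positivity)
    have hη1 : ∀ x, ‖η x‖ ≤ 1 := fun x => by
      rw [Real.norm_eq_abs, abs_of_nonneg χ.nonneg]; exact χ.le_one
    have hηsupp : tsupport η ⊆ Metric.closedBall 0 (2 * ε) := by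
      refine closure_minimal (fun x hx => ?_) Metric.isClosed_closedBall
      have hx' : ε⁻¹ • x ∈ Function.support χ := hx
      rw [χ.support_eq, mem_ball_zero_iff, norm_smul, Real.norm_eq_abs,
        abs_of_pos (by positivity)] at hx'
      have hx2 : ε⁻¹ * ‖x‖ < 2 := hx'
      rw [inv_mul_lt_iff₀ hε] at hx2
      rw [mem_closedBall_zero_iff]; linarith
    have hηc : HasCompactSupport η :=
      (isCompact_closedBall _ _).of_isClosed_subset (isClosed_tsupport η) hηsupp
    set ψ : EuclideanSpace ℝ (Fin d) → ℝ := fun x => φ x * (1 - η x)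
    have hψ : ContDiff ℝ ∞ ψ := hφ.mul (contDiff_const.sub hη)
    have hψc : HasCompactSupport ψ := hc.mul_right
    have hψ0 : (0 : EuclideanSpace ℝ (Fin d)) ∉ tsupport ψ := by
      rw [notMem_tsupport_iff_eventuallyEq]
      have h1 : ∀ᶠ x in 𝓝 (0 : EuclideanSpace ℝ (Fin d)), η x = 1 := by
        have : Tendsto (fun x : EuclideanSpace ℝ (Fin d) => ε⁻¹ • x) (𝓝 0) (𝓝 0) := by
          simpa using (continuous_const_smul ε⁻¹).tendsto (0 : EuclideanSpace ℝ (Fin d))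
        exact this.eventually χ.eventuallyEq_one
      filter_upwards [h1] with x hx
      simp [ψ, hx]
    have hzero := hK.integral_fderiv_eq_zero_of_notMem_tsupport hα hψ hψc hψ0
    have hzero' : ∫ x, fderiv ℝ ψ x (puncture K x) = 0 := by
      rw [← hzero]
      refine integral_congr_ae ?_
      filter_upwards [Measure.ae_ne volume (0 : EuclideanSpace ℝ (Fin d))] with x hx
      rw [puncture_of_ne K hx]
    set θ : EuclideanSpace ℝ (Fin d) → ℝ := fun x => φ x * η x
    have hθ : ContDiff ℝ ∞ θ := hφ.mul hη
    have hsum : ∀ x, fderiv ℝ φ x = fderiv ℝ ψ x + fderiv ℝ θ x := by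
      intro x
      have : φ = fun x => ψ x + θ x := by funext x; simp only [ψ, θ]; ring
      conv_lhs => rw [this]
      exact fderiv_fun_add (hψ.differentiable (by simp) x) (hθ.differentiable (by simp) x)
    have hθd : ∀ x, ‖fderiv ℝ θ x‖ ≤ A + A' * D * ε⁻¹ := by
      intro x
      have : fderiv ℝ θ x = φ x • fderiv ℝ η x + η x • fderiv ℝ φ x :=
        fderiv_fun_mul (hφ.differentiable (by simp) x) (hη.differentiable (by simp) x)
      rw [this]
      refine (norm_add_le _ _).trans ?_
      rw [norm_smul, norm_smul]
      have e1 := mul_le_mul (hA' x) (hηbd x) (norm_nonneg _) hA0'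
      have e2 := mul_le_mul (hη1 x) (hA x) (norm_nonneg _) zero_le_one
      linarith
    have hθsupp : ∀ x ∉ Metric.ball (0 : EuclideanSpace ℝ (Fin d)) (2 * ε), θ x = 0 := by
      intro x hx
      have : η x = 0 := by
        refine χ.zero_of_le_dist ?_
        rw [mem_ball_zero_iff, not_lt] at hx
        rw [dist_zero_right, norm_smul, Real.norm_eq_abs, abs_of_pos (by positivity)]
        change 2 ≤ ε⁻¹ * ‖x‖
        rw [le_inv_mul_iff₀ hε]; linarith
      simp [θ, this]
    have hθsupp' : ∀ x ∉ Metric.closedBall (0 : EuclideanSpace ℝ (Fin d)) (2 * ε),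
        fderiv ℝ θ x = 0 := by
      intro x hx
      have : x ∉ tsupport θ := fun h => hx (hηsupp
        (closure_mono (Function.support_mul_subset_right _ _) h))
      by_contra h
      exact this (support_fderiv_subset ℝ (f := θ) h)
    have hae : ∀ᵐ x : EuclideanSpace ℝ (Fin d),
        x ∉ Metric.sphere (0 : EuclideanSpace ℝ (Fin d)) (2 * ε) := by
      rw [ae_iff]
      have := Measure.addHaar_sphere_of_ne_zero volume (0 : EuclideanSpace ℝ (Fin d))
        (by positivity : 2 * ε ≠ 0)
      simpa only [not_not, Set.ofPred_mem_eq] using this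
    have hbound : ∀ᵐ x : EuclideanSpace ℝ (Fin d), ‖fderiv ℝ θ x (puncture K x)‖ₑ ≤
        (Metric.ball (0 : EuclideanSpace ℝ (Fin d)) (2 * ε)).indicator (fun x => ENNReal.ofReal
          ((A + A' * D) * (2 * c)) * ENNReal.ofReal (‖x‖ ^ (-(α + 1)))) x := by
      filter_upwards [hae] with x hx
      by_cases hxb : x ∈ Metric.ball (0 : EuclideanSpace ℝ (Fin d)) (2 * ε)
      · rw [Set.indicator_of_mem hxb, ← ENNReal.ofReal_mul (by positivity),
          ← ofReal_norm]
        refine ENNReal.ofReal_le_ofReal ((ContinuousLinearMap.le_opNorm _ _).trans ?_)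
        refine (mul_le_mul (hθd x) (hk.norm_le x) (norm_nonneg _) (by positivity)).trans ?_
        have hw : ‖x‖ ^ (-(α + 1)) = weight α x := by rw [weight]; congr 1; ring
        rw [hw]
        rw [mem_ball_zero_iff] at hxb
        have hwn := weight_nonneg (α := α) x
        have e : (A + A' * D * ε⁻¹) * ‖x‖ ≤ (A + A' * D) * 2 := by
          have e1 : (A + A' * D * ε⁻¹) * ‖x‖ ≤ (A + A' * D * ε⁻¹) * (2 * ε) := by gcongr
          refine e1.trans ?_
          have : (A + A' * D * ε⁻¹) * (2 * ε) = 2 * (A * ε) + 2 * (A' * D) * (ε⁻¹ * ε) := by ring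
          rw [this, inv_mul_cancel₀ hε.ne']
          nlinarith
        calc (A + A' * D * ε⁻¹) * (c * (‖x‖ * weight α x))
            = ((A + A' * D * ε⁻¹) * ‖x‖) * (c * weight α x) := by ring
          _ ≤ ((A + A' * D) * 2) * (c * weight α x) := by gcongr
          _ = _ := by ring
      · have : x ∉ Metric.closedBall (0 : EuclideanSpace ℝ (Fin d)) (2 * ε) := by
          intro h
          rcases (mem_closedBall_zero_iff.1 h).lt_or_eq with h | h
          · exact hxb (mem_ball_zero_iff.2 h)
          · exact hx (mem_sphere_zero_iff_norm.2 h)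
        simp [hθsupp' x this]
    have hlint : ∫⁻ x, ‖fderiv ℝ θ x (puncture K x)‖ₑ ≤ ENNReal.ofReal
        ((A + A' * D) * (2 * c)) * (ENNReal.ofReal ((2 * ε) ^ ((d : ℝ) - (α + 1))) * I) := by
      refine (lintegral_mono_ae hbound).trans (le_of_eq ?_)
      rw [lintegral_indicator measurableSet_ball, lintegral_const_mul' _ _ ENNReal.ofReal_ne_top,
        lintegral_norm_rpow_ball (by positivity)]
      simp [I]
    have hθint := hk.integrable_fderiv_apply hd hθ (hc.mul_right (f' := η))
    have hψint := hk.integrable_fderiv_apply hd hψ hψc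
    have : ∫ x, fderiv ℝ φ x (puncture K x) = ∫ x, fderiv ℝ θ x (puncture K x) := by
      simp_rw [hsum, add_apply]
      rw [integral_add hψint hθint, hzero', zero_add]
    rw [this]
    refine (norm_integral_le_lintegral_norm _).trans ?_
    simp_rw [ofReal_norm]
    refine (ENNReal.toReal_mono ?_ hlint).trans (le_of_eq ?_)
    · exact (ENNReal.mul_lt_top ENNReal.ofReal_lt_top
        (ENNReal.mul_lt_top ENNReal.ofReal_lt_top hI)).ne
    · rw [ENNReal.toReal_mul, ENNReal.toReal_mul, ENNReal.toReal_ofReal (by positivity),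
        ENNReal.toReal_ofReal (by positivity)]
      ring
  have hlim : Tendsto (fun ε : ℝ => (A + A' * D) * (2 * c) * (2 * ε) ^ ((d : ℝ) - (α + 1))
      * I.toReal) (𝓝[>] 0) (𝓝 0) := by
    have hp : 0 < (d : ℝ) - (α + 1) := by linarith
    have h1 : Tendsto (fun ε : ℝ => (2 * ε) ^ ((d : ℝ) - (α + 1))) (𝓝 0) (𝓝 0) := by
      have : Continuous fun ε : ℝ => (2 * ε) ^ ((d : ℝ) - (α + 1)) :=
        (continuous_const.mul continuous_id).rpow_const fun _ => Or.inr hp.le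
      simpa [Real.zero_rpow hp.ne'] using this.tendsto 0
    have h2 := ((h1.const_mul ((A + A' * D) * (2 * c))).mul_const I.toReal)
    rw [mul_zero, zero_mul] at h2
    exact h2.mono_left nhdsWithin_le_nhds
  have : ‖∫ x, fderiv ℝ φ x (puncture K x)‖ ≤ 0 := by
    refine ge_of_tendsto hlim ?_
    filter_upwards [Ioc_mem_nhdsGT (zero_lt_one' ℝ)] with ε hε
    exact key ε hε.1 hε.2
  exact norm_le_zero_iff.1 this

/-- The mean-field velocity of a probability measure is weakly divergence free. -/
theorem IsKernel.integral_fderiv_meanVelocity_eq_zero (hα : 0 ≤ α) (hd : α + 1 < d)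
    (hK : IsKernel α C K) {μ : Measure (EuclideanSpace ℝ (Fin d))} [IsProbabilityMeasure μ]
    {C₁ : ℝ} (hC₁ : 0 ≤ C₁) (hμ : WeightBound α C₁ μ) {φ : EuclideanSpace ℝ (Fin d) → ℝ}
    (hφ : ContDiff ℝ ∞ φ) (hc : HasCompactSupport φ) :
    ∫ x, fderiv ℝ φ x (meanVelocity (puncture K) μ x) = 0 := by
  have hk := hK.singularKernel hα
  set c := |C| * ((2 : ℝ) ^ (α + 1) + 4)
  have hφ' : Continuous (fderiv ℝ φ) := hφ.continuous_fderiv (by simp)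
  obtain ⟨A, hA⟩ := hφ'.bounded_above_of_compact_support (hc.fderiv ℝ)
  have hA0 : 0 ≤ A := (norm_nonneg _).trans (hA 0)
  have hc' : HasCompactSupport (fderiv ℝ φ) := hc.fderiv ℝ
  have h1 : ∀ x, fderiv ℝ φ x (meanVelocity (puncture K) μ x)
      = ∫ y, fderiv ℝ φ x (puncture K (x - y)) ∂μ := fun x =>
    ((fderiv ℝ φ x).integral_comp_comm (hμ.integrable_kernel hk x)).symm
  simp_rw [h1]
  have hmeas : AEStronglyMeasurable (Function.uncurry fun x y : EuclideanSpace ℝ (Fin d) =>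
      fderiv ℝ φ x (puncture K (x - y))) (volume.prod μ) :=
    (ContinuousLinearMap.id ℝ (EuclideanSpace ℝ (Fin d) →L[ℝ] ℝ)).aestronglyMeasurable_comp₂
      (hφ'.comp continuous_fst).aestronglyMeasurable
      (hk.measurable.comp (measurable_fst.sub measurable_snd)).aestronglyMeasurable
  have hint : Integrable (Function.uncurry fun x y : EuclideanSpace ℝ (Fin d) =>
      fderiv ℝ φ x (puncture K (x - y))) (volume.prod μ) := by
    rw [integrable_prod_iff hmeas]
    refine ⟨ae_of_all _ fun x => ((fderiv ℝ φ x).integrable_comp (hμ.integrable_kernel hk x)), ?_⟩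
    refine Integrable.mono' (g := fun x => ‖fderiv ℝ φ x‖ * (c * (1 + C₁))) ?_
      hmeas.norm.integral_prod_right' (ae_of_all _ fun x => ?_)
    · exact (hφ'.norm.integrable_of_hasCompactSupport hc'.norm).mul_const _
    · rw [Real.norm_eq_abs, abs_of_nonneg (integral_nonneg fun y => norm_nonneg _)]
      have hi : Integrable (fun y => ‖fderiv ℝ φ x‖ * (c * (1 + weight α (x - y)))) μ :=
        (((integrable_const 1).add (hμ.integrable_weight x)).const_mul c).const_mul _
      calc ∫ y, ‖fderiv ℝ φ x (puncture K (x - y))‖ ∂μ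
          ≤ ∫ y, ‖fderiv ℝ φ x‖ * (c * (1 + weight α (x - y))) ∂μ := by
            refine integral_mono_of_nonneg (ae_of_all _ fun y => norm_nonneg _) hi
              (ae_of_all _ fun y => ?_)
            exact (ContinuousLinearMap.le_opNorm _ _).trans
              (mul_le_mul_of_nonneg_left (hk.norm_le_one_add _) (norm_nonneg _))
        _ = ‖fderiv ℝ φ x‖ * (c * (1 + ∫ y, weight α (x - y) ∂μ)) := by
            rw [integral_const_mul, integral_const_mul,
              integral_add (integrable_const 1) (hμ.integrable_weight x)]
            simp
        _ ≤ _ := by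
            have := hμ.integral_weight_le hC₁ x
            have := hk.const_nonneg
            gcongr
  rw [integral_integral_swap hint]
  refine integral_eq_zero_of_ae (ae_of_all _ fun y => ?_)
  change ∫ x, fderiv ℝ φ x (puncture K (x - y)) = 0
  rw [← integral_add_right_eq_self _ y]
  simp_rw [add_sub_cancel_right]
  have hφy : ContDiff ℝ ∞ fun x => φ (x + y) := hφ.comp (contDiff_id.add contDiff_const)
  have hcy : HasCompactSupport fun x => φ (x + y) := hc.comp_homeomorph (Homeomorph.addRight y)
  rw [← hK.integral_fderiv_eq_zero hα hd hφy hcy]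
  congr 1 with x
  rw [fderiv_comp_add_right]

end DivergenceFree

/-! ### Bounded Lipschitz fields and their flows -/

/-- Time-dependent vector fields on `[0, T]` that are bounded by `U`, `L`-Lipschitz in space and
continuous in time. -/
structure IsLipschitzField {E : Type*} [NormedAddCommGroup E] (T L U : ℝ) (u : ℝ → E → E) :
    Prop where
  lipschitz_nonneg : 0 ≤ L
  bound_nonneg : 0 ≤ U
  continuousOn : ∀ x, ContinuousOn (fun t => u t x) (Set.Icc 0 T)
  norm_sub_le : ∀ t ∈ Set.Icc 0 T, ∀ x y, ‖u t x - u t y‖ ≤ L * ‖x - y‖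
  norm_le : ∀ t ∈ Set.Icc 0 T, ∀ x, ‖u t x‖ ≤ U

/-- `Φ t x` is the position at time `t` of the trajectory of `u` that starts at `x`. -/
structure IsFlow {E : Type*} [NormedAddCommGroup E] [NormedSpace ℝ E] (T : ℝ) (u : ℝ → E → E)
    (Φ : ℝ → E → E) : Prop where
  initial : ∀ x, Φ 0 x = x
  hasDeriv : ∀ x, ∀ t ∈ Set.Icc 0 T,
    HasDerivWithinAt (fun s => Φ s x) (u t (Φ t x)) (Set.Icc 0 T) t

namespace IsLipschitzField

variable {E : Type*} [NormedAddCommGroup E] {T L U : ℝ} {u : ℝ → E → E}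

lemma mono (hu : IsLipschitzField T L U u) {T' : ℝ} (h : T' ≤ T) : IsLipschitzField T' L U u where
  lipschitz_nonneg := hu.lipschitz_nonneg
  bound_nonneg := hu.bound_nonneg
  continuousOn x := (hu.continuousOn x).mono (Set.Icc_subset_Icc_right h)
  norm_sub_le t ht := hu.norm_sub_le t (Set.Icc_subset_Icc_right h ht)
  norm_le t ht := hu.norm_le t (Set.Icc_subset_Icc_right h ht)

lemma lipschitzWith (hu : IsLipschitzField T L U u) {t : ℝ} (ht : t ∈ Set.Icc 0 T) :
    LipschitzWith L.toNNReal (u t) := by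
  refine LipschitzWith.of_dist_le_mul fun x y => ?_
  rw [dist_eq_norm, dist_eq_norm, Real.coe_toNNReal _ hu.lipschitz_nonneg]
  exact hu.norm_sub_le t ht x y

lemma continuousOn_uncurry (hu : IsLipschitzField T L U u) :
    ContinuousOn (Function.uncurry u) (Set.Icc 0 T ×ˢ Set.univ) :=
  continuousOn_prod_of_continuousOn_lipschitzOnWith' _ L.toNNReal
    (fun _ ht => (hu.lipschitzWith ht).lipschitzOnWith) fun x _ => hu.continuousOn x

/-- On bounded sets the field is continuous in time, uniformly in space. -/
lemma exists_forall_norm_sub_le [ProperSpace E] (hu : IsLipschitzField T L U u) {δ : ℝ}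
    (hδ : 0 < δ) (R : ℝ) :
    ∃ h₀ > 0, ∀ s ∈ Set.Icc 0 T, ∀ σ ∈ Set.Icc 0 T, |σ - s| < h₀ →
      ∀ x ∈ Metric.closedBall (0 : E) R, ‖u σ x - u s x‖ ≤ δ := by
  have hcomp : IsCompact (Set.Icc 0 T ×ˢ Metric.closedBall (0 : E) R) :=
    isCompact_Icc.prod (isCompact_closedBall _ _)
  have huc := hcomp.uniformContinuousOn_of_continuous
    (hu.continuousOn_uncurry.mono (Set.prod_mono le_rfl (Set.subset_univ _)))
  obtain ⟨h₀, hh₀, hd⟩ := Metric.uniformContinuousOn_iff.1 huc δ hδ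
  refine ⟨h₀, hh₀, fun s hs σ hσ hsσ x hx => ?_⟩
  have := hd (σ, x) ⟨hσ, hx⟩ (s, x) ⟨hs, hx⟩ (by
    rw [Prod.dist_eq, dist_self, max_eq_left dist_nonneg, Real.dist_eq]; exact hsσ)
  rw [dist_eq_norm] at this
  exact this.le

variable [NormedSpace ℝ E]

/-- Since the field is bounded, the Picard-Lindelöf theorem applies on the whole of `[0, T]`. -/
theorem exists_isFlow [CompleteSpace E] (hT : 0 ≤ T) (hu : IsLipschitzField T L U u) :
    ∃ Φ, IsFlow T u Φ := by
  have h : ∀ x : E, ∃ γ : ℝ → E, γ 0 = x ∧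
      ∀ t ∈ Set.Icc 0 T, HasDerivWithinAt γ (u t (γ t)) (Set.Icc 0 T) t := by
    intro x
    have hpl : IsPicardLindelof u (tmin := 0) (tmax := T) ⟨0, le_rfl, hT⟩ x
        (U * T).toNNReal 0 U.toNNReal L.toNNReal :=
      { lipschitzOnWith := fun t ht => (hu.lipschitzWith ht).lipschitzOnWith
        continuousOn := fun y _ => hu.continuousOn y
        norm_le := fun t ht y _ => by
          rw [Real.coe_toNNReal _ hu.bound_nonneg]; exact hu.norm_le t ht y
        mul_max_le := by
          have := hu.bound_nonneg
          rw [Real.coe_toNNReal _ hu.bound_nonneg, Real.coe_toNNReal _ (by positivity)]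
          simp [max_eq_left hT] }
    exact hpl.exists_eq_forall_mem_Icc_hasDerivWithinAt₀
  choose γ h0 h1 using h
  exact ⟨fun t x => γ x t, h0, h1⟩

end IsLipschitzField

lemma hasDerivWithinAt_Ici_of_Icc {E : Type*} [NormedAddCommGroup E] [NormedSpace ℝ E]
    {f : ℝ → E} {f' : E} {a b t : ℝ} (h : HasDerivWithinAt f f' (Set.Icc a b) t)
    (ht : t ∈ Set.Ico a b) : HasDerivWithinAt f f' (Set.Ici t) t :=
  h.mono_of_mem_nhdsWithin (Icc_mem_nhdsGE_of_mem ht)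

namespace IsFlow

variable {E : Type*} [NormedAddCommGroup E] [NormedSpace ℝ E] {T L U : ℝ} {u Φ : ℝ → E → E}

lemma mono (hΦ : IsFlow T u Φ) {T' : ℝ} (h : T' ≤ T) : IsFlow T' u Φ where
  initial := hΦ.initial
  hasDeriv x t ht := (hΦ.hasDeriv x t (Set.Icc_subset_Icc_right h ht)).mono
    (Set.Icc_subset_Icc_right h)

lemma continuousOn (hΦ : IsFlow T u Φ) (x : E) : ContinuousOn (fun t => Φ t x) (Set.Icc 0 T) :=
  fun t ht => (hΦ.hasDeriv x t ht).continuousWithinAt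

lemma norm_sub_le (hΦ : IsFlow T u Φ) (hu : IsLipschitzField T L U u) {s t : ℝ}
    (hs : s ∈ Set.Icc 0 T) (ht : t ∈ Set.Icc 0 T) (x : E) :
    ‖Φ t x - Φ s x‖ ≤ U * |t - s| :=
  (convex_Icc 0 T).norm_image_sub_le_of_norm_hasDerivWithin_le (f := fun t => Φ t x)
    (fun t ht => hΦ.hasDeriv x t ht) (fun t ht => hu.norm_le t ht _) hs ht

lemma dist_le (hΦ : IsFlow T u Φ) (hu : IsLipschitzField T L U u) {t : ℝ}
    (ht : t ∈ Set.Icc 0 T) (x y : E) : dist (Φ t x) (Φ t y) ≤ Real.exp (L * t) * dist x y := by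
  have h := dist_le_of_trajectories_ODE_of_mem (v := u) (s := fun _ => Set.univ)
    (K := L.toNNReal) (f := fun t => Φ t x) (g := fun t => Φ t y) (a := 0) (b := T)
    (δ := dist x y)
    (fun t ht => (hu.lipschitzWith (Set.Ico_subset_Icc_self ht)).lipschitzOnWith)
    (hΦ.continuousOn x)
    (fun t ht => hasDerivWithinAt_Ici_of_Icc (hΦ.hasDeriv x t (Set.Ico_subset_Icc_self ht)) ht)
    (fun _ _ => trivial) (hΦ.continuousOn y)
    (fun t ht => hasDerivWithinAt_Ici_of_Icc (hΦ.hasDeriv y t (Set.Ico_subset_Icc_self ht)) ht)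
    (fun _ _ => trivial) (by rw [hΦ.initial, hΦ.initial]) t ht
  rwa [sub_zero, Real.coe_toNNReal _ hu.lipschitz_nonneg, mul_comm] at h

lemma continuous (hΦ : IsFlow T u Φ) (hu : IsLipschitzField T L U u) {t : ℝ}
    (ht : t ∈ Set.Icc 0 T) : Continuous (Φ t) := by
  refine (LipschitzWith.of_dist_le_mul (K := (Real.exp (L * t)).toNNReal) fun x y => ?_).continuous
  rw [Real.coe_toNNReal _ (Real.exp_pos _).le]
  exact hΦ.dist_le hu ht x y

/-- One step of the flow agrees to second order with a step of the explicit Euler scheme for any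
field `w` close to `u`. -/
lemma norm_sub_euler_le (hΦ : IsFlow T u Φ) (hu : IsLipschitzField T L U u) {s h δ : ℝ} (hs : 0 ≤ s)
    (hh : 0 ≤ h) (hsT : s + h ≤ T) (w : E → E) (x : E)
    (hw : ∀ σ ∈ Set.Icc s (s + h), ‖u σ (Φ s x) - w (Φ s x)‖ ≤ δ) :
    ‖Φ (s + h) x - (Φ s x + h • w (Φ s x))‖ ≤ (L * (U * h) + δ) * h := by
  have hsub : Set.Icc s (s + h) ⊆ Set.Icc 0 T := Set.Icc_subset_Icc hs hsT
  have hL := hu.lipschitz_nonneg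
  have hU := hu.bound_nonneg
  have hd : ∀ σ ∈ Set.Icc s (s + h), HasDerivWithinAt (fun τ => Φ τ x - (τ - s) • w (Φ s x))
      (u σ (Φ σ x) - w (Φ s x)) (Set.Icc s (s + h)) σ := by
    intro σ hσ
    have h1 := (hΦ.hasDeriv x σ (hsub hσ)).mono hsub
    have h2 : HasDerivWithinAt (fun τ : ℝ => (τ - s) • w (Φ s x)) ((1 : ℝ) • w (Φ s x))
        (Set.Icc s (s + h)) σ := ((hasDerivAt_id σ).sub_const s).hasDerivWithinAt.smul_const _
    rw [one_smul] at h2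
    exact h1.sub h2
  have := (convex_Icc s (s + h)).norm_image_sub_le_of_norm_hasDerivWithin_le hd
    (C := L * (U * h) + δ) (fun σ hσ => ?_) (Set.left_mem_Icc.2 (by linarith))
    (Set.right_mem_Icc.2 (by linarith))
  · simp only [add_sub_cancel_left, sub_self, zero_smul, sub_zero, Real.norm_eq_abs,
      abs_of_nonneg hh] at this
    rwa [sub_sub, add_comm (h • w _)] at this
  · have e : u σ (Φ σ x) - w (Φ s x) = (u σ (Φ σ x) - u σ (Φ s x)) + (u σ (Φ s x) - w (Φ s x)) := by
      abel
    rw [e]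
    refine (norm_add_le _ _).trans (add_le_add ?_ (hw σ hσ))
    refine (hu.norm_sub_le σ (hsub hσ) _ _).trans (mul_le_mul_of_nonneg_left ?_ hL)
    refine (hΦ.norm_sub_le hu (hsub (Set.left_mem_Icc.2 (by linarith))) (hsub hσ) x).trans ?_
    refine mul_le_mul_of_nonneg_left ?_ hU
    rw [abs_of_nonneg (by linarith [hσ.1])]; linarith [hσ.2]

end IsFlow

/-! ### Mollification of Lipschitz fields -/

section Mollification

variable {E : Type*} [NormedAddCommGroup E] [InnerProductSpace ℝ E] [FiniteDimensional ℝ E]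
  [MeasurableSpace E] [BorelSpace E]

/-- A smooth function with compact support has translates whose `L¹` distance is linear in the
shift. -/
lemma exists_integral_translate_le {η : E → ℝ} (hη : ContDiff ℝ ∞ η) (hc : HasCompactSupport η) :
    ∃ A : ℝ, 0 ≤ A ∧ ∀ b, ∫ z, ‖η (z + b) - η z‖ ≤ A * ‖b‖ := by
  obtain ⟨ℓ, hℓ⟩ := hη.lipschitzWith_of_hasCompactSupport hc (by simp)
  set S := tsupport η
  have hS : IsCompact S := hc
  refine ⟨ℓ * (2 * (volume : Measure E).real S), by positivity, fun b => ?_⟩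
  have hi : Integrable (S.indicator (fun _ => (1 : ℝ))) (volume : Measure E) :=
    (integrable_indicator_iff hS.measurableSet).2 (integrableOn_const hS.measure_lt_top.ne)
  have hib := hi.comp_add_right b
  have hint : ∫ z, S.indicator (fun _ => (1 : ℝ)) z = (volume : Measure E).real S := by
    rw [integral_indicator_const _ hS.measurableSet]; simp
  calc ∫ z, ‖η (z + b) - η z‖
      ≤ ∫ z, ℓ * ‖b‖ * (S.indicator (fun _ => (1 : ℝ)) (z + b) + S.indicator (fun _ => 1) z) := by
        refine integral_mono_of_nonneg (ae_of_all _ fun z => norm_nonneg _)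
          ((hib.add hi).const_mul _) (ae_of_all _ fun z => ?_)
        have h1 : ‖η (z + b) - η z‖ ≤ ℓ * ‖b‖ := by
          have := hℓ.dist_le_mul (z + b) z
          rwa [dist_eq_norm, dist_eq_norm, add_sub_cancel_left] at this
        by_cases hz : z ∈ S
        · refine h1.trans (le_mul_of_one_le_right (by positivity) ?_)
          rw [Set.indicator_of_mem hz]
          linarith [Set.indicator_nonneg (s := S) (f := fun _ : E => (1 : ℝ))
            (fun _ _ => zero_le_one) (z + b)]
        by_cases hzb : z + b ∈ S
        · refine h1.trans (le_mul_of_one_le_right (by positivity) ?_)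
          rw [Set.indicator_of_mem hzb]
          linarith [Set.indicator_nonneg (s := S) (f := fun _ : E => (1 : ℝ))
            (fun _ _ => zero_le_one) z]
        · simp [image_eq_zero_of_notMem_tsupport hz, image_eq_zero_of_notMem_tsupport hzb,
            Set.indicator_of_notMem hz, Set.indicator_of_notMem hzb]
    _ = _ := by
        rw [integral_const_mul, integral_add hib hi, hint,
          integral_add_right_eq_self (S.indicator fun _ => (1 : ℝ)) b, hint]
        ring

/-- Bounded Lipschitz fields are uniformly close to smooth fields with the same bounds and with a
Lipschitz bound for the derivative that depends on the distance only. -/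
theorem exists_smooth_approx (L U : ℝ) (hL : 0 ≤ L) {ε : ℝ} (hε : 0 < ε) :
    ∃ L₂ : ℝ, 0 ≤ L₂ ∧ ∀ v : E → E, (∀ x y, ‖v x - v y‖ ≤ L * ‖x - y‖) → (∀ x, ‖v x‖ ≤ U) →
      ∃ w : E → E, ContDiff ℝ ∞ w ∧ (∀ x, ‖w x‖ ≤ U) ∧ (∀ x, ‖fderiv ℝ w x‖ ≤ L) ∧
        (∀ x y, ‖fderiv ℝ w x - fderiv ℝ w y‖ ≤ L₂ * ‖x - y‖) ∧ ∀ x, ‖w x - v x‖ ≤ L * ε := by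
  let χ : ContDiffBump (0 : E) :=
    { rIn := ε / 2, rOut := ε, rIn_pos := half_pos hε, rIn_lt_rOut := half_lt_self hε }
  set η : E → ℝ := χ.normed volume
  have hη : ContDiff ℝ ∞ η := χ.contDiff_normed
  have hηc : HasCompactSupport η := χ.hasCompactSupport_normed
  have hη0 : ∀ z, 0 ≤ η z := χ.nonneg_normed
  have hη1 : ∫ z, η z = 1 := χ.integral_normed
  have hηi : Integrable η := χ.integrable_normed
  obtain ⟨A, hA, hAη⟩ := exists_integral_translate_le hη hηc
  refine ⟨A * L, by positivity, fun v hv hvU => ?_⟩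
  have hvc : Continuous v := by
    refine (LipschitzWith.of_dist_le_mul (K := L.toNNReal) fun x y => ?_).continuous
    rw [dist_eq_norm, dist_eq_norm, Real.coe_toNNReal _ hL]; exact hv x y
  set w : E → E := fun x => ∫ z, η z • v (x - z)
  have hi : ∀ f : E → ℝ, Integrable f → ∀ x, Integrable fun z => f z • v (x - z) := fun f hf x =>
    hf.smul_bdd U (hvc.comp (continuous_const.sub continuous_id)).aestronglyMeasurable
      (ae_of_all _ fun z => hvU _)
  have hw : ContDiff ℝ ∞ w :=
    hηc.contDiff_convolution_left (ContinuousLinearMap.lsmul ℝ ℝ) hη hvc.locallyIntegrable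
  have hwL : LipschitzWith L.toNNReal w := by
    refine LipschitzWith.of_dist_le_mul fun x y => ?_
    rw [dist_eq_norm, dist_eq_norm, Real.coe_toNNReal _ hL]
    simp only [w]
    rw [← integral_sub (hi η hηi x) (hi η hηi y)]
    refine (norm_integral_le_of_norm_le (hηi.mul_const (L * ‖x - y‖))
      (ae_of_all _ fun z => ?_)).trans (le_of_eq (by rw [integral_mul_const, hη1, one_mul]))
    rw [← smul_sub, norm_smul, Real.norm_eq_abs, abs_of_nonneg (hη0 z)]
    refine mul_le_mul_of_nonneg_left ((hv _ _).trans (le_of_eq ?_)) (hη0 z)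
    rw [sub_sub_sub_cancel_right]
  refine ⟨w, hw, fun x => ?_, fun x => ?_, fun x y => ?_, fun x => ?_⟩
  · refine (norm_integral_le_of_norm_le (hηi.mul_const U) (ae_of_all _ fun z => ?_)).trans
      (le_of_eq (by rw [integral_mul_const, hη1, one_mul]))
    rw [norm_smul, Real.norm_eq_abs, abs_of_nonneg (hη0 z)]
    exact mul_le_mul_of_nonneg_left (hvU _) (hη0 z)
  · have := norm_fderiv_le_of_lipschitz ℝ hwL (x₀ := x)
    rwa [Real.coe_toNNReal _ hL] at this
  · -- the increment `w (· + b) - w` is Lipschitz with constant proportional to `‖b‖`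
    set b := x - y
    have hG : LipschitzWith (A * L * ‖b‖).toNNReal fun x => w (x + b) - w x := by
      have hrep : ∀ x, w (x + b) - w x = ∫ z, (η (z + b) - η z) • v (x - z) := by
        intro x
        have e : w (x + b) = ∫ z, η (z + b) • v (x - z) := by
          simp only [w]
          rw [← integral_add_right_eq_self _ b]
          simp only [add_sub_add_right_eq_sub]
        simp_rw [sub_smul]
        rw [integral_sub (hi _ (hηi.comp_add_right b) x) (hi η hηi x), e]
      have hdi : Integrable fun z => η (z + b) - η z := (hηi.comp_add_right b).sub hηi
      refine LipschitzWith.of_dist_le_mul fun x y => ?_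
      rw [dist_eq_norm, dist_eq_norm, Real.coe_toNNReal _ (by positivity), hrep, hrep,
        ← integral_sub (hi _ hdi x) (hi _ hdi y)]
      refine (norm_integral_le_of_norm_le (hdi.norm.mul_const (L * ‖x - y‖))
        (ae_of_all _ fun z => ?_)).trans ?_
      · rw [← smul_sub, norm_smul]
        refine mul_le_mul_of_nonneg_left ((hv _ _).trans (le_of_eq ?_)) (norm_nonneg _)
        rw [sub_sub_sub_cancel_right]
      · rw [integral_mul_const]
        calc _ ≤ A * ‖b‖ * (L * ‖x - y‖) :=
              mul_le_mul_of_nonneg_right (hAη b) (by positivity)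
          _ = _ := by ring
    have h1 := norm_fderiv_le_of_lipschitz ℝ hG (x₀ := y)
    rw [Real.coe_toNNReal _ (by positivity)] at h1
    have hwd := hw.differentiable (by simp)
    have h2 : fderiv ℝ (fun x => w (x + b) - w x) y = fderiv ℝ w x - fderiv ℝ w y := by
      have hwb : DifferentiableAt ℝ (fun x => w (x + b)) y :=
        DifferentiableAt.comp (g := w) (f := fun x => x + b) y (hwd (y + b))
          (differentiableAt_id.add_const b)
      rw [fderiv_fun_sub hwb (hwd y), fderiv_comp_add_right]
      simp [b]
    rwa [h2] at h1
  · rw [← dist_eq_norm]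
    refine χ.dist_normed_convolution_le hvc.aestronglyMeasurable fun y hy => ?_
    rw [dist_eq_norm]
    refine (hv y x).trans (mul_le_mul_of_nonneg_left ?_ hL)
    rw [← dist_eq_norm]
    exact (Metric.mem_ball.1 hy).le

end Mollification

/-! ### Measure solutions of the continuity equation are transported by the flow -/

section Transport

variable {E : Type*} [NormedAddCommGroup E] [InnerProductSpace ℝ E]

/-- Test functions supported in the ball of radius `r`, with gradient bounded by `A` and
`B`-Lipschitz. -/
structure IsTestFunction (r A B : ℝ) (ψ : E → ℝ) : Prop where
  contDiff : ContDiff ℝ ∞ ψ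
  eq_zero : ∀ x, r < ‖x‖ → ψ x = 0
  norm_fderiv_le : ∀ x, ‖fderiv ℝ ψ x‖ ≤ A
  norm_fderiv_sub_le : ∀ x y, ‖fderiv ℝ ψ x - fderiv ℝ ψ y‖ ≤ B * ‖x - y‖

/-- Smooth time-independent fields bounded by `U`, with gradient bounded by `L` and
`L₂`-Lipschitz. -/
structure IsSmoothField (U L L₂ : ℝ) (w : E → E) : Prop where
  contDiff : ContDiff ℝ ∞ w
  norm_le : ∀ x, ‖w x‖ ≤ U
  norm_fderiv_le : ∀ x, ‖fderiv ℝ w x‖ ≤ L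
  norm_fderiv_sub_le : ∀ x y, ‖fderiv ℝ w x - fderiv ℝ w y‖ ≤ L₂ * ‖x - y‖

namespace IsTestFunction

variable {r A B : ℝ} {ψ : E → ℝ}

lemma mono (h : IsTestFunction r A B ψ) {r' A' B' : ℝ} (hr : r ≤ r') (hA : A ≤ A') (hB : B ≤ B') :
    IsTestFunction r' A' B' ψ where
  contDiff := h.contDiff
  eq_zero x hx := h.eq_zero x (hr.trans_lt hx)
  norm_fderiv_le x := (h.norm_fderiv_le x).trans hA
  norm_fderiv_sub_le x y := (h.norm_fderiv_sub_le x y).trans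
    (mul_le_mul_of_nonneg_right hB (norm_nonneg _))

lemma differentiable (h : IsTestFunction r A B ψ) : Differentiable ℝ ψ :=
  h.contDiff.differentiable (by simp)

lemma hasCompactSupport [FiniteDimensional ℝ E] (h : IsTestFunction r A B ψ) :
    HasCompactSupport ψ :=
  HasCompactSupport.intro (isCompact_closedBall (0 : E) r) fun x hx =>
    h.eq_zero x (by simpa using hx)

lemma fderiv_eq_zero (h : IsTestFunction r A B ψ) {x : E} (hx : r < ‖x‖) : fderiv ℝ ψ x = 0 := by
  have : ψ =ᶠ[𝓝 x] fun _ => 0 := by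
    filter_upwards [(isOpen_lt continuous_const continuous_norm).mem_nhds hx] with y hy
    exact h.eq_zero y hy
  rw [this.fderiv_eq]
  exact fderiv_const_apply 0

lemma abs_sub_le (h : IsTestFunction r A B ψ) (x y : E) : |ψ x - ψ y| ≤ A * ‖x - y‖ :=
  convex_univ.norm_image_sub_le_of_norm_fderiv_le (fun z _ => h.differentiable z)
    (fun z _ => h.norm_fderiv_le z) trivial trivial

lemma abs_taylor_le (hB : 0 ≤ B) (h : IsTestFunction r A B ψ) (x v : E) :
    |ψ (x + v) - ψ x - fderiv ℝ ψ x v| ≤ B * ‖v‖ ^ 2 := by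
  have := (convex_closedBall x ‖v‖).norm_image_sub_le_of_norm_fderiv_le'
    (f := ψ) (φ := fderiv ℝ ψ x) (C := B * ‖v‖) (fun z _ => h.differentiable z)
    (fun z hz => (h.norm_fderiv_sub_le z x).trans
      (mul_le_mul_of_nonneg_left (by rwa [← dist_eq_norm]) hB))
    (Metric.mem_closedBall_self (norm_nonneg v)) (y := x + v) (by simp [dist_eq_norm])
  rw [add_sub_cancel_left, Real.norm_eq_abs] at this
  refine this.trans (le_of_eq (by ring))

end IsTestFunction

lemma IsSmoothField.norm_sub_le {U L L₂ : ℝ} {w : E → E} (hw : IsSmoothField U L L₂ w) (x y : E) :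
    ‖w x - w y‖ ≤ L * ‖x - y‖ :=
  convex_univ.norm_image_sub_le_of_norm_fderiv_le
    (fun z _ => hw.contDiff.differentiable (by simp) z)
    (fun z _ => hw.norm_fderiv_le z) trivial trivial

/-- The pull-back of a test function by an Euler step, with the resulting bounds. -/
lemma IsTestFunction.comp_euler {r A B U L L₂ h : ℝ} {ψ : E → ℝ} {w : E → E}
    (hψ : IsTestFunction r A B ψ) (hw : IsSmoothField U L L₂ w) (hh : 0 ≤ h) (hA : 0 ≤ A)
    (hB : 0 ≤ B) (hL : 0 ≤ L) :
    IsTestFunction (r + h * U) (A * (1 + h * L)) (B * (1 + h * L) ^ 2 + A * (h * L₂))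
      (fun x => ψ (x + h • w x)) := by
  have hwd : Differentiable ℝ w := hw.contDiff.differentiable (by simp)
  have hd : ∀ x, fderiv ℝ (fun x => ψ (x + h • w x)) x = (fderiv ℝ ψ (x + h • w x)).comp
      (ContinuousLinearMap.id ℝ E + h • fderiv ℝ w x) := by
    intro x
    have h1 : HasFDerivAt (fun x => x + h • w x)
        (ContinuousLinearMap.id ℝ E + h • fderiv ℝ w x) x :=
      (hasFDerivAt_id x).add ((hwd x).hasFDerivAt.const_smul h)
    exact ((hψ.differentiable _).hasFDerivAt.comp x h1).fderiv
  have hn : ∀ x, ‖ContinuousLinearMap.id ℝ E + h • fderiv ℝ w x‖ ≤ 1 + h * L := by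
    intro x
    refine (norm_add_le _ _).trans (add_le_add ContinuousLinearMap.norm_id_le ?_)
    rw [norm_smul, Real.norm_eq_abs, abs_of_nonneg hh]
    exact mul_le_mul_of_nonneg_left (hw.norm_fderiv_le x) hh
  refine ⟨hψ.contDiff.comp (contDiff_id.add (hw.contDiff.const_smul h)), fun x hx => ?_,
    fun x => ?_, fun x y => ?_⟩
  · refine hψ.eq_zero _ ?_
    have h1 : ‖x‖ ≤ ‖x + h • w x‖ + ‖h • w x‖ := by
      simpa using norm_sub_le (x + h • w x) (h • w x)
    have h2 : ‖h • w x‖ ≤ h * U := by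
      rw [norm_smul, Real.norm_eq_abs, abs_of_nonneg hh]
      exact mul_le_mul_of_nonneg_left (hw.norm_le x) hh
    linarith
  · rw [hd]
    exact (ContinuousLinearMap.opNorm_comp_le _ _).trans
      (mul_le_mul (hψ.norm_fderiv_le _) (hn x) (norm_nonneg _) hA)
  · rw [hd, hd]
    have e : (fderiv ℝ ψ (x + h • w x)).comp (ContinuousLinearMap.id ℝ E + h • fderiv ℝ w x)
        - (fderiv ℝ ψ (y + h • w y)).comp (ContinuousLinearMap.id ℝ E + h • fderiv ℝ w y)
        = (fderiv ℝ ψ (x + h • w x) - fderiv ℝ ψ (y + h • w y)).comp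
            (ContinuousLinearMap.id ℝ E + h • fderiv ℝ w x)
          + (fderiv ℝ ψ (y + h • w y)).comp (h • (fderiv ℝ w x - fderiv ℝ w y)) := by
      ext z
      simp
      ring
    have h1 : ‖(x + h • w x) - (y + h • w y)‖ ≤ (1 + h * L) * ‖x - y‖ := by
      have : (x + h • w x) - (y + h • w y) = (x - y) + h • (w x - w y) := by
        rw [smul_sub]; abel
      rw [this]
      refine (norm_add_le _ _).trans ?_
      rw [norm_smul, Real.norm_eq_abs, abs_of_nonneg hh]
      have := mul_le_mul_of_nonneg_left (hw.norm_sub_le x y) hh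
      linarith
    have hpos : 0 ≤ 1 + h * L := by positivity
    rw [e]
    refine (norm_add_le _ _).trans ?_
    have e1 : ‖(fderiv ℝ ψ (x + h • w x) - fderiv ℝ ψ (y + h • w y)).comp
            (ContinuousLinearMap.id ℝ E + h • fderiv ℝ w x)‖
        ≤ (B * ((1 + h * L) * ‖x - y‖)) * (1 + h * L) :=
      (ContinuousLinearMap.opNorm_comp_le _ _).trans (mul_le_mul
        ((hψ.norm_fderiv_sub_le _ _).trans (mul_le_mul_of_nonneg_left h1 hB)) (hn x)
        (norm_nonneg _) (by positivity))
    have e2 : ‖(fderiv ℝ ψ (y + h • w y)).comp (h • (fderiv ℝ w x - fderiv ℝ w y))‖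
        ≤ A * (h * (L₂ * ‖x - y‖)) := by
      refine (ContinuousLinearMap.opNorm_comp_le _ _).trans (mul_le_mul (hψ.norm_fderiv_le _) ?_
        (norm_nonneg _) hA)
      rw [norm_smul, Real.norm_eq_abs, abs_of_nonneg hh]
      exact mul_le_mul_of_nonneg_left (hw.norm_fderiv_sub_le x y) hh
    calc _ ≤ _ := add_le_add e1 e2
      _ = _ := by ring

variable [MeasurableSpace E]

/-- Measure-valued weak solutions on `[0, T]` of `∂ₜμ + div (u μ) = 0`; the measures are only
required to be locally finite, uniformly in time, so that Lebesgue measure is allowed. -/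
structure IsContinuitySolution (T : ℝ) (u : ℝ → E → E) (μ : ℝ → Measure E) : Prop where
  exists_bound : ∀ R, ∃ m : ℝ, 0 ≤ m ∧
    ∀ t ∈ Set.Icc 0 T, μ t (Metric.closedBall 0 R) ≤ ENNReal.ofReal m
  integrableOn : ∀ φ : E → ℝ, ContDiff ℝ ∞ φ → HasCompactSupport φ →
    IntegrableOn (fun s => ∫ x, fderiv ℝ φ x (u s x) ∂(μ s)) (Set.Icc 0 T)
  weak_eq : ∀ φ : E → ℝ, ContDiff ℝ ∞ φ → HasCompactSupport φ → ∀ t ∈ Set.Icc 0 T,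
    ∫ x, φ x ∂(μ t) = ∫ x, φ x ∂(μ 0) + ∫ s in (0 : ℝ)..t, ∫ x, fderiv ℝ φ x (u s x) ∂(μ s)

namespace IsContinuitySolution

variable {T L U : ℝ} {u : ℝ → E → E} {μ : ℝ → Measure E}

lemma mono (hμ : IsContinuitySolution T u μ) {T' : ℝ} (h : T' ≤ T) :
    IsContinuitySolution T' u μ where
  exists_bound R := by
    obtain ⟨m, hm, hb⟩ := hμ.exists_bound R
    exact ⟨m, hm, fun t ht => hb t (Set.Icc_subset_Icc_right h ht)⟩
  integrableOn φ h1 h2 := (hμ.integrableOn φ h1 h2).mono_set (Set.Icc_subset_Icc_right h)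
  weak_eq φ h1 h2 t ht := hμ.weak_eq φ h1 h2 t (Set.Icc_subset_Icc_right h ht)

lemma isFiniteMeasureOnCompacts (hμ : IsContinuitySolution T u μ) {t : ℝ} (ht : t ∈ Set.Icc 0 T) :
    IsFiniteMeasureOnCompacts (μ t) := by
  refine ⟨fun K hK => ?_⟩
  obtain ⟨R, hR⟩ := hK.isBounded.subset_closedBall (0 : E)
  obtain ⟨m, -, hm⟩ := hμ.exists_bound R
  exact (measure_mono hR).trans_lt ((hm t ht).trans_lt ENNReal.ofReal_lt_top)

lemma intervalIntegrable (hμ : IsContinuitySolution T u μ) {φ : E → ℝ} (hφ : ContDiff ℝ ∞ φ)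
    (hc : HasCompactSupport φ) {s t : ℝ} (hs : s ∈ Set.Icc 0 T) (ht : t ∈ Set.Icc 0 T) :
    IntervalIntegrable (fun s => ∫ x, fderiv ℝ φ x (u s x) ∂(μ s)) volume s t := by
  rw [intervalIntegrable_iff]
  refine (hμ.integrableOn φ hφ hc).mono_set (Set.uIoc_subset_uIcc.trans ?_)
  exact Set.uIcc_subset_Icc hs ht

lemma sub_eq (hμ : IsContinuitySolution T u μ) {φ : E → ℝ} (hφ : ContDiff ℝ ∞ φ)
    (hc : HasCompactSupport φ) {s t : ℝ} (hs : s ∈ Set.Icc 0 T) (ht : t ∈ Set.Icc 0 T) :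
    ∫ x, φ x ∂(μ t) - ∫ x, φ x ∂(μ s)
      = ∫ σ in s..t, ∫ x, fderiv ℝ φ x (u σ x) ∂(μ σ) := by
  have h0 : (0 : ℝ) ∈ Set.Icc 0 T := ⟨le_rfl, ht.1.trans ht.2⟩
  rw [hμ.weak_eq φ hφ hc t ht, hμ.weak_eq φ hφ hc s hs,
    ← intervalIntegral.integral_add_adjacent_intervals (hμ.intervalIntegrable hφ hc h0 hs)
      (hμ.intervalIntegrable hφ hc hs ht)]
  ring

end IsContinuitySolution

lemma abs_integral_le_of_eq_zero {F : Type*} [NormedAddCommGroup F] [MeasurableSpace F]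
    {ν : Measure F} {f : F → ℝ} {R m c : ℝ} (hm : 0 ≤ m) (hc : 0 ≤ c)
    (hν : ν (Metric.closedBall 0 R) ≤ ENNReal.ofReal m) (hf0 : ∀ x, R < ‖x‖ → f x = 0)
    (hf : ∀ x ∈ Metric.closedBall (0 : F) R, |f x| ≤ c) : |∫ x, f x ∂ν| ≤ c * m := by
  rw [← setIntegral_eq_integral_of_forall_compl_eq_zero (s := Metric.closedBall 0 R)
    fun x hx => hf0 x (by simpa using hx), ← Real.norm_eq_abs]
  refine (norm_setIntegral_le_of_norm_le_const (hν.trans_lt ENNReal.ofReal_lt_top) hf).trans ?_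
  exact mul_le_mul_of_nonneg_left (ENNReal.toReal_le_of_le_ofReal hm hν) hc

variable [FiniteDimensional ℝ E] [BorelSpace E] {T L U : ℝ} {u : ℝ → E → E} {μ : ℝ → Measure E}

/-- Moving a test function back by one Euler step compensates the evolution of the measure up to
the distance of the fields and a quadratic error. -/
lemma IsContinuitySolution.abs_integral_sub_euler_le (hu : IsLipschitzField T L U u)
    (hμ : IsContinuitySolution T u μ) {r R A B L₂ m s h δ : ℝ} {ψ : E → ℝ} {w : E → E}
    (hψ : IsTestFunction r A B ψ) (hA : 0 ≤ A) (hB : 0 ≤ B) (hw : IsSmoothField U L L₂ w)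
    (hs : 0 ≤ s) (hh : 0 ≤ h) (hsT : s + h ≤ T) (hrR : r + h * U ≤ R) (hm : 0 ≤ m) (hδ : 0 ≤ δ)
    (hμm : ∀ t ∈ Set.Icc 0 T, μ t (Metric.closedBall 0 R) ≤ ENNReal.ofReal m)
    (huw : ∀ σ ∈ Set.Icc s (s + h), ∀ x ∈ Metric.closedBall (0 : E) R, ‖u σ x - w x‖ ≤ δ) :
    |∫ x, ψ x ∂(μ (s + h)) - ∫ x, ψ (x + h • w x) ∂(μ s)|
      ≤ (A * δ + h * (2 * B * U ^ 2 + A * L * U)) * m * h := by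
  have hL := hu.lipschitz_nonneg
  have hU := hu.bound_nonneg
  have hsub : Set.Icc s (s + h) ⊆ Set.Icc 0 T := Set.Icc_subset_Icc hs hsT
  have hs' : s ∈ Set.Icc 0 T := hsub (Set.left_mem_Icc.2 (by linarith))
  have hsh' : s + h ∈ Set.Icc 0 T := hsub (Set.right_mem_Icc.2 (by linarith))
  have hψs := hψ.contDiff
  have hψc := hψ.hasCompactSupport
  have hψ' : ContDiff ℝ ∞ (fderiv ℝ ψ) := hψs.fderiv_right (by simp)
  have hrR' : r ≤ R := by nlinarith
  set g : E → ℝ := fun x => fderiv ℝ ψ x (w x)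
  have hg : ContDiff ℝ ∞ g := hψ'.clm_apply hw.contDiff
  have hgz : ∀ x, R < ‖x‖ → g x = 0 := fun x hx => by
    simp [g, hψ.fderiv_eq_zero (hrR'.trans_lt hx)]
  have hgc : HasCompactSupport g :=
    HasCompactSupport.intro (isCompact_closedBall (0 : E) R) fun x hx => hgz x (by simpa using hx)
  have hgL : LipschitzWith (B * U + A * L).toNNReal g := by
    refine LipschitzWith.of_dist_le_mul fun x y => ?_
    rw [dist_eq_norm, dist_eq_norm, Real.coe_toNNReal _ (by positivity)]
    have e : g x - g y = (fderiv ℝ ψ x - fderiv ℝ ψ y) (w x) + fderiv ℝ ψ y (w x - w y) := by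
      simp [g]
    rw [e]
    refine (norm_add_le _ _).trans ?_
    have e1 : ‖(fderiv ℝ ψ x - fderiv ℝ ψ y) (w x)‖ ≤ B * ‖x - y‖ * U :=
      (ContinuousLinearMap.le_opNorm _ _).trans (mul_le_mul (hψ.norm_fderiv_sub_le x y)
        (hw.norm_le x) (norm_nonneg _) (by positivity))
    have e2 : ‖fderiv ℝ ψ y (w x - w y)‖ ≤ A * (L * ‖x - y‖) :=
      (ContinuousLinearMap.le_opNorm _ _).trans (mul_le_mul (hψ.norm_fderiv_le y)
        (hw.norm_sub_le x y) (norm_nonneg _) hA)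
    linarith
  have hg' : ∀ x, ‖fderiv ℝ g x‖ ≤ B * U + A * L := fun x => by
    have := norm_fderiv_le_of_lipschitz ℝ hgL (x₀ := x)
    rwa [Real.coe_toNNReal _ (by positivity)] at this
  have hgz' : ∀ x, R < ‖x‖ → fderiv ℝ g x = 0 := by
    intro x hx
    have : g =ᶠ[𝓝 x] fun _ => 0 := by
      filter_upwards [(isOpen_lt continuous_const continuous_norm).mem_nhds hx] with y hy
      exact hgz y hy
    rw [this.fderiv_eq]
    exact fderiv_const_apply 0
  -- the integrand of the weak formulation is nearly constant in time
  have hgt : ∀ σ ∈ Set.Icc s (s + h), |∫ x, g x ∂(μ σ) - ∫ x, g x ∂(μ s)|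
      ≤ (B * U + A * L) * U * m * h := by
    intro σ hσ
    rw [hμ.sub_eq hg hgc hs' (hsub hσ), ← Real.norm_eq_abs]
    have hb : ∀ τ ∈ Set.uIoc s σ, ‖∫ x, fderiv ℝ g x (u τ x) ∂(μ τ)‖ ≤ (B * U + A * L) * U * m := by
      intro τ hτ
      rw [Set.uIoc_of_le hσ.1] at hτ
      have hτ' : τ ∈ Set.Icc 0 T := hsub ⟨hτ.1.le, hτ.2.trans hσ.2⟩
      refine abs_integral_le_of_eq_zero hm (by positivity) (hμm τ hτ')
        (fun x hx => by simp [hgz' x hx]) fun x _ => ?_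
      exact (ContinuousLinearMap.le_opNorm _ _).trans (mul_le_mul (hg' x) (hu.norm_le τ hτ' x)
        (norm_nonneg _) (by positivity))
    refine (intervalIntegral.norm_integral_le_of_norm_le_const hb).trans ?_
    rw [abs_of_nonneg (by linarith [hσ.1])]
    exact mul_le_mul_of_nonneg_left (by linarith [hσ.2]) (by positivity)
  have hFt : ∀ σ ∈ Set.Icc s (s + h), |∫ x, fderiv ℝ ψ x (u σ x) ∂(μ σ) - ∫ x, g x ∂(μ σ)|
      ≤ A * δ * m := by
    intro σ hσ
    have := hμ.isFiniteMeasureOnCompacts (hsub hσ)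
    have huc : Continuous (u σ) := (hu.lipschitzWith (hsub hσ)).continuous
    have i1 : Integrable (fun x => fderiv ℝ ψ x (u σ x)) (μ σ) := by
      refine (hψ'.continuous.clm_apply huc).integrable_of_hasCompactSupport ?_
      exact HasCompactSupport.intro (isCompact_closedBall (0 : E) R) fun x hx => by
        simp [hψ.fderiv_eq_zero (hrR'.trans_lt (by simpa using hx))]
    have i2 : Integrable g (μ σ) := hg.continuous.integrable_of_hasCompactSupport hgc
    rw [← integral_sub i1 i2]
    refine abs_integral_le_of_eq_zero hm (by positivity) (hμm σ (hsub hσ))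
      (fun x hx => by simp [g, hψ.fderiv_eq_zero (hrR'.trans_lt hx)]) fun x hx => ?_
    simp only [g]
    rw [← map_sub]
    exact (ContinuousLinearMap.le_opNorm _ _).trans (mul_le_mul (hψ.norm_fderiv_le x)
      (huw σ hσ x hx) (norm_nonneg _) hA)
  have hmain : |∫ x, ψ x ∂(μ (s + h)) - ∫ x, ψ x ∂(μ s) - h * ∫ x, g x ∂(μ s)|
      ≤ (A * δ * m + (B * U + A * L) * U * m * h) * h := by
    rw [hμ.sub_eq hψs hψc hs' hsh']
    have hconst : h * ∫ x, g x ∂(μ s) = ∫ _ in s..(s + h), ∫ x, g x ∂(μ s) := by simp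
    rw [hconst, ← intervalIntegral.integral_sub (hμ.intervalIntegrable hψs hψc hs' hsh')
      intervalIntegrable_const, ← Real.norm_eq_abs]
    have hb : ∀ σ ∈ Set.uIoc s (s + h), ‖(∫ x, fderiv ℝ ψ x (u σ x) ∂(μ σ)) - ∫ x, g x ∂(μ s)‖
        ≤ A * δ * m + (B * U + A * L) * U * m * h := by
      intro σ hσ
      rw [Set.uIoc_of_le (by linarith)] at hσ
      have hσ' : σ ∈ Set.Icc s (s + h) := ⟨hσ.1.le, hσ.2⟩
      have e : (∫ x, fderiv ℝ ψ x (u σ x) ∂(μ σ)) - ∫ x, g x ∂(μ s)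
          = ((∫ x, fderiv ℝ ψ x (u σ x) ∂(μ σ)) - ∫ x, g x ∂(μ σ))
            + (∫ x, g x ∂(μ σ) - ∫ x, g x ∂(μ s)) := by ring
      rw [e]
      exact (norm_add_le _ _).trans (add_le_add (hFt σ hσ') (hgt σ hσ'))
    refine (intervalIntegral.norm_integral_le_of_norm_le_const hb).trans (le_of_eq ?_)
    rw [add_sub_cancel_left, abs_of_nonneg hh]
  have htay : |∫ x, ψ (x + h • w x) ∂(μ s) - ∫ x, ψ x ∂(μ s) - h * ∫ x, g x ∂(μ s)|
      ≤ B * (h * U) ^ 2 * m := by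
    have := hμ.isFiniteMeasureOnCompacts hs'
    have hψe := hψ.comp_euler hw hh hA hB hL
    have i0 : Integrable ψ (μ s) := hψs.continuous.integrable_of_hasCompactSupport hψc
    have i1 : Integrable (fun x => ψ (x + h • w x)) (μ s) :=
      hψe.contDiff.continuous.integrable_of_hasCompactSupport hψe.hasCompactSupport
    have i10 : Integrable (fun x => ψ (x + h • w x) - ψ x) (μ s) := i1.sub i0
    have i2 : Integrable g (μ s) := hg.continuous.integrable_of_hasCompactSupport hgc
    rw [← integral_const_mul, ← integral_sub i1 i0, ← integral_sub i10 (i2.const_mul h)]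
    refine abs_integral_le_of_eq_zero hm (by positivity) (hμm s hs') (fun x hx => ?_)
      fun x _ => ?_
    · rw [hψe.eq_zero x (hrR.trans_lt hx), hψ.eq_zero x (hrR'.trans_lt hx), hgz x hx]
      simp
    · have := hψ.abs_taylor_le hB x (h • w x)
      rw [map_smul, smul_eq_mul] at this
      refine this.trans (mul_le_mul_of_nonneg_left ?_ hB)
      refine pow_le_pow_left₀ (norm_nonneg _) ?_ 2
      rw [norm_smul, Real.norm_eq_abs, abs_of_nonneg hh]
      exact mul_le_mul_of_nonneg_left (hw.norm_le x) hh
  have e : ∫ x, ψ x ∂(μ (s + h)) - ∫ x, ψ (x + h • w x) ∂(μ s)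
      = (∫ x, ψ x ∂(μ (s + h)) - ∫ x, ψ x ∂(μ s) - h * ∫ x, g x ∂(μ s))
        - (∫ x, ψ (x + h • w x) ∂(μ s) - ∫ x, ψ x ∂(μ s) - h * ∫ x, g x ∂(μ s)) := by ring
  rw [e]
  refine (abs_sub _ _).trans ((add_le_add hmain htay).trans (le_of_eq ?_))
  ring

/-- Iterating the Euler step backwards from time `n * h`, both along the measure solution and along
trajectories of the flow. -/
lemma exists_euler_iterate (hu : IsLipschitzField T L U u) (hμ : IsContinuitySolution T u μ)
    {Φ : ℝ → E → E} (hΦ : IsFlow T u Φ) {r R A B L₂ m h δ : ℝ} {φ : E → ℝ} {n : ℕ}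
    (hφ : IsTestFunction r A B φ) (hA : 0 ≤ A) (hB : 0 ≤ B) (hL₂ : 0 ≤ L₂) (hh : 0 ≤ h)
    (hn : n * h = T) (hrR : r + 2 * (T * U) ≤ R) (hm : 0 ≤ m) (hδ : 0 ≤ δ)
    (hμm : ∀ t ∈ Set.Icc 0 T, μ t (Metric.closedBall 0 R) ≤ ENNReal.ofReal m)
    {w : ℝ → E → E} (hw : ∀ s ∈ Set.Icc 0 T, IsSmoothField U L L₂ (w s))
    (huw : ∀ s, 0 ≤ s → s + h ≤ T → ∀ σ ∈ Set.Icc s (s + h),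
      ∀ x ∈ Metric.closedBall (0 : E) R, ‖u σ x - w s x‖ ≤ δ) {A' B' : ℝ}
    (hA' : A' = A * Real.exp (L * T)) (hB' : B' = Real.exp (2 * L * T) * (B + A * L₂ * T)) (j : ℕ) :
    j ≤ n → ∃ ψ : E → ℝ, IsTestFunction (r + j * h * U) (A * Real.exp (L * (j * h)))
        (Real.exp (2 * L * (j * h)) * (B + A * L₂ * (j * h))) ψ ∧
      |∫ x, φ x ∂(μ T) - ∫ x, ψ x ∂(μ (T - j * h))|
        ≤ (A' * δ + h * (2 * B' * U ^ 2 + A' * L * U)) * m * (j * h) ∧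
      ∀ y ∈ Metric.closedBall (0 : E) (r + T * U),
        |φ (Φ T y) - ψ (Φ (T - j * h) y)| ≤ A' * (L * (U * h) + δ) * (j * h) := by
  have hL := hu.lipschitz_nonneg
  have hU := hu.bound_nonneg
  have hT : 0 ≤ T := hn ▸ by positivity
  have hA0' : 0 ≤ A' := hA' ▸ by positivity
  have hB0' : 0 ≤ B' := hB' ▸ by positivity
  induction j with
  | zero =>
    intro _
    refine ⟨φ, ?_, by simp, fun y _ => by simp⟩
    simpa using hφ
  | succ j ih =>
    intro hj
    obtain ⟨ψ, hψ, h1, h2⟩ := ih (by omega)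
    have hjn : ((j : ℝ) + 1) * h ≤ T := by
      rw [← hn]
      refine mul_le_mul_of_nonneg_right ?_ hh
      exact_mod_cast hj
    have hjT : (j : ℝ) * h ≤ T := by nlinarith
    have hj0 : 0 ≤ (j : ℝ) * h := by positivity
    set s : ℝ := T - (j + 1) * h
    have hs : 0 ≤ s := by simp only [s]; linarith
    have hsh : s + h = T - j * h := by simp only [s]; ring
    have hsT : s + h ≤ T := by rw [hsh]; linarith
    have hs' : s ∈ Set.Icc 0 T := ⟨hs, by linarith⟩
    have hr' : r + j * h * U + h * U ≤ r + T * U := by nlinarith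
    have hTU : 0 ≤ T * U := by positivity
    have hψ' : IsTestFunction (r + j * h * U) A' B' ψ := by
      refine hψ.mono le_rfl ?_ ?_
      · rw [hA']; gcongr
      · rw [hB']; gcongr
    have hex : 1 + h * L ≤ Real.exp (L * h) := by
      have := Real.add_one_le_exp (L * h); linarith
    have hex0 : 0 ≤ 1 + h * L := by positivity
    refine ⟨fun x => ψ (x + h • w s x), ?_, ?_, fun y hy => ?_⟩
    · refine (hψ.comp_euler (hw s hs') hh (by positivity) (by positivity) hL).mono ?_ ?_ ?_
      · push_cast; linarith
      · push_cast
        rw [show L * ((j + 1) * h) = L * (j * h) + L * h by ring, Real.exp_add, ← mul_assoc A]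
        exact mul_le_mul_of_nonneg_left hex (by positivity)
      · push_cast
        set a := Real.exp (L * (j * h))
        set e := Real.exp (L * h)
        have ha : 1 ≤ a := Real.one_le_exp (by positivity)
        have he : 1 ≤ e := Real.one_le_exp (by positivity)
        have q1 : Real.exp (2 * L * (j * h)) = a ^ 2 := by
          rw [← Real.exp_nat_mul]; congr 1; push_cast; ring
        have q2 : Real.exp (2 * L * ((j + 1) * h)) = a ^ 2 * e ^ 2 := by
          rw [← Real.exp_nat_mul, ← Real.exp_nat_mul, ← Real.exp_add]; congr 1; push_cast; ring
        rw [q1, q2]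
        have p1 : (1 + h * L) ^ 2 ≤ e ^ 2 := pow_le_pow_left₀ hex0 hex 2
        have p2 : a ≤ a ^ 2 * e ^ 2 := by
          have : 1 ≤ a * e ^ 2 := one_le_mul_of_one_le_of_one_le ha (one_le_pow₀ he)
          nlinarith
        have p3 : a ^ 2 * (B + A * L₂ * (j * h)) * (1 + h * L) ^ 2
            ≤ a ^ 2 * (B + A * L₂ * (j * h)) * e ^ 2 :=
          mul_le_mul_of_nonneg_left p1 (by positivity)
        have p4 : A * a * (h * L₂) ≤ a ^ 2 * e ^ 2 * (A * L₂ * h) := by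
          calc A * a * (h * L₂) = a * (A * L₂ * h) := by ring
            _ ≤ _ := mul_le_mul_of_nonneg_right p2 (by positivity)
        calc _ ≤ _ := add_le_add p3 p4
          _ = _ := by ring
    · have h3 := hμ.abs_integral_sub_euler_le hu hψ' hA0' hB0' (hw s hs') hs hh hsT
        (by linarith) hm hδ hμm (huw s hs hsT)
      rw [hsh] at h3
      push_cast
      have e : ∫ x, φ x ∂(μ T) - ∫ x, ψ (x + h • w s x) ∂(μ s)
          = (∫ x, φ x ∂(μ T) - ∫ x, ψ x ∂(μ (T - j * h)))
            + (∫ x, ψ x ∂(μ (T - j * h)) - ∫ x, ψ (x + h • w s x) ∂(μ s)) := by ring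
      rw [e]
      refine (abs_add_le _ _).trans ((add_le_add h1 h3).trans (le_of_eq ?_))
      ring
    · have hys : Φ s y ∈ Metric.closedBall (0 : E) R := by
        have q1 := hΦ.norm_sub_le hu ⟨le_rfl, hT⟩ hs' y
        rw [hΦ.initial, sub_zero, abs_of_nonneg hs] at q1
        have q2 : U * s ≤ U * T := mul_le_mul_of_nonneg_left hs'.2 hU
        have q3 := norm_le_norm_add_norm_sub' (Φ s y) y
        rw [mem_closedBall_zero_iff] at hy ⊢
        linarith
      have h3 := hΦ.norm_sub_euler_le hu hs hh hsT (w s) y (fun σ hσ => huw s hs hsT σ hσ _ hys)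
      have h4 := hψ'.abs_sub_le (Φ (s + h) y) (Φ s y + h • w s (Φ s y))
      rw [hsh] at h3 h4
      push_cast
      have e : φ (Φ T y) - ψ (Φ s y + h • w s (Φ s y))
          = (φ (Φ T y) - ψ (Φ (T - j * h) y))
            + (ψ (Φ (T - j * h) y) - ψ (Φ s y + h • w s (Φ s y))) := by ring
      rw [e]
      refine (abs_add_le _ _).trans ((add_le_add (h2 y hy)
        (h4.trans (mul_le_mul_of_nonneg_left h3 hA0'))).trans (le_of_eq ?_))
      ring

/-- **Representation by the flow.** A measure solution of the continuity equation for a bounded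
Lipschitz field is transported by the flow of the field. -/
theorem IsContinuitySolution.integral_eq (hT : 0 ≤ T) (hu : IsLipschitzField T L U u)
    (hμ : IsContinuitySolution T u μ) {Φ : ℝ → E → E} (hΦ : IsFlow T u Φ) {φ : E → ℝ}
    (hφ : ContDiff ℝ ∞ φ) (hc : HasCompactSupport φ) :
    ∫ x, φ x ∂(μ T) = ∫ x, φ (Φ T x) ∂(μ 0) := by
  have hL := hu.lipschitz_nonneg
  have hU := hu.bound_nonneg
  have h0T : (0 : ℝ) ∈ Set.Icc 0 T := ⟨le_rfl, hT⟩
  have hTT : T ∈ Set.Icc 0 T := ⟨hT, le_rfl⟩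
  -- quantitative bounds for the test function
  obtain ⟨r, A, B, hA, hB, hφt⟩ : ∃ r A B : ℝ, 0 ≤ A ∧ 0 ≤ B ∧ IsTestFunction r A B φ := by
    obtain ⟨r, hr⟩ := hc.isBounded.subset_closedBall (0 : E)
    have hφ' : ContDiff ℝ ∞ (fderiv ℝ φ) := hφ.fderiv_right (by simp)
    obtain ⟨A, hA⟩ := hφ'.continuous.bounded_above_of_compact_support (hc.fderiv ℝ)
    obtain ⟨B, hB⟩ := hφ'.lipschitzWith_of_hasCompactSupport (hc.fderiv ℝ) (by simp)
    refine ⟨r, A, B, (norm_nonneg _).trans (hA 0), B.2, hφ, fun x hx => ?_, hA, fun x y => ?_⟩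
    · refine image_eq_zero_of_notMem_tsupport fun h => ?_
      have := hr h
      rw [mem_closedBall_zero_iff] at this; linarith
    · rw [← dist_eq_norm, ← dist_eq_norm]; exact hB.dist_le_mul x y
  set R := r + 2 * (T * U)
  obtain ⟨m, hm, hμm⟩ := hμ.exists_bound R
  set A' := A * Real.exp (L * T)
  have hA' : 0 ≤ A' := by positivity
  have key : ∀ δ : ℝ, 0 < δ → |∫ x, φ x ∂(μ T) - ∫ x, φ (Φ T x) ∂(μ 0)|
      ≤ δ * ((A' + 1) * m * T + (A' + 1) * T * m) := by
    intro δ hδ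
    obtain ⟨L₂, hL₂, happ⟩ := exists_smooth_approx (E := E) L U hL
      (ε := δ / (2 * (L + 1))) (by positivity)
    have hLe : L * (δ / (2 * (L + 1))) ≤ δ / 2 := by
      rw [mul_div_assoc', div_le_div_iff₀ (by positivity) (by positivity)]
      nlinarith
    have hwex : ∀ s, ∃ w : E → E, s ∈ Set.Icc 0 T →
        IsSmoothField U L L₂ w ∧ ∀ x, ‖w x - u s x‖ ≤ δ / 2 := by
      intro s
      by_cases hs : s ∈ Set.Icc 0 T
      · obtain ⟨w, h1, h2, h3, h4, h5⟩ := happ (u s) (hu.norm_sub_le s hs) (hu.norm_le s hs)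
        exact ⟨w, fun _ => ⟨⟨h1, h2, h3, h4⟩, fun x => (h5 x).trans hLe⟩⟩
      · exact ⟨0, fun h => absurd h hs⟩
    choose w hw using hwex
    -- uniform continuity of the field on the relevant compact set
    obtain ⟨h₀, hh₀, huc⟩ := hu.exists_forall_norm_sub_le (half_pos hδ) R
    set B' := Real.exp (2 * L * T) * (B + A * L₂ * T)
    have hB' : 0 ≤ B' := by positivity
    set Q := 2 * B' * U ^ 2 + A' * L * U
    have hQ : 0 ≤ Q := by positivity
    obtain ⟨n, hn⟩ := exists_nat_gt (T / h₀ + T * Q / δ)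
    have hn0 : (0 : ℝ) < n := lt_of_le_of_lt (by positivity) hn
    set h := T / n
    have hh : 0 ≤ h := by positivity
    have hnh : n * h = T := by simp only [h]; field_simp
    have hhh : h < h₀ := by
      have : T / h₀ < n := lt_of_le_of_lt (le_add_of_nonneg_right (by positivity)) hn
      rw [div_lt_iff₀ hh₀] at this
      rw [div_lt_iff₀ hn0]; linarith
    have hhQ : h * Q ≤ δ := by
      have : T * Q / δ < n := lt_of_le_of_lt (le_add_of_nonneg_left (by positivity)) hn
      rw [div_lt_iff₀ hδ] at this
      rw [div_mul_eq_mul_div, div_le_iff₀ hn0]; linarith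
    have huw : ∀ s, 0 ≤ s → s + h ≤ T → ∀ σ ∈ Set.Icc s (s + h),
        ∀ x ∈ Metric.closedBall (0 : E) R, ‖u σ x - w s x‖ ≤ δ := by
      intro s hs hsT σ hσ x hx
      have hs' : s ∈ Set.Icc 0 T := ⟨hs, by linarith⟩
      have h1 := huc s hs' σ ⟨hs.trans hσ.1, hσ.2.trans hsT⟩
        (by rw [abs_of_nonneg (by linarith [hσ.1])]; linarith [hσ.2]) x hx
      have h2 := (hw s hs').2 x
      rw [norm_sub_rev] at h2
      have h3 := norm_sub_le_norm_sub_add_norm_sub (u σ x) (u s x) (w s x)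
      linarith
    obtain ⟨ψ, hψ, h1, h2⟩ := exists_euler_iterate hu hμ hΦ hφt hA hB hL₂ hh hnh le_rfl hm hδ.le
      hμm (fun s hs => (hw s hs).1) huw rfl rfl n le_rfl
    rw [hnh, sub_self] at h1 h2
    rw [hnh] at hψ
    have hTU : 0 ≤ T * U := by positivity
    have h3 : |∫ x, ψ x ∂(μ 0) - ∫ x, φ (Φ T x) ∂(μ 0)|
        ≤ A' * (L * (U * h) + δ) * T * m := by
      have := hμ.isFiniteMeasureOnCompacts h0T
      have hφz : ∀ x, r + T * U < ‖x‖ → φ (Φ T x) = 0 := by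
        intro x hx
        refine hφt.eq_zero _ ?_
        have q1 := hΦ.norm_sub_le hu h0T hTT x
        rw [hΦ.initial, sub_zero, abs_of_nonneg hT] at q1
        have q3 := norm_le_norm_add_norm_sub (Φ T x) x
        linarith
      have hψz : ∀ x, r + T * U < ‖x‖ → ψ x = 0 := hψ.eq_zero
      have i1 : Integrable ψ (μ 0) :=
        hψ.contDiff.continuous.integrable_of_hasCompactSupport hψ.hasCompactSupport
      have i2 : Integrable (fun x => φ (Φ T x)) (μ 0) := by
        refine (hφ.continuous.comp (hΦ.continuous hu hTT)).integrable_of_hasCompactSupport ?_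
        exact HasCompactSupport.intro (isCompact_closedBall (0 : E) (r + T * U)) fun x hx =>
          hφz x (by simpa using hx)
      rw [← integral_sub i1 i2]
      refine abs_integral_le_of_eq_zero (R := r + T * U) hm (by positivity)
        ((measure_mono (Metric.closedBall_subset_closedBall (by linarith))).trans (hμm 0 h0T))
        (fun x hx => by rw [hφz x hx, hψz x hx, sub_zero]) fun x hx => ?_
      have := h2 x hx
      rw [hΦ.initial] at this
      rwa [abs_sub_comm]
    have e : ∫ x, φ x ∂(μ T) - ∫ x, φ (Φ T x) ∂(μ 0)
        = (∫ x, φ x ∂(μ T) - ∫ x, ψ x ∂(μ 0)) + (∫ x, ψ x ∂(μ 0) - ∫ x, φ (Φ T x) ∂(μ 0)) := by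
      ring
    have hALU : A' * (L * (U * h)) ≤ δ := by
      refine le_trans ?_ hhQ
      have : 0 ≤ h * (2 * B' * U ^ 2) := by positivity
      simp only [Q]; nlinarith
    rw [e]
    refine (abs_add_le _ _).trans ((add_le_add h1 h3).trans ?_)
    have f1 : (A' * δ + h * Q) * m * T ≤ (A' * δ + δ) * m * T := by gcongr
    have f2 : A' * (L * (U * h) + δ) * T * m ≤ (δ + A' * δ) * T * m := by
      rw [mul_add]; gcongr
    calc _ ≤ _ := add_le_add f1 f2
      _ = _ := by ring
  set c := (A' + 1) * m * T + (A' + 1) * T * m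
  have hlim : Tendsto (fun δ : ℝ => δ * c) (𝓝[>] 0) (𝓝 0) := by
    have : Tendsto (fun δ : ℝ => δ * c) (𝓝 0) (𝓝 (0 * c)) := tendsto_id.mul_const c
    rw [zero_mul] at this
    exact this.mono_left nhdsWithin_le_nhds
  have h0 : |∫ x, φ x ∂(μ T) - ∫ x, φ (Φ T x) ∂(μ 0)| ≤ 0 := by
    refine ge_of_tendsto hlim ?_
    filter_upwards [self_mem_nhdsWithin] with δ hδ
    exact key δ hδ
  linarith [abs_eq_zero.1 (le_antisymm h0 (abs_nonneg _))]

end Transport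

section Transport

variable {E : Type*} [NormedAddCommGroup E] [InnerProductSpace ℝ E] [FiniteDimensional ℝ E]
  [MeasurableSpace E] [BorelSpace E]

/-- Locally finite measures are determined by the integrals of test functions. -/
lemma ext_of_integral_contDiff_eq {μ ν : Measure E} [IsFiniteMeasureOnCompacts μ]
    [IsFiniteMeasureOnCompacts ν]
    (h : ∀ φ : E → ℝ, ContDiff ℝ ∞ φ → HasCompactSupport φ → ∫ x, φ x ∂μ = ∫ x, φ x ∂ν) :
    μ = ν := by
  refine Measure.ext_of_integral_eq_on_compactlySupported fun f => ?_
  have hf : HasCompactSupport f := f.hasCompactSupport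
  have hfc : Continuous f := f.continuous
  obtain ⟨R, hR⟩ := hf.isBounded.subset_closedBall (0 : E)
  have hfz : ∀ x, R < ‖x‖ → f x = 0 := fun x hx => image_eq_zero_of_notMem_tsupport fun h => by
    have := hR h
    rw [mem_closedBall_zero_iff] at this; linarith
  have hfu : UniformContinuous f := hf.uniformContinuous_of_continuous hfc
  set S := Metric.closedBall (0 : E) (R + 1)
  have hSc : IsCompact S := isCompact_closedBall _ _
  -- uniform approximation by test functions supported in a common ball
  have key : ∀ δ > 0, ∃ g : E → ℝ, ContDiff ℝ ∞ g ∧ (∀ x, R + 1 < ‖x‖ → g x = 0) ∧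
      ∀ x, |f x - g x| ≤ δ := by
    intro δ hδ
    obtain ⟨ε, hε, hd⟩ := Metric.uniformContinuous_iff.1 hfu δ hδ
    obtain ⟨g, hg, hgd⟩ := hfc.exists_contDiff_dist_le_of_forall_mem_ball_dist_le
      (ε := min ε 1) (lt_min hε one_pos)
    refine ⟨g, hg, fun x hx => ?_, fun x => ?_⟩
    · have h0 : f x = 0 := hfz x (by linarith)
      have := hgd x 0 (fun y hy => by
        have hy1 : dist y x < 1 := (Metric.mem_ball.1 hy).trans_le (min_le_right _ _)
        have : R < ‖y‖ := by
          have := norm_le_norm_add_norm_sub' x y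
          rw [dist_comm, dist_eq_norm] at hy1; linarith
        rw [hfz y this, h0, dist_self])
      have := dist_le_zero.1 this
      rw [this, h0]
    · have := hgd x δ (fun y hy => (hd ((Metric.mem_ball.1 hy).trans_le (min_le_left _ _))).le)
      rwa [dist_comm, Real.dist_eq] at this
  have hb : ∀ δ > 0, |∫ x, f x ∂μ - ∫ x, f x ∂ν| ≤ δ * (μ.real S + ν.real S) := by
    intro δ hδ
    obtain ⟨g, hg, hgz, hfg⟩ := key δ hδ
    have hgc : HasCompactSupport g :=
      HasCompactSupport.intro hSc fun x hx => hgz x (by simpa [S] using hx)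
    have hz : ∀ x, R + 1 < ‖x‖ → f x - g x = 0 := fun x hx => by
      rw [hgz x hx, hfz x (by linarith), sub_zero]
    have h1 : ∀ (κ : Measure E) [IsFiniteMeasureOnCompacts κ],
        |∫ x, f x ∂κ - ∫ x, g x ∂κ| ≤ δ * κ.real S := by
      intro κ _
      rw [← integral_sub (hfc.integrable_of_hasCompactSupport hf)
        (hg.continuous.integrable_of_hasCompactSupport hgc)]
      exact abs_integral_le_of_eq_zero ENNReal.toReal_nonneg hδ.le
        (by rw [Measure.real, ENNReal.ofReal_toReal hSc.measure_lt_top.ne]) hz fun x _ => hfg x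
    have e : ∫ x, f x ∂μ - ∫ x, f x ∂ν
        = (∫ x, f x ∂μ - ∫ x, g x ∂μ) - (∫ x, f x ∂ν - ∫ x, g x ∂ν) := by
      rw [h g hg hgc]; ring
    rw [e, mul_add]
    exact (abs_sub _ _).trans (add_le_add (h1 μ) (h1 ν))
  have h0 : |∫ x, f x ∂μ - ∫ x, f x ∂ν| ≤ 0 := by
    have hlim : Tendsto (fun δ : ℝ => δ * (μ.real S + ν.real S)) (𝓝[>] 0) (𝓝 0) := by
      have : Tendsto (fun δ : ℝ => δ * (μ.real S + ν.real S)) (𝓝 0)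
        (𝓝 (0 * (μ.real S + ν.real S))) := tendsto_id.mul_const _
      rw [zero_mul] at this
      exact this.mono_left nhdsWithin_le_nhds
    refine ge_of_tendsto hlim ?_
    filter_upwards [self_mem_nhdsWithin] with δ hδ
    exact hb δ hδ
  linarith [abs_eq_zero.1 (le_antisymm h0 (abs_nonneg _))]

variable {T L U : ℝ} {u : ℝ → E → E} {μ : ℝ → Measure E} {Φ : ℝ → E → E}

theorem IsContinuitySolution.eq_map (hu : IsLipschitzField T L U u)
    (hμ : IsContinuitySolution T u μ) (hΦ : IsFlow T u Φ) {t : ℝ} (ht : t ∈ Set.Icc 0 T) :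
    μ t = (μ 0).map (Φ t) := by
  have hut := hu.mono ht.2
  have h0 : (0 : ℝ) ∈ Set.Icc 0 T := ⟨le_rfl, ht.1.trans ht.2⟩
  have hc := hΦ.continuous hu ht
  have := hμ.isFiniteMeasureOnCompacts ht
  have := hμ.isFiniteMeasureOnCompacts h0
  have : IsFiniteMeasureOnCompacts ((μ 0).map (Φ t)) := by
    refine ⟨fun K hK => ?_⟩
    rw [Measure.map_apply hc.measurable hK.measurableSet]
    obtain ⟨R, hR⟩ := hK.isBounded.subset_closedBall (0 : E)
    refine lt_of_le_of_lt (measure_mono (t := Metric.closedBall 0 (R + U * t)) fun x hx => ?_)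
      (isCompact_closedBall _ _).measure_lt_top
    have h1 := hR hx
    have q1 := hΦ.norm_sub_le hu h0 ht x
    rw [hΦ.initial, sub_zero, abs_of_nonneg ht.1] at q1
    have q3 := norm_le_norm_add_norm_sub (Φ t x) x
    rw [mem_closedBall_zero_iff] at h1 ⊢
    linarith
  refine ext_of_integral_contDiff_eq fun φ hφ hφc => ?_
  rw [integral_map hc.measurable.aemeasurable hφ.continuous.aestronglyMeasurable]
  exact (hμ.mono ht.2).integral_eq ht.1 hut (hΦ.mono ht.2) hφ hφc

/-- **Liouville's theorem** for bounded Lipschitz fields: Lebesgue measure solves the continuity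
equation of a weakly divergence-free field, so it is invariant under the flow. -/
theorem IsFlow.measurePreserving (hu : IsLipschitzField T L U u) (hΦ : IsFlow T u Φ)
    (hdiv : ∀ s ∈ Set.Icc 0 T, ∀ φ : E → ℝ, ContDiff ℝ ∞ φ → HasCompactSupport φ →
      ∫ x, fderiv ℝ φ x (u s x) = 0) {t : ℝ} (ht : t ∈ Set.Icc 0 T) :
    MeasurePreserving (Φ t) := by
  have hsol : IsContinuitySolution T u fun _ => (volume : Measure E) := by
    refine ⟨fun R => ⟨(volume : Measure E).real (Metric.closedBall 0 R), ENNReal.toReal_nonneg,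
      fun t _ => ?_⟩, fun φ h1 h2 => ?_, fun φ h1 h2 t ht => ?_⟩
    · rw [Measure.real, ENNReal.ofReal_toReal (isCompact_closedBall _ _).measure_lt_top.ne]
    · exact (integrableOn_zero (ε' := ℝ)).congr_fun (fun s hs => (hdiv s hs φ h1 h2).symm)
        measurableSet_Icc
    · rw [intervalIntegral.integral_congr (g := fun _ => (0 : ℝ))]
      · simp
      · intro s hs
        rw [Set.uIcc_of_le ht.1] at hs
        exact hdiv s (Set.Icc_subset_Icc_right ht.2 hs) φ h1 h2
  exact ⟨(hΦ.continuous hu ht).measurable, (hsol.eq_map hu hΦ ht).symm⟩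

end Transport

section WeakSolution

variable {d : ℕ} {α C C₁ M T : ℝ} {q : ℝ≥0∞}
  {K : EuclideanSpace ℝ (Fin d) → EuclideanSpace ℝ (Fin d)}
  {ρ₀ : Measure (EuclideanSpace ℝ (Fin d))} {ρ : ℝ → Measure (EuclideanSpace ℝ (Fin d))}

lemma one_lt_of_lt {β : ℝ} {q : ℝ≥0∞} (hβ : 1 ≤ β) (hq : ENNReal.ofReal β < q) : 1 < q :=
  lt_of_le_of_lt (by simpa using ENNReal.ofReal_le_ofReal hβ) hq

/-- The velocity field of a weak solution is bounded and Lipschitz. -/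
lemma IsWeakSolution.isLipschitzField {c : ℝ}
    {k : EuclideanSpace ℝ (Fin d) → EuclideanSpace ℝ (Fin d)} (hk : SingularKernel α c k)
    (hρ : IsWeakSolution q K ρ₀ T ρ) (hC₁ : 0 ≤ C₁)
    (hw : ∀ t ∈ Set.Icc 0 T, WeightBound α C₁ (ρ t)) :
    IsLipschitzField T (2 * c * C₁) (c * (1 + C₁)) fun t => meanVelocity k (ρ t) := by
  have hc := hk.const_nonneg
  refine ⟨by positivity, by positivity, fun x => ?_, fun t ht x y => ?_, fun t ht x => ?_⟩
  · exact continuousOn_meanVelocity hk hC₁ hρ.isProbabilityMeasure hw hρ.continuousOn x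
  · have := hρ.isProbabilityMeasure t ht
    exact (hw t ht).norm_meanVelocity_sub_le hC₁ hk x y
  · have := hρ.isProbabilityMeasure t ht
    exact (hw t ht).norm_meanVelocity_le hC₁ hk x

lemma IsWeakSolution.isContinuitySolution {L U : ℝ}
    (hρ : IsWeakSolution q K ρ₀ T ρ)
    (hK : ∀ t ∈ Set.Icc 0 T, meanVelocity (puncture K) (ρ t) = meanVelocity K (ρ t))
    (hu : IsLipschitzField T L U fun t => meanVelocity (puncture K) (ρ t)) :
    IsContinuitySolution T (fun t => meanVelocity (puncture K) (ρ t)) ρ := by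
  have hU := hu.bound_nonneg
  refine ⟨fun R => ⟨1, zero_le_one, fun t ht => ?_⟩, fun φ h1 h2 => ?_, fun φ h1 h2 t ht => ?_⟩
  · have := hρ.isProbabilityMeasure t ht
    simpa using prob_le_one
  · refine ContinuousOn.integrableOn_compact isCompact_Icc ?_
    have hφ' : Continuous (fderiv ℝ φ) := h1.continuous_fderiv (by simp)
    obtain ⟨A, hA⟩ := hφ'.bounded_above_of_compact_support (h2.fderiv ℝ)
    have hA0 : 0 ≤ A := (norm_nonneg _).trans (hA 0)
    obtain ⟨R, hR⟩ := h2.isBounded.subset_closedBall (0 : EuclideanSpace ℝ (Fin d))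
    have hz : ∀ x ∉ Metric.closedBall (0 : EuclideanSpace ℝ (Fin d)) R, fderiv ℝ φ x = 0 := by
      intro x hx
      by_contra h
      exact hx (hR (support_fderiv_subset ℝ (f := φ) h))
    have hcont : ∀ s ∈ Set.Icc 0 T,
        Continuous fun x => fderiv ℝ φ x (meanVelocity (puncture K) (ρ s) x) := fun s hs =>
      hφ'.clm_apply (hu.lipschitzWith hs).continuous
    have hbd : ∀ s ∈ Set.Icc 0 T,
        ∀ x, ‖fderiv ℝ φ x (meanVelocity (puncture K) (ρ s) x)‖ ≤ A * U := fun s hs x =>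
      (ContinuousLinearMap.le_opNorm _ _).trans
        (mul_le_mul (hA x) (hu.norm_le s hs x) (norm_nonneg _) hA0)
    intro s hs
    have hnc := hρ.continuousOn (BoundedContinuousFunction.ofNormedAddCommGroup _ (hcont s hs) _
      (hbd s hs)) s hs
    rw [Metric.continuousWithinAt_iff] at hnc ⊢
    intro ε hε
    obtain ⟨h₁, hh₁, hd₁⟩ := hnc (ε / 2) (half_pos hε)
    obtain ⟨h₀, hh₀, hd₀⟩ := hu.exists_forall_norm_sub_le (δ := ε / (4 * (A + 1)))
      (by positivity) R
    refine ⟨min h₀ h₁, lt_min hh₀ hh₁, fun {σ} hσ hσs => ?_⟩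
    have := hρ.isProbabilityMeasure σ hσ
    have e1 := hd₁ hσ (hσs.trans_le (min_le_right _ _))
    rw [Real.dist_eq] at e1 ⊢
    simp only [BoundedContinuousFunction.coe_ofNormedAddCommGroup] at e1
    have hint : ∀ s ∈ Set.Icc 0 T,
        Integrable (fun x => fderiv ℝ φ x (meanVelocity (puncture K) (ρ s) x)) (ρ σ) :=
      fun s hs => Integrable.of_bound (hcont s hs).aestronglyMeasurable (A * U)
        (ae_of_all _ (hbd s hs))
    have e2 : |∫ x, fderiv ℝ φ x (meanVelocity (puncture K) (ρ σ) x) ∂(ρ σ)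
        - ∫ x, fderiv ℝ φ x (meanVelocity (puncture K) (ρ s) x) ∂(ρ σ)| ≤ ε / 4 := by
      rw [← integral_sub (hint σ hσ) (hint s hs), ← Real.norm_eq_abs]
      have hAε : A * (ε / (4 * (A + 1))) ≤ ε / 4 := by
        rw [mul_div_assoc', div_le_div_iff₀ (by positivity) (by positivity)]
        nlinarith
      refine (norm_integral_le_of_norm_le_const (C := ε / 4) (ae_of_all _ fun x => ?_)).trans
        (by simp)
      rw [← map_sub]
      by_cases hx : x ∈ Metric.closedBall (0 : EuclideanSpace ℝ (Fin d)) R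
      · refine (ContinuousLinearMap.le_opNorm _ _).trans (le_trans ?_ hAε)
        exact mul_le_mul (hA x) (hd₀ s hs σ hσ
          (by rw [← Real.dist_eq]; exact hσs.trans_le (min_le_left _ _)) x hx) (norm_nonneg _) hA0
      · rw [hz x hx]
        simp only [zero_apply, norm_zero]; positivity
    have e3 := abs_sub_le (∫ x, fderiv ℝ φ x (meanVelocity (puncture K) (ρ σ) x) ∂(ρ σ))
      (∫ x, fderiv ℝ φ x (meanVelocity (puncture K) (ρ s) x) ∂(ρ σ))
      (∫ x, fderiv ℝ φ x (meanVelocity (puncture K) (ρ s) x) ∂(ρ s))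
    linarith
  · rw [hρ.weak_eq φ h1 h2 t ht, hρ.initial]
    congr 1
    refine intervalIntegral.integral_congr fun s hs => ?_
    rw [Set.uIcc_of_le ht.1] at hs
    simp only [hK s (Set.Icc_subset_Icc_right ht.2 hs)]

/-- **Structure of weak solutions.** A weak solution is transported by the flow of its velocity, and
since that flow preserves volume the density bound of the initial datum is propagated. -/
theorem IsWeakSolution.exists_flow (hα : 0 ≤ α) (hd : α + 1 < d) (hq : 1 < q)
    (hr : dualExponent q * (α + 1) < d) (hK : IsKernel α C K) (hT : 0 ≤ T)
    (hM : HasDensityBound q M ρ₀) (hρ : IsWeakSolution q K ρ₀ T ρ) :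
    ∃ (L U : ℝ) (Φ : ℝ → EuclideanSpace ℝ (Fin d) → EuclideanSpace ℝ (Fin d)),
      IsLipschitzField T L U (fun t => meanVelocity (puncture K) (ρ t)) ∧
      IsFlow T (fun t => meanVelocity (puncture K) (ρ t)) Φ ∧
      ∀ t ∈ Set.Icc 0 T, ρ t = ρ₀.map (Φ t) ∧ DensityBound (dualExponent q) M (ρ t) := by
  have hd0 : 0 < d := by
    have : (0 : ℝ) < d := by linarith
    exact_mod_cast this
  have : Nonempty (Fin d) := ⟨⟨0, hd0⟩⟩
  have hk := hK.singularKernel hα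
  obtain ⟨M', hM'⟩ := hρ.densityBound
  obtain ⟨C₁, hC₁, hw⟩ := exists_lintegral_weight_le (E := EuclideanSpace ℝ (Fin d)) M' hα
    (one_le_dualExponent hq) (by simpa using hr)
  have hw' : ∀ t ∈ Set.Icc 0 T, WeightBound α C₁ (ρ t) := fun t ht =>
    hw (ρ t) (hρ.isProbabilityMeasure t ht) ((hM' t ht).densityBound hq)
  have hac : ∀ t ∈ Set.Icc 0 T, meanVelocity (puncture K) (ρ t) = meanVelocity K (ρ t) :=
    fun t ht => meanVelocity_puncture hd0 (((hM' t ht).densityBound hq).absolutelyContinuous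
      (by linarith [one_le_dualExponent hq]))
  have hu := hρ.isLipschitzField hk hC₁ hw'
  obtain ⟨Φ, hΦ⟩ := hu.exists_isFlow hT
  refine ⟨_, _, Φ, hu, hΦ, fun t ht => ?_⟩
  have hmp := hΦ.measurePreserving hu (fun s hs φ h1 h2 => by
    have := hρ.isProbabilityMeasure s hs
    exact hK.integral_fderiv_meanVelocity_eq_zero hα hd hC₁ (hw' s hs) h1 h2) ht
  have hmap := (hρ.isContinuitySolution hac hu).eq_map hu hΦ ht
  rw [hρ.initial] at hmap
  refine ⟨hmap, ?_⟩
  rw [hmap]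
  exact (hM.densityBound hq).map hmp

end WeakSolution

/-! ### Kernel sums over separated points -/

section Packing

variable {E : Type*} [NormedAddCommGroup E] [InnerProductSpace ℝ E] [FiniteDimensional ℝ E]
  [MeasurableSpace E] [BorelSpace E]

local notation "dim" => Module.finrank ℝ E

/-- The weight summed over `n` points with mutual distance and distance from the pole at least `δ`:
compare the sum with the integral over the disjoint balls of radius `δ / 2` and use the bathtub
principle. -/
theorem exists_sum_weight_le [Nontrivial E] {α : ℝ} (hα : 0 ≤ α) (hdim : α + 1 < dim) :
    ∃ C : ℝ, 0 ≤ C ∧ ∀ {ι : Type} (J : Finset ι) (P : ι → E) (x : E) (δ : ℝ), 0 < δ →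
      (∀ j ∈ J, δ ≤ ‖x - P j‖) → (∀ i ∈ J, ∀ j ∈ J, i ≠ j → δ ≤ ‖P i - P j‖) →
      ∑ j ∈ J, weight α (x - P j)
        ≤ C * (J.card : ℝ) ^ (1 - (α + 1) / dim) * δ ^ (-(α + 1)) := by
  obtain ⟨Ct, hCt, hbath⟩ := exists_setLIntegral_weight_le (E := E) hα hdim
  have hdpos : (0 : ℝ) < dim := by linarith
  set β := (α + 1) / dim
  have hβ : β < 1 := (div_lt_one hdpos).2 hdim
  set v₁ := (volume : Measure E).real (Metric.ball 0 1)
  have hv₁ : 0 < v₁ := ENNReal.toReal_pos (Metric.measure_ball_pos _ _ one_pos).ne'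
    measure_ball_lt_top.ne
  set D : ℝ := (3 / 2 : ℝ) ^ (α + 1)
  have hD : 0 ≤ D := by positivity
  refine ⟨D * Ct * v₁ ^ (-β) * 2 ^ (α + 1), by positivity, fun {ι} J P x δ hδ hx hP => ?_⟩
  classical
  rcases J.eq_empty_or_nonempty with rfl | hJ
  · simp only [Finset.sum_empty, Finset.card_empty, Nat.cast_zero]
    positivity
  have hn : (0 : ℝ) < J.card := by exact_mod_cast hJ.card_pos
  set n : ℝ := (J.card : ℝ)
  set b : ℝ := (δ / 2) ^ dim * v₁
  have hb : 0 < b := by positivity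
  have hball : ∀ y : E, volume (Metric.ball y (δ / 2)) = ENNReal.ofReal b := by
    intro y
    rw [Measure.addHaar_ball_of_pos _ _ (half_pos hδ), ENNReal.ofReal_mul (by positivity),
      show ENNReal.ofReal v₁ = _ from ENNReal.ofReal_toReal measure_ball_lt_top.ne]
  have hdisj : Set.PairwiseDisjoint (J : Set ι) fun j => Metric.ball (P j) (δ / 2) := by
    intro i hi j hj hij
    refine Metric.ball_disjoint_ball ?_
    rw [dist_eq_norm]; linarith [hP i hi j hj hij]
  set A := ⋃ j ∈ J, Metric.ball (P j) (δ / 2)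
  have hA : volume A ≤ ENNReal.ofReal (n * b) := by
    refine (measure_biUnion_finset_le J _).trans (le_of_eq ?_)
    simp only [hball]
    rw [Finset.sum_const, nsmul_eq_mul, ENNReal.ofReal_mul hn.le, ENNReal.ofReal_natCast]
  have hw : Measurable fun y : E => ENNReal.ofReal (weight α (x - y)) :=
    (measurable_weight.comp (measurable_const.sub measurable_id)).ennreal_ofReal
  have hj : ∀ j ∈ J, ENNReal.ofReal (weight α (x - P j)) * ENNReal.ofReal b
      ≤ ENNReal.ofReal D *
        ∫⁻ y in Metric.ball (P j) (δ / 2), ENNReal.ofReal (weight α (x - y)) := by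
    intro j hjJ
    rw [← hball (P j), ← setLIntegral_const, ← lintegral_const_mul _ hw]
    refine setLIntegral_mono (hw.const_mul _) fun y hy => ?_
    rw [← ENNReal.ofReal_mul hD]
    refine ENNReal.ofReal_le_ofReal ?_
    have h1 := hx j hjJ
    have h2 : ‖P j - y‖ < δ / 2 := by rwa [Metric.mem_ball, dist_comm, dist_eq_norm] at hy
    have h3 : ‖x - y‖ ≤ ‖x - P j‖ + ‖P j - y‖ := norm_sub_le_norm_sub_add_norm_sub _ _ _
    have h4 : ‖x - P j‖ ≤ ‖x - y‖ + ‖y - P j‖ := norm_sub_le_norm_sub_add_norm_sub _ _ _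
    rw [norm_sub_rev y] at h4
    refine weight_le_of_norm_le hα ?_ ?_ (by linarith)
    · rw [← norm_pos_iff]; linarith
    · rw [← norm_pos_iff]; linarith
  have hsum : ENNReal.ofReal ((∑ j ∈ J, weight α (x - P j)) * b)
      ≤ ENNReal.ofReal (D * (Ct * (n * b) ^ (1 - β))) := by
    rw [ENNReal.ofReal_mul (Finset.sum_nonneg fun j _ => weight_nonneg _),
      ENNReal.ofReal_sum_of_nonneg fun j _ => weight_nonneg _, Finset.sum_mul]
    refine (Finset.sum_le_sum hj).trans ?_
    rw [← Finset.mul_sum, ← lintegral_biUnion_finset hdisj fun j _ => measurableSet_ball,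
      ENNReal.ofReal_mul hD]
    exact mul_le_mul_right (hbath A (n * b) (by positivity) hA x) _
  rw [ENNReal.ofReal_le_ofReal_iff (by positivity), ← le_div_iff₀ hb] at hsum
  refine hsum.trans (le_of_eq ?_)
  have e1 : b ^ (1 - β) = b * b ^ (-β) := by
    rw [sub_eq_add_neg, Real.rpow_add hb, Real.rpow_one]
  have e2 : b ^ (-β) = δ ^ (-(α + 1)) * 2 ^ (α + 1) * v₁ ^ (-β) := by
    rw [Real.mul_rpow (by positivity) hv₁.le, ← Real.rpow_natCast, ← Real.rpow_mul (by positivity),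
      show (dim : ℝ) * -β = -(α + 1) by simp only [β]; field_simp,
      Real.div_rpow hδ.le (by norm_num), Real.rpow_neg (by norm_num : (0 : ℝ) ≤ 2), div_inv_eq_mul]
  rw [Real.mul_rpow hn.le hb.le, e1, e2]
  field_simp

end Packing

/-! ### Kernel sums controlled by a coupling -/

section KernelSum

/-- The uniform probability measure on the labels of `N` particles. -/
noncomputable def uniformLabel (N : ℕ) : Measure (Fin N) :=
  (N : ℝ≥0∞)⁻¹ • ∑ i, Measure.dirac i

lemma lintegral_uniformLabel {N : ℕ} (f : Fin N → ℝ≥0∞) :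
    ∫⁻ i, f i ∂(uniformLabel N) = (N : ℝ≥0∞)⁻¹ * ∑ i, f i := by
  rw [uniformLabel, lintegral_smul_measure, lintegral_finsetSum_measure, smul_eq_mul]
  simp

lemma ofReal_average {N : ℕ} (hN : 0 < N) {f : Fin N → ℝ} (hf : ∀ i, 0 ≤ f i) (s : Finset (Fin N)) :
    ENNReal.ofReal ((N : ℝ)⁻¹ * ∑ i ∈ s, f i) = (N : ℝ≥0∞)⁻¹ * ∑ i ∈ s, ENNReal.ofReal (f i) := by
  have : (0 : ℝ) < N := by exact_mod_cast hN
  rw [ENNReal.ofReal_mul (by positivity), ENNReal.ofReal_sum_of_nonneg fun i _ => hf i,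
    ENNReal.ofReal_inv_of_pos this, ENNReal.ofReal_natCast]

/-- Couplings of the uniform measure on labels with `μ`: the `i`-th slice is the part of `μ` that is
transported to the `i`-th particle. -/
structure IsLabelCoupling {E : Type*} [MeasurableSpace E] {N : ℕ} (Γ : Measure (Fin N × E))
    (μ : Measure E) : Prop where
  map_fst : Γ.map Prod.fst = uniformLabel N
  map_snd : Γ.map Prod.snd = μ

variable {E : Type*} [MeasurableSpace E] {N : ℕ} {Γ : Measure (Fin N × E)} {μ : Measure E}

namespace IsLabelCoupling

lemma lintegral_fst (h : IsLabelCoupling Γ μ) (f : Fin N → ℝ≥0∞) :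
    ∫⁻ z, f z.1 ∂Γ = (N : ℝ≥0∞)⁻¹ * ∑ i, f i := by
  rw [← lintegral_uniformLabel, ← h.map_fst, lintegral_map (measurable_of_finite f) measurable_fst]

lemma lintegral_snd (h : IsLabelCoupling Γ μ) {f : E → ℝ≥0∞} (hf : Measurable f) :
    ∫⁻ z, f z.2 ∂Γ = ∫⁻ y, f y ∂μ := by
  rw [← h.map_snd, lintegral_map hf measurable_snd]

lemma isProbabilityMeasure [IsProbabilityMeasure μ] (h : IsLabelCoupling Γ μ) :
    IsProbabilityMeasure Γ := by
  have : IsProbabilityMeasure (Γ.map Prod.snd) := by rw [h.map_snd]; infer_instance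
  exact ⟨by
    have h1 := this.measure_univ
    rwa [Measure.map_apply measurable_snd MeasurableSet.univ, Set.preimage_univ] at h1⟩

lemma map {F : E → E} (hF : Measurable F) (h : IsLabelCoupling Γ μ) :
    IsLabelCoupling (Γ.map fun z => (z.1, F z.2)) (μ.map F) := by
  have hm : Measurable fun z : Fin N × E => (z.1, F z.2) :=
    measurable_fst.prodMk (hF.comp measurable_snd)
  constructor
  · rw [Measure.map_map measurable_fst hm, ← h.map_fst]; rfl
  · rw [Measure.map_map measurable_snd hm, ← h.map_snd, Measure.map_map hF measurable_snd]; rfl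

end IsLabelCoupling

end KernelSum

section KernelSum

variable {E : Type*} [NormedAddCommGroup E] [InnerProductSpace ℝ E] [FiniteDimensional ℝ E]
  [MeasurableSpace E] [BorelSpace E]

local notation "dim" => Module.finrank ℝ E

/-- **Kernel sums.** Let `Γ` couple `N` points of separation `δ` to a measure `μ` with bounded
density, and let `R` be a scale at which only mass `R ^ (dim / r)` is displaced by more than `R / 2`.
Pairs at distance more than `R` are compared with `μ` (or have small total mass), and the number of
particles within distance `R` is at most of order `N R ^ (dim / r)`, so that packing applies. -/
theorem exists_average_weight_le [Nontrivial E] {α r C₁ Cb : ℝ} (hα : 0 ≤ α) (hC₁ : 0 ≤ C₁)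
    (hCb : 0 ≤ Cb) (hdim : α + 1 < dim) :
    ∃ C : ℝ, 0 ≤ C ∧ ∀ {N : ℕ} (Γ : Measure (Fin N × E)) (μ : Measure E) (X : Fin N → E) (R δ : ℝ),
      0 < N → IsLabelCoupling Γ μ → μ ≪ volume → WeightBound α C₁ μ →
      (∀ x, ∀ s > 0, μ (Metric.ball x s) ≤ ENNReal.ofReal (Cb * s ^ ((dim : ℝ) / r))) →
      0 < R → 0 < δ → (∀ i j, i ≠ j → δ ≤ ‖X i - X j‖) →
      Γ {z | R / 2 < ‖X z.1 - z.2‖} ≤ ENNReal.ofReal (R ^ ((dim : ℝ) / r)) →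
      ∀ i, (N : ℝ)⁻¹ * ∑ j, weight α (X i - X j) ≤
        (3 / 2 : ℝ) ^ (α + 1) * C₁ + R ^ ((dim : ℝ) / r - (α + 1)) +
          C * (R ^ ((dim : ℝ) / r)) ^ (1 - (α + 1) / dim) *
            ((N : ℝ) ^ (1 / (dim : ℝ)) * δ) ^ (-(α + 1)) := by
  obtain ⟨Cp, hCp, hpack⟩ := exists_sum_weight_le (E := E) hα hdim
  have hdpos : (0 : ℝ) < dim := by linarith
  set β := (α + 1) / dim
  have hβ : 0 ≤ 1 - β := sub_nonneg.2 ((div_lt_one hdpos).2 hdim).le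
  set τ := (dim : ℝ) / r
  set D : ℝ := (3 / 2 : ℝ) ^ (α + 1)
  have hD : 0 ≤ D := by positivity
  set B : ℝ := Cb * 2 ^ τ + 1
  have hB : 0 ≤ B := by positivity
  refine ⟨Cp * B ^ (1 - β), by positivity, ?_⟩
  intro N Γ μ X R δ hN hΓ hac hw hball hR hδ hsep hbad i
  classical
  have hN' : (0 : ℝ) < N := by exact_mod_cast hN
  have hNe : (N : ℝ≥0∞) ≠ 0 := by exact_mod_cast hN.ne'
  set bad : Set (Fin N × E) := {z | R / 2 < ‖X z.1 - z.2‖}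
  have hXm : Measurable fun z : Fin N × E => X z.1 := (measurable_of_finite X).comp measurable_fst
  have hbadm : MeasurableSet bad :=
    measurableSet_lt measurable_const (hXm.sub measurable_snd).norm
  set J : Finset (Fin N) := Finset.univ.filter fun j => j ≠ i ∧ ‖X i - X j‖ ≤ R
  -- the number of particles close to `X i`
  have hcard : (J.card : ℝ) / N ≤ B * R ^ τ := by
    have h1 : ENNReal.ofReal ((N : ℝ)⁻¹ * ∑ j ∈ J, (1 : ℝ)) ≤ ENNReal.ofReal (B * R ^ τ) := by
      rw [ofReal_average hN fun _ => zero_le_one]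
      have h2 : (N : ℝ≥0∞)⁻¹ * ∑ j ∈ J, ENNReal.ofReal 1 = Γ {z | z.1 ∈ J} := by
        have := hΓ.lintegral_fst fun j => if j ∈ J then 1 else 0
        rw [Finset.sum_ite_mem, Finset.univ_inter] at this
        rw [ENNReal.ofReal_one, ← this, ← lintegral_indicator_one]
        · refine lintegral_congr fun z => ?_
          by_cases hz : z.1 ∈ J <;> simp [hz]
        · exact measurable_fst (Set.toFinite {j | j ∈ J}).measurableSet
      rw [h2]
      have hsub : {z : Fin N × E | z.1 ∈ J} ⊆ Prod.snd ⁻¹' Metric.ball (X i) (2 * R) ∪ bad := by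
        intro z hz
        by_cases hzb : z ∈ bad
        · exact Or.inr hzb
        · left
          have h3 : ‖X i - X z.1‖ ≤ R := by
            have : z.1 ∈ J := hz
            exact (Finset.mem_filter.1 this).2.2
          have h4 : ‖X z.1 - z.2‖ ≤ R / 2 := not_lt.1 hzb
          have h5 := norm_sub_le_norm_sub_add_norm_sub (X i) (X z.1) z.2
          rw [Set.mem_preimage, Metric.mem_ball, dist_comm, dist_eq_norm]
          linarith
      refine (measure_mono hsub).trans ((measure_union_le _ _).trans ?_)
      have h6 : Γ (Prod.snd ⁻¹' Metric.ball (X i) (2 * R)) = μ (Metric.ball (X i) (2 * R)) := by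
        rw [← hΓ.map_snd, Measure.map_apply measurable_snd measurableSet_ball]
      rw [h6]
      refine (add_le_add (hball (X i) (2 * R) (by positivity)) hbad).trans (le_of_eq ?_)
      rw [← ENNReal.ofReal_add (by positivity) (by positivity),
        Real.mul_rpow (by norm_num) hR.le]
      congr 1; simp only [B]; ring
    rw [ENNReal.ofReal_le_ofReal_iff (by positivity)] at h1
    rw [div_eq_inv_mul]
    simpa using h1
  -- the contribution of the particles close to `X i`
  have hnear : (N : ℝ)⁻¹ * ∑ j ∈ J, weight α (X i - X j) ≤
      Cp * B ^ (1 - β) * (R ^ τ) ^ (1 - β) * ((N : ℝ) ^ (1 / (dim : ℝ)) * δ) ^ (-(α + 1)) := by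
    have h1 := hpack J X (X i) δ hδ (fun j hj => hsep i j (Finset.mem_filter.1 hj).2.1.symm)
      (fun a _ b _ hab => hsep a b hab)
    have h2 : ((J.card : ℝ) / N) ^ (1 - β) ≤ B ^ (1 - β) * (R ^ τ) ^ (1 - β) := by
      rw [← Real.mul_rpow hB (by positivity)]
      exact Real.rpow_le_rpow (by positivity) hcard hβ
    have h3 : (N : ℝ)⁻¹ * (J.card : ℝ) ^ (1 - β) * δ ^ (-(α + 1))
        = ((J.card : ℝ) / N) ^ (1 - β) * ((N : ℝ) ^ (1 / (dim : ℝ)) * δ) ^ (-(α + 1)) := by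
      rw [Real.div_rpow (by positivity) hN'.le, Real.mul_rpow (by positivity) hδ.le,
        ← Real.rpow_mul hN'.le, show 1 / (dim : ℝ) * -(α + 1) = -β by simp only [β]; ring,
        Real.rpow_sub hN', Real.rpow_one, Real.rpow_neg hN'.le]
      have : (N : ℝ) ^ β ≠ 0 := by positivity
      field_simp
    calc (N : ℝ)⁻¹ * ∑ j ∈ J, weight α (X i - X j)
        ≤ (N : ℝ)⁻¹ * (Cp * (J.card : ℝ) ^ (1 - β) * δ ^ (-(α + 1))) := by gcongr
      _ = Cp * (((N : ℝ)⁻¹ * (J.card : ℝ) ^ (1 - β)) * δ ^ (-(α + 1))) := by ring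
      _ = Cp * (((J.card : ℝ) / N) ^ (1 - β) * ((N : ℝ) ^ (1 / (dim : ℝ)) * δ) ^ (-(α + 1))) := by
          rw [h3]
      _ ≤ Cp * ((B ^ (1 - β) * (R ^ τ) ^ (1 - β))
            * ((N : ℝ) ^ (1 / (dim : ℝ)) * δ) ^ (-(α + 1))) := by gcongr
      _ = _ := by ring
  -- the pointwise splitting, away from the null set where `z.2 = X i`
  have hne : ∀ᵐ z ∂Γ, z.2 ≠ X i := by
    have h1 : ∀ᵐ y ∂μ, y ≠ X i := hac.ae_le (Measure.ae_ne volume (X i))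
    rw [← hΓ.map_snd] at h1
    exact ae_of_ae_map measurable_snd.aemeasurable h1
  have hwm : Measurable fun y : E => ENNReal.ofReal (weight α (X i - y)) :=
    (measurable_weight.comp (measurable_const.sub measurable_id)).ennreal_ofReal
  have hpt : ∀ᵐ z ∂Γ, ENNReal.ofReal (weight α (X i - X z.1)) ≤
      (ENNReal.ofReal D * ENNReal.ofReal (weight α (X i - z.2))
        + bad.indicator (fun _ => ENNReal.ofReal (R ^ (-α - 1))) z)
        + (if z.1 ∈ J then ENNReal.ofReal (weight α (X i - X z.1)) else 0) := by
    filter_upwards [hne] with z hz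
    by_cases hzi : z.1 = i
    · rw [hzi, sub_self, weight_zero hα, ENNReal.ofReal_zero]; exact bot_le
    by_cases hzR : ‖X i - X z.1‖ ≤ R
    · have : z.1 ∈ J := Finset.mem_filter.2 ⟨Finset.mem_univ _, hzi, hzR⟩
      rw [if_pos this]; exact le_add_self
    rw [not_le] at hzR
    refine le_trans ?_ le_self_add
    by_cases hzb : z ∈ bad
    · rw [Set.indicator_of_mem hzb]
      exact (ENNReal.ofReal_le_ofReal (weight_le_of_le_norm hα hR hzR.le)).trans le_add_self
    · refine le_trans ?_ le_self_add
      rw [← ENNReal.ofReal_mul hD]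
      refine ENNReal.ofReal_le_ofReal ?_
      have h4 : ‖X z.1 - z.2‖ ≤ R / 2 := not_lt.1 hzb
      have h5 := norm_sub_le_norm_sub_add_norm_sub (X i) (X z.1) z.2
      refine weight_le_of_norm_le hα ?_ (sub_ne_zero.2 hz.symm) (by linarith)
      rw [← norm_pos_iff]; linarith
  have hwm' : Measurable fun z : Fin N × E => ENNReal.ofReal (weight α (X i - z.2)) :=
    hwm.comp measurable_snd
  have hJm : Measurable fun z : Fin N × E =>
      if z.1 ∈ J then ENNReal.ofReal (weight α (X i - X z.1)) else 0 :=
    (measurable_of_finite fun j : Fin N =>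
      if j ∈ J then ENNReal.ofReal (weight α (X i - X j)) else 0).comp measurable_fst
  have hmain : ENNReal.ofReal ((N : ℝ)⁻¹ * ∑ j, weight α (X i - X j)) ≤
      ENNReal.ofReal (D * C₁ + R ^ (τ - (α + 1)) +
        (N : ℝ)⁻¹ * ∑ j ∈ J, weight α (X i - X j)) := by
    rw [ofReal_average hN fun _ => weight_nonneg _, ← hΓ.lintegral_fst]
    refine (lintegral_mono_ae hpt).trans ?_
    rw [lintegral_add_right _ hJm,
      lintegral_add_right _ (measurable_const.indicator hbadm), lintegral_const_mul _ hwm', hΓ.lintegral_snd hwm, lintegral_indicator_const hbadm,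
      hΓ.lintegral_fst fun j => if j ∈ J then ENNReal.ofReal (weight α (X i - X j)) else 0,
      Finset.sum_ite_mem, Finset.univ_inter, ← ofReal_average hN fun _ => weight_nonneg _,
      ENNReal.ofReal_add (by positivity) (mul_nonneg (by positivity)
        (Finset.sum_nonneg fun _ _ => weight_nonneg _)),
      ENNReal.ofReal_add (by positivity) (by positivity), ENNReal.ofReal_mul hD]
    refine add_le_add (add_le_add (mul_le_mul_right (hw (X i)) _) ?_) le_rfl
    refine (mul_le_mul_right hbad _).trans (le_of_eq ?_)
    rw [← ENNReal.ofReal_mul (by positivity), ← Real.rpow_add hR]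
    congr 2; ring
  rw [ENNReal.ofReal_le_ofReal_iff (add_nonneg (by positivity) (mul_nonneg (by positivity)
    (Finset.sum_nonneg fun _ _ => weight_nonneg _)))] at hmain
  exact hmain.trans (add_le_add_right hnear _)

end KernelSum

/-! ### Tools for `L^p` norms -/

section LpTools

variable {Z : Type*} [MeasurableSpace Z] {Γ : Measure Z}

/-- **Schur test**: an integral operator whose kernel has row and column integrals at most `κ` has
norm at most `κ` on `L^p`. -/
theorem eLpNorm_lintegral_mul_le [SFinite Γ] {w : Z → Z → ℝ≥0∞}
    (hw : Measurable (Function.uncurry w)) {κ : ℝ≥0∞} (hrow : ∀ z, ∫⁻ z', w z z' ∂Γ ≤ κ)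
    (hcol : ∀ z', ∫⁻ z, w z z' ∂Γ ≤ κ) {a : Z → ℝ≥0∞} (ha : Measurable a) {p : ℝ≥0∞}
    (hp : 1 ≤ p) (hp' : p ≠ ⊤) :
    eLpNorm (fun z => ∫⁻ z', w z z' * a z' ∂Γ) p Γ ≤ κ * eLpNorm a p Γ := by
  have hp0 : p ≠ 0 := (zero_lt_one.trans_le hp).ne'
  set P := p.toReal
  have hP : 1 ≤ P := by simpa using ENNReal.toReal_mono hp' hp
  have hP0 : 0 < P := by linarith
  have hrowm : ∀ z, Measurable (w z) := fun z => hw.of_uncurry_left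
  have hjensen : ∀ z, (∫⁻ z', w z z' * a z' ∂Γ) ^ P
      ≤ κ ^ (P - 1) * ∫⁻ z', w z z' * a z' ^ P ∂Γ := by
    intro z
    have h1 := eLpNorm_le_eLpNorm_mul_rpow_measure_univ (μ := Γ.withDensity (w z)) hp
      ha.aestronglyMeasurable
    rw [eLpNorm_one_eq_lintegral_enorm, eLpNorm_eq_lintegral_rpow_enorm_toReal hp0 hp'] at h1
    simp only [enorm_eq_self] at h1
    rw [lintegral_withDensity_eq_lintegral_mul _ (hrowm z) ha,
      lintegral_withDensity_eq_lintegral_mul _ (hrowm z) (ha.pow_const _),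
      withDensity_apply _ MeasurableSet.univ, setLIntegral_univ, ENNReal.toReal_one] at h1
    have h2 := ENNReal.rpow_le_rpow h1 hP0.le
    rw [ENNReal.mul_rpow_of_nonneg _ _ hP0.le, ← ENNReal.rpow_mul, ← ENNReal.rpow_mul,
      one_div_mul_cancel hP0.ne', ENNReal.rpow_one,
      show (1 / 1 - 1 / P) * P = P - 1 by field_simp] at h2
    refine h2.trans (le_of_eq_of_le (mul_comm _ _) ?_)
    exact mul_le_mul' (ENNReal.rpow_le_rpow (hrow z) (by linarith)) le_rfl
  rw [eLpNorm_eq_lintegral_rpow_enorm_toReal hp0 hp',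
    eLpNorm_eq_lintegral_rpow_enorm_toReal hp0 hp']
  simp only [enorm_eq_self]
  have h3 : ∫⁻ z, (∫⁻ z', w z z' * a z' ∂Γ) ^ P ∂Γ ≤ κ ^ P * ∫⁻ z, a z ^ P ∂Γ := by
    have hm : Measurable (Function.uncurry fun z z' => w z z' * a z' ^ P) :=
      hw.mul ((ha.pow_const P).comp measurable_snd)
    calc ∫⁻ z, (∫⁻ z', w z z' * a z' ∂Γ) ^ P ∂Γ
        ≤ ∫⁻ z, κ ^ (P - 1) * ∫⁻ z', w z z' * a z' ^ P ∂Γ ∂Γ := lintegral_mono hjensen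
      _ = κ ^ (P - 1) * ∫⁻ z', ∫⁻ z, w z z' * a z' ^ P ∂Γ ∂Γ := by
          rw [lintegral_const_mul _ hm.lintegral_prod_right, lintegral_lintegral_swap
            hm.aemeasurable]
      _ ≤ κ ^ (P - 1) * ∫⁻ z', κ * a z' ^ P ∂Γ := by
          gcongr with z'
          rw [lintegral_mul_const _ hw.of_uncurry_right]
          gcongr
          exact hcol z'
      _ = κ ^ P * ∫⁻ z, a z ^ P ∂Γ := by
          rw [lintegral_const_mul _ (ha.pow_const _), ← mul_assoc]
          congr 1
          nth_rewrite 2 [← ENNReal.rpow_one κ]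
          rw [← ENNReal.rpow_add_of_nonneg _ _ (by linarith) zero_le_one, sub_add_cancel]
  refine (ENNReal.rpow_le_rpow h3 (by positivity)).trans (le_of_eq ?_)
  rw [ENNReal.mul_rpow_of_nonneg _ _ (by positivity), ← ENNReal.rpow_mul,
    mul_one_div_cancel hP0.ne', ENNReal.rpow_one]

/-- Uniform bounds for all finite exponents pass to the essential supremum. -/
theorem eLpNorm_top_le_of_forall [IsFiniteMeasure Γ] {F : Type*} [NormedAddCommGroup F] {f : Z → F}
    (hf : AEStronglyMeasurable f Γ) {b : ℝ}
    (h : ∀ p : ℝ≥0∞, 1 ≤ p → p ≠ ⊤ → eLpNorm f p Γ ≤ ENNReal.ofReal b) :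
    eLpNorm f ⊤ Γ ≤ ENNReal.ofReal b := by
  rw [eLpNorm_exponent_top]
  refine le_of_forall_gt_imp_ge_of_dense fun a ha => ?_
  rcases eq_or_ne a ⊤ with rfl | ha'
  · exact le_top
  have ha0 : a ≠ 0 := (bot_le.trans_lt ha).ne'
  have hnull : Γ {z | a ≤ ‖f z‖ₑ} = 0 := by
    refine le_antisymm (ge_of_tendsto' (x := atTop) (f := fun n : ℕ =>
      (a⁻¹ * ENNReal.ofReal b) ^ (n + 1)) ?_ fun n => ?_) bot_le
    · have hlt : a⁻¹ * ENNReal.ofReal b < 1 := by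
        rw [mul_comm, ← div_eq_mul_inv]
        exact (ENNReal.div_lt_iff (Or.inl ha0) (Or.inl ha')).2 (by rwa [one_mul])
      exact (ENNReal.tendsto_pow_atTop_nhds_zero_of_lt_one hlt).comp (tendsto_add_atTop_nat 1)
    · have hn : (1 : ℝ≥0∞) ≤ ((n + 1 : ℕ) : ℝ≥0∞) := by exact_mod_cast Nat.le_add_left 1 n
      have h1 := meas_ge_le_mul_pow_eLpNorm_enorm Γ (p := ((n + 1 : ℕ) : ℝ≥0∞))
        (zero_lt_one.trans_le hn).ne' (ENNReal.natCast_ne_top _) hf ha0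
        (fun h => absurd h ha')
      refine h1.trans ?_
      rw [ENNReal.toReal_natCast, ENNReal.rpow_natCast, ENNReal.rpow_natCast, ← mul_pow]
      gcongr
      exact h _ hn (ENNReal.natCast_ne_top _)
  refine eLpNormEssSup_le_of_ae_enorm_bound ?_
  rw [ae_iff]
  exact measure_mono_null (fun z hz => (not_le.1 hz).le) hnull

/-- **Gronwall inequality in `L^p`** for a curve of functions that is differentiable at each point
of the underlying space, with bounded derivative. The norm of the difference quotients converges to
the norm of the derivative, by dominated convergence; this uses `p < ∞`. -/
theorem eLpNorm_le_gronwallBound [IsFiniteMeasure Γ] {F : Type*} [NormedAddCommGroup F]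
    [NormedSpace ℝ F] [MeasurableSpace F] [BorelSpace F] [SecondCountableTopology F]
    {H G : ℝ → Z → F} {T B δ L b : ℝ} {p : ℝ≥0∞} (hp : 1 ≤ p) (hp' : p ≠ ⊤)
    (hB : 0 ≤ B) (hδ : 0 ≤ δ) (hL : 0 ≤ L) (hb : 0 ≤ b)
    (hH : ∀ t ∈ Set.Icc 0 T, Measurable (H t))
    (hder : ∀ t ∈ Set.Icc 0 T, ∀ z, HasDerivWithinAt (fun s => H s z) (G t z) (Set.Icc 0 T) t)
    (hG : ∀ t ∈ Set.Icc 0 T, ∀ z, ‖G t z‖ ≤ B)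
    (h0 : eLpNorm (H 0) p Γ ≤ ENNReal.ofReal δ)
    (hGH : ∀ t ∈ Set.Icc 0 T,
      eLpNorm (G t) p Γ ≤ ENNReal.ofReal L * eLpNorm (H t) p Γ + ENNReal.ofReal b) :
    ∀ t ∈ Set.Icc 0 T, eLpNorm (H t) p Γ ≤ ENNReal.ofReal (gronwallBound δ L b t) := by
  have hp0 : p ≠ 0 := (zero_lt_one.trans_le hp).ne'
  intro t₁ ht₁
  have hT : (0 : ℝ) ≤ T := ht₁.1.trans ht₁.2
  have h0T : (0 : ℝ) ∈ Set.Icc 0 T := ⟨le_rfl, hT⟩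
  have hlip : ∀ s ∈ Set.Icc 0 T, ∀ t ∈ Set.Icc 0 T, ∀ z, ‖H t z - H s z‖ ≤ B * |t - s| :=
    fun s hs t ht z => (convex_Icc 0 T).norm_image_sub_le_of_norm_hasDerivWithin_le
      (fun x hx => hder x hx z) (fun x hx => hG x hx z) hs ht
  have hmem : ∀ s ∈ Set.Icc 0 T, ∀ t ∈ Set.Icc 0 T, MemLp (fun z => H t z - H s z) p Γ :=
    fun s hs t ht => MemLp.of_bound ((hH t ht).sub (hH s hs)).aestronglyMeasurable _
      (ae_of_all _ fun z => hlip s hs t ht z)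
  have hmem0 : MemLp (H 0) p Γ :=
    ⟨(hH 0 h0T).aestronglyMeasurable, h0.trans_lt ENNReal.ofReal_lt_top⟩
  have hmemt : ∀ t ∈ Set.Icc 0 T, MemLp (H t) p Γ := fun t ht => by
    have := (hmem 0 h0T t ht).add hmem0
    refine this.congr_norm (hH t ht).aestronglyMeasurable (ae_of_all _ fun z => ?_)
    simp
  set h : ℝ → ℝ := fun t => (eLpNorm (H t) p Γ).toReal
  -- the triangle inequality for `h`
  have htri : ∀ s ∈ Set.Icc 0 T, ∀ t ∈ Set.Icc 0 T,
      h t - h s ≤ (eLpNorm (fun z => H t z - H s z) p Γ).toReal := by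
    intro s hs t ht
    have h1 : eLpNorm (H t) p Γ ≤ eLpNorm (fun z => H t z - H s z) p Γ + eLpNorm (H s) p Γ := by
      refine le_trans (le_of_eq (congrArg (fun f => eLpNorm f p Γ) ?_))
        (eLpNorm_add_le (hmem s hs t ht).1 (hmemt s hs).1 hp)
      funext z; simp
    have h2 := ENNReal.toReal_mono
      (ENNReal.add_ne_top.2 ⟨(hmem s hs t ht).2.ne, (hmemt s hs).2.ne⟩) h1
    rw [ENNReal.toReal_add (hmem s hs t ht).2.ne (hmemt s hs).2.ne] at h2
    simp only [h]; linarith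
  have hcont : ContinuousOn h (Set.Icc 0 T) := by
    set c₀ : ℝ := (Γ Set.univ ^ p.toReal⁻¹).toReal
    have hfin : Γ Set.univ ^ p.toReal⁻¹ ≠ ⊤ :=
      ENNReal.rpow_ne_top_of_nonneg (by positivity) (measure_ne_top _ _)
    have hle : ∀ s ∈ Set.Icc 0 T, ∀ t ∈ Set.Icc 0 T, h t - h s ≤ c₀ * B * |t - s| := by
      intro s hs t ht
      refine (htri s hs t ht).trans ?_
      have h3 := eLpNorm_le_of_ae_bound (p := p) (μ := Γ) (ae_of_all _ fun z => hlip s hs t ht z)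
      have h4 := ENNReal.toReal_mono (ENNReal.mul_ne_top hfin ENNReal.ofReal_ne_top) h3
      rwa [ENNReal.toReal_mul, ENNReal.toReal_ofReal (by positivity), ← mul_assoc] at h4
    have : LipschitzOnWith (c₀ * B).toNNReal h (Set.Icc 0 T) := by
      refine LipschitzOnWith.of_dist_le_mul fun s hs t ht => ?_
      rw [Real.coe_toNNReal _ (by positivity), Real.dist_eq, Real.dist_eq, abs_sub_le_iff]
      exact ⟨hle t ht s hs, by rw [abs_sub_comm]; exact hle s hs t ht⟩
    exact this.continuousOn
  have hderiv : ∀ t ∈ Set.Ico 0 T, ∀ r, (eLpNorm (G t) p Γ).toReal < r →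
      ∃ᶠ s in 𝓝[>] t, (s - t)⁻¹ * (h s - h t) < r := by
    intro t ht r hr
    have htI : t ∈ Set.Icc 0 T := Set.Ico_subset_Icc_self ht
    have hev : ∀ᶠ s in 𝓝[>] t, s ∈ Set.Icc 0 T := by
      filter_upwards [Ioc_mem_nhdsGT ht.2] with s hs using ⟨ht.1.trans hs.1.le, hs.2⟩
    have hslope : ∀ z, Tendsto (fun s => slope (fun s => H s z) t s) (𝓝[>] t) (𝓝 (G t z)) := by
      intro z
      have := hasDerivWithinAt_iff_tendsto_slope.1 (hder t htI z)
      refine this.mono_left (nhdsWithin_le_of_mem ?_)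
      filter_upwards [hev, self_mem_nhdsWithin] with s hs hs' using ⟨hs, (ne_of_gt hs')⟩
    have hlim : Tendsto (fun s => eLpNorm (fun z => slope (fun s => H s z) t s) p Γ) (𝓝[>] t)
        (𝓝 (eLpNorm (G t) p Γ)) := by
      simp only [eLpNorm_eq_lintegral_rpow_enorm_toReal hp0 hp']
      refine ((ENNReal.continuous_rpow_const (y := 1 / p.toReal)).tendsto _).comp ?_
      refine tendsto_lintegral_filter_of_dominated_convergence
        (fun _ => ENNReal.ofReal B ^ p.toReal) ?_ ?_ ?_ (ae_of_all _ fun z => ?_)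
      · filter_upwards [hev] with s hs
        exact (((hH s hs).sub (hH t htI)).const_smul _).enorm.pow_const _
      · filter_upwards [hev, self_mem_nhdsWithin] with s hs hst
        refine ae_of_all _ fun z => ENNReal.rpow_le_rpow ?_ ENNReal.toReal_nonneg
        have hst' : 0 < s - t := sub_pos.2 hst
        rw [← ofReal_norm, slope_def_module, norm_smul, norm_inv, Real.norm_eq_abs,
          abs_of_pos hst']
        refine ENNReal.ofReal_le_ofReal ?_
        rw [inv_mul_le_iff₀ hst', mul_comm, ← abs_of_pos hst']
        exact hlip t htI s hs z
      · rw [lintegral_const]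
        exact ENNReal.mul_ne_top (ENNReal.rpow_ne_top_of_nonneg ENNReal.toReal_nonneg
          ENNReal.ofReal_ne_top) (measure_ne_top _ _)
      · exact ((ENNReal.continuous_rpow_const (y := p.toReal)).tendsto _).comp
          ((continuous_enorm.tendsto _).comp (hslope z))
    have hGfin : eLpNorm (G t) p Γ ≠ ⊤ := by
      refine ((hGH t htI).trans_lt (ENNReal.add_lt_top.2 ⟨?_, ENNReal.ofReal_lt_top⟩)).ne
      exact ENNReal.mul_lt_top ENNReal.ofReal_lt_top (hmemt t htI).2
    have hlim' := (ENNReal.tendsto_toReal hGfin).comp hlim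
    refine Eventually.frequently ?_
    filter_upwards [hev, self_mem_nhdsWithin, hlim'.eventually (gt_mem_nhds hr)] with s hs hst hlt
    refine lt_of_le_of_lt ?_ hlt
    have hst' : 0 < s - t := sub_pos.2 hst
    have h5 : eLpNorm (fun z => slope (fun s => H s z) t s) p Γ
        = ENNReal.ofReal (s - t)⁻¹ * eLpNorm (fun z => H s z - H t z) p Γ := by
      have := eLpNorm_const_smul (s - t)⁻¹ (fun z => H s z - H t z) p Γ
      rw [Real.enorm_eq_ofReal (inv_nonneg.2 hst'.le)] at this
      rw [← this]; rfl
    rw [Function.comp_apply, h5, ENNReal.toReal_mul, ENNReal.toReal_ofReal (inv_nonneg.2 hst'.le)]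
    exact mul_le_mul_of_nonneg_left (htri t htI s hs) (inv_nonneg.2 hst'.le)
  have := le_gronwallBound_of_liminf_deriv_right_le (δ := δ) (K := L) (ε := b) hcont hderiv
    (ENNReal.toReal_le_of_le_ofReal hδ h0) (fun t ht => ?_) t₁ ht₁
  · rw [sub_zero] at this
    exact ENNReal.le_ofReal_iff_toReal_le (hmemt t₁ ht₁).2.ne (ENNReal.toReal_nonneg.trans this)
      |>.2 this
  · have htI : t ∈ Set.Icc 0 T := Set.Ico_subset_Icc_self ht
    have h6 := ENNReal.toReal_mono (ENNReal.add_ne_top.2 ⟨ENNReal.mul_ne_top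
      ENNReal.ofReal_ne_top (hmemt t htI).2.ne, ENNReal.ofReal_ne_top⟩) (hGH t htI)
    rwa [ENNReal.toReal_add (ENNReal.mul_ne_top ENNReal.ofReal_ne_top (hmemt t htI).2.ne)
      ENNReal.ofReal_ne_top, ENNReal.toReal_mul, ENNReal.toReal_ofReal hL,
      ENNReal.toReal_ofReal hb] at h6

end LpTools

/-! ### Label couplings and the Wasserstein distance -/

section Coupling

variable {d N : ℕ} {p : ℝ≥0∞} {μ : Measure (EuclideanSpace ℝ (Fin d))}

lemma map_uniformLabel (X : Fin N → EuclideanSpace ℝ (Fin d)) :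
    (uniformLabel N).map X = empiricalMeasure X := by
  ext s hs
  rw [Measure.map_apply (measurable_of_finite X) hs]
  simp [uniformLabel, empiricalMeasure, Measure.dirac_apply' _ hs, Set.indicator]
  rfl

/-- Since the points are distinct, a coupling of their empirical measure with `μ` lifts to the
labels, at the same cost. -/
theorem exists_isLabelCoupling (hN : 0 < N) {X : Fin N → EuclideanSpace ℝ (Fin d)}
    (hX : Function.Injective X) {ε : ℝ≥0∞} (h : wasserstein p (empiricalMeasure X) μ < ε) :
    ∃ Γ : Measure (Fin N × EuclideanSpace ℝ (Fin d)), IsLabelCoupling Γ μ ∧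
      eLpNorm (fun z => X z.1 - z.2) p Γ < ε := by
  have : Nonempty (Fin N) := ⟨⟨0, hN⟩⟩
  rw [wasserstein] at h
  obtain ⟨γ, h⟩ := iInf_lt_iff.1 h
  obtain ⟨h1, h⟩ := iInf_lt_iff.1 h
  obtain ⟨h2, h⟩ := iInf_lt_iff.1 h
  set g : EuclideanSpace ℝ (Fin d) → Fin N := Function.invFun X
  have hgX : ∀ i, g (X i) = i := Function.leftInverse_invFun hX
  have hXm : Measurable X := measurable_of_finite X
  have hg : Measurable g := by
    refine (measurable_const (a := Classical.choice this)).measurable_of_countable_ne ?_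
    refine (Set.countable_range X).mono fun x hx => ?_
    by_contra hx'
    exact hx (Function.invFun_neg hx').symm
  have hm : Measurable fun z : EuclideanSpace ℝ (Fin d) × EuclideanSpace ℝ (Fin d) =>
      (g z.1, z.2) := (hg.comp measurable_fst).prodMk measurable_snd
  refine ⟨γ.map fun z => (g z.1, z.2), ⟨?_, ?_⟩, ?_⟩
  · rw [Measure.map_map measurable_fst hm,
      show Prod.fst ∘ (fun z : EuclideanSpace ℝ (Fin d) × EuclideanSpace ℝ (Fin d) =>
        (g z.1, z.2)) = g ∘ Prod.fst from rfl, ← Measure.map_map hg measurable_fst, h1,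
      ← map_uniformLabel, Measure.map_map hg hXm]
    convert Measure.map_id
    exact funext hgX
  · rw [Measure.map_map measurable_snd hm]
    exact h2
  · have hfm : Measurable fun z : Fin N × EuclideanSpace ℝ (Fin d) => X z.1 - z.2 :=
      (hXm.comp measurable_fst).sub measurable_snd
    rw [eLpNorm_map_measure hfm.aestronglyMeasurable hm.aemeasurable]
    refine lt_of_eq_of_lt (eLpNorm_congr_ae ?_) h
    have hrange : ∀ᵐ x ∂(γ.map Prod.fst), x ∈ Set.range X := by
      rw [h1, ← map_uniformLabel]
      refine (ae_map_iff hXm.aemeasurable (Set.finite_range X).measurableSet).2 ?_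
      exact ae_of_all _ fun i => Set.mem_range_self i
    filter_upwards [ae_of_ae_map measurable_fst.aemeasurable hrange] with z hz
    obtain ⟨i, hi⟩ := hz
    simp only [Function.comp_apply, ← hi, hgX]

theorem IsLabelCoupling.wasserstein_le {Γ : Measure (Fin N × EuclideanSpace ℝ (Fin d))}
    (h : IsLabelCoupling Γ μ) (X : Fin N → EuclideanSpace ℝ (Fin d)) :
    wasserstein p (empiricalMeasure X) μ ≤ eLpNorm (fun z => X z.1 - z.2) p Γ := by
  have hXm : Measurable fun z : Fin N × EuclideanSpace ℝ (Fin d) => X z.1 :=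
    (measurable_of_finite X).comp measurable_fst
  have hm : Measurable fun z : Fin N × EuclideanSpace ℝ (Fin d) => (X z.1, z.2) :=
    hXm.prodMk measurable_snd
  refine (iInf_le _ (Γ.map fun z => (X z.1, z.2))).trans <| (iInf_le _ ?_).trans <|
    (iInf_le _ ?_).trans (le_of_eq ?_)
  · rw [Measure.map_map measurable_fst hm, ← map_uniformLabel, ← h.map_fst,
      Measure.map_map (measurable_of_finite X) measurable_fst]; rfl
  · rw [Measure.map_map measurable_snd hm]; exact h.map_snd
  · have hsub : Measurable fun z : EuclideanSpace ℝ (Fin d) × EuclideanSpace ℝ (Fin d) =>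
        z.1 - z.2 := measurable_fst.sub measurable_snd
    rw [eLpNorm_map_measure hsub.aestronglyMeasurable hm.aemeasurable]; rfl

theorem IsLabelCoupling.eLpNorm_fst_le {Γ : Measure (Fin N × EuclideanSpace ℝ (Fin d))}
    (h : IsLabelCoupling Γ μ) (hN : 0 < N) (hp : 1 ≤ p) {V : Fin N → EuclideanSpace ℝ (Fin d)}
    {C : ℝ} (hV : ‖WithLp.toLp p V‖ ≤ C * (N : ℝ) ^ (p⁻¹).toReal) :
    eLpNorm (fun z => V z.1) p Γ ≤ ENNReal.ofReal C := by
  have hN' : (0 : ℝ) < N := by exact_mod_cast hN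
  rcases eq_or_ne p ⊤ with rfl | hp'
  · rw [eLpNorm_exponent_top]
    refine eLpNormEssSup_le_of_ae_enorm_bound (ae_of_all _ fun z => ?_)
    rw [← ofReal_norm]
    refine ENNReal.ofReal_le_ofReal ?_
    have := PiLp.norm_apply_le (WithLp.toLp (⊤ : ℝ≥0∞) V) z.1
    simp only [ENNReal.inv_top, ENNReal.toReal_zero, Real.rpow_zero, mul_one] at hV
    exact this.trans hV
  · have hP : 0 < p.toReal := ENNReal.toReal_pos (zero_lt_one.trans_le hp).ne' hp'
    have hC : 0 ≤ C := by
      have h0 : 0 ≤ ‖WithLp.toLp p V‖ := by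
        rw [PiLp.norm_eq_sum hP]; positivity
      exact nonneg_of_mul_nonneg_left (h0.trans hV) (by positivity)
    rw [PiLp.norm_eq_sum hP, ENNReal.toReal_inv] at hV
    have h1 : ∑ i, ‖V i‖ ^ p.toReal ≤ C ^ p.toReal * N := by
      have h2 := Real.rpow_le_rpow (by positivity) hV hP.le
      rwa [← Real.rpow_mul (by positivity), one_div_mul_cancel hP.ne', Real.rpow_one,
        Real.mul_rpow hC (by positivity), ← Real.rpow_mul hN'.le, inv_mul_cancel₀ hP.ne',
        Real.rpow_one] at h2
    rw [eLpNorm_eq_lintegral_rpow_enorm_toReal (zero_lt_one.trans_le hp).ne' hp',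
      h.lintegral_fst fun i => ‖V i‖ₑ ^ p.toReal]
    have h3 : (N : ℝ≥0∞)⁻¹ * ∑ i, ‖V i‖ₑ ^ p.toReal ≤ ENNReal.ofReal (C ^ p.toReal) := by
      have h4 := ofReal_average hN (f := fun i => ‖V i‖ ^ p.toReal) (fun i => by positivity)
        Finset.univ
      simp only [← ENNReal.ofReal_rpow_of_nonneg (norm_nonneg _) hP.le, ofReal_norm] at h4
      rw [← h4]
      refine ENNReal.ofReal_le_ofReal ?_
      rwa [inv_mul_le_iff₀ hN', mul_comm]
    refine (ENNReal.rpow_le_rpow h3 (by positivity)).trans (le_of_eq ?_)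
    rw [ENNReal.ofReal_rpow_of_nonneg (by positivity) (by positivity), ← Real.rpow_mul hC,
      mul_one_div_cancel hP.ne', Real.rpow_one]

/-- Chebyshev's inequality at the scale `R` for which the bound it gives is `R ^ (δ / r)`. -/
theorem measure_half_lt_norm_le {Z F : Type*} [MeasurableSpace Z] [NormedAddCommGroup F]
    {Γ : Measure Z} {f : Z → F} (hf : AEStronglyMeasurable f Γ) (hp : 1 ≤ p) {η r δ : ℝ}
    (hη : 0 < η) (hr : 0 < r) (hδ : 0 ≤ δ) (h : eLpNorm f p Γ ≤ ENNReal.ofReal η) :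
    Γ {z | (2 * η) ^ (r / (r + δ * (p⁻¹).toReal)) / 2 < ‖f z‖} ≤
      ENNReal.ofReal (((2 * η) ^ (r / (r + δ * (p⁻¹).toReal))) ^ (δ / r)) := by
  rcases eq_or_ne p ⊤ with rfl | hp'
  · simp only [ENNReal.inv_top, ENNReal.toReal_zero, mul_zero, add_zero, div_self hr.ne',
      Real.rpow_one, mul_div_cancel_left₀ η (two_ne_zero' ℝ)]
    refine le_of_eq_of_le ?_ bot_le
    rw [eLpNorm_exponent_top] at h
    have h1 : ∀ᵐ z ∂Γ, ¬ η < ‖f z‖ := by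
      filter_upwards [enorm_ae_le_eLpNormEssSup f Γ] with z hz
      rw [not_lt, ← ENNReal.ofReal_le_ofReal_iff hη.le, ofReal_norm]
      exact hz.trans h
    simpa [ae_iff] using h1
  · have hp0 : p ≠ 0 := (zero_lt_one.trans_le hp).ne'
    have hP : 0 < p.toReal := ENNReal.toReal_pos hp0 hp'
    rw [ENNReal.toReal_inv]
    set R := (2 * η) ^ (r / (r + δ * p.toReal⁻¹))
    have hR : 0 < R := by positivity
    have h1 := meas_ge_le_mul_pow_eLpNorm_enorm Γ hp0 hp' hf (ε := ENNReal.ofReal (R / 2))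
      (by simpa using hR) (fun h => absurd h ENNReal.ofReal_ne_top)
    refine (measure_mono fun z hz => ?_).trans (h1.trans ?_)
    · rw [Set.mem_ofPred_eq, ← ofReal_norm]
      exact ENNReal.ofReal_le_ofReal (le_of_lt hz)
    · rw [← ENNReal.mul_rpow_of_nonneg _ _ hP.le]
      refine (ENNReal.rpow_le_rpow (mul_le_mul_right h _) hP.le).trans (le_of_eq ?_)
      rw [← ENNReal.ofReal_inv_of_pos (by positivity), ← ENNReal.ofReal_mul (by positivity),
        ENNReal.ofReal_rpow_of_pos (by positivity)]
      congr 1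
      have h2 : (R / 2)⁻¹ * η = R ^ (δ * p.toReal⁻¹ / r) := by
        have h3 : 2 * η = R * R ^ (δ * p.toReal⁻¹ / r) := by
          have h4 : R * R ^ (δ * p.toReal⁻¹ / r) = R ^ (1 + δ * p.toReal⁻¹ / r) := by
            rw [Real.rpow_add hR, Real.rpow_one]
          have : r + δ * p.toReal⁻¹ ≠ 0 := by positivity
          rw [h4, ← Real.rpow_mul (by positivity),
            show r / (r + δ * p.toReal⁻¹) * (1 + δ * p.toReal⁻¹ / r) = 1 by field_simp,
            Real.rpow_one]
        rw [inv_div, div_mul_eq_mul_div, h3, mul_div_cancel_left₀ _ hR.ne']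
      rw [h2, ← Real.rpow_mul hR.le]
      congr 1
      field_simp

end Coupling

/-! ### Stability of the force -/

section Force

variable {d N : ℕ} {α c C₁ S : ℝ} {k : EuclideanSpace ℝ (Fin d) → EuclideanSpace ℝ (Fin d)}
  {μ : Measure (EuclideanSpace ℝ (Fin d))}

/-- The force `(1/N) ∑ j, k(x - X j)` of `N` particles. -/
noncomputable def particleForce (k : EuclideanSpace ℝ (Fin d) → EuclideanSpace ℝ (Fin d))
    (X : Fin N → EuclideanSpace ℝ (Fin d)) (x : EuclideanSpace ℝ (Fin d)) :
    EuclideanSpace ℝ (Fin d) :=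
  (N : ℝ)⁻¹ • ∑ j, k (x - X j)

/-- The sum of the weights of the particle pair and of the mean-field pair of two points of
`Fin N × ℝ^d`. -/
noncomputable def pairWeight (α : ℝ) (X : Fin N → EuclideanSpace ℝ (Fin d))
    (z z' : Fin N × EuclideanSpace ℝ (Fin d)) : ℝ≥0∞ :=
  ENNReal.ofReal (weight α (X z.1 - X z'.1)) + ENNReal.ofReal (weight α (z.2 - z'.2))

lemma measurable_uncurry_pairWeight (α : ℝ) (X : Fin N → EuclideanSpace ℝ (Fin d)) :
    Measurable (Function.uncurry (pairWeight α X)) := by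
  have hXm : Measurable fun z : Fin N × EuclideanSpace ℝ (Fin d) => X z.1 :=
    (measurable_of_finite X).comp measurable_fst
  refine ((measurable_weight.comp ?_).ennreal_ofReal).add
    ((measurable_weight.comp ?_).ennreal_ofReal)
  · exact (hXm.comp measurable_fst).sub (hXm.comp measurable_snd)
  · exact (measurable_snd.comp measurable_fst).sub (measurable_snd.comp measurable_snd)

lemma pairWeight_comm (α : ℝ) (X : Fin N → EuclideanSpace ℝ (Fin d))
    (z z' : Fin N × EuclideanSpace ℝ (Fin d)) : pairWeight α X z z' = pairWeight α X z' z := by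
  rw [pairWeight, pairWeight, ← weight_neg (X z.1 - _), ← weight_neg (z.2 - _), neg_sub, neg_sub]

lemma IsLabelCoupling.lintegral_pairWeight_le
    {Γ : Measure (Fin N × EuclideanSpace ℝ (Fin d))} (hΓ : IsLabelCoupling Γ μ)
    (hC₁ : 0 ≤ C₁) (hμ : WeightBound α C₁ μ) (hN : 0 < N)
    {X : Fin N → EuclideanSpace ℝ (Fin d)} (hS0 : 0 ≤ S)
    (hS : ∀ i, (N : ℝ)⁻¹ * ∑ j, weight α (X i - X j) ≤ S)
    (z : Fin N × EuclideanSpace ℝ (Fin d)) :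
    ∫⁻ z', pairWeight α X z z' ∂Γ ≤ ENNReal.ofReal (S + C₁) := by
  have h1 : Measurable fun y => ENNReal.ofReal (weight α (z.2 - y)) :=
    (measurable_weight.comp (measurable_const.sub measurable_id)).ennreal_ofReal
  have h2 : Measurable fun z' : Fin N × EuclideanSpace ℝ (Fin d) =>
      ENNReal.ofReal (weight α (z.2 - z'.2)) := h1.comp measurable_snd
  simp only [pairWeight]
  rw [lintegral_add_right _ h2,
    hΓ.lintegral_fst fun j => ENNReal.ofReal (weight α (X z.1 - X j)), hΓ.lintegral_snd h1,
    ← ofReal_average hN fun _ => weight_nonneg _, ENNReal.ofReal_add hS0 hC₁]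
  exact add_le_add (ENNReal.ofReal_le_ofReal (hS _)) (hμ _)

lemma enorm_kernel_sub_le (hk : SingularKernel α c k) (X : Fin N → EuclideanSpace ℝ (Fin d))
    (z z' : Fin N × EuclideanSpace ℝ (Fin d)) :
    ‖k (X z.1 - X z'.1) - k (z.2 - z'.2)‖ₑ ≤ ENNReal.ofReal c *
      (‖X z.1 - z.2‖ₑ * pairWeight α X z z' + pairWeight α X z z' * ‖X z'.1 - z'.2‖ₑ) := by
  have hc := hk.const_nonneg
  rw [mul_comm (pairWeight α X z z'), ← add_mul]
  simp only [pairWeight, ← ofReal_norm]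
  rw [← ENNReal.ofReal_add (norm_nonneg _) (norm_nonneg _),
    ← ENNReal.ofReal_add (weight_nonneg _) (weight_nonneg _),
    ← ENNReal.ofReal_mul (by positivity), ← ENNReal.ofReal_mul hc]
  refine ENNReal.ofReal_le_ofReal ((hk.norm_sub_le _ _).trans ?_)
  have h3 : ‖X z.1 - X z'.1 - (z.2 - z'.2)‖ ≤ ‖X z.1 - z.2‖ + ‖X z'.1 - z'.2‖ := by
    rw [sub_sub_sub_comm]; exact norm_sub_le _ _
  have := weight_nonneg (α := α) (X z.1 - X z'.1)
  have := weight_nonneg (α := α) (z.2 - z'.2)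
  gcongr

lemma IsLabelCoupling.enorm_particleForce_sub_le [IsProbabilityMeasure μ]
    {Γ : Measure (Fin N × EuclideanSpace ℝ (Fin d))} (hΓ : IsLabelCoupling Γ μ)
    (hk : SingularKernel α c k) (hμ : WeightBound α C₁ μ)
    (X : Fin N → EuclideanSpace ℝ (Fin d)) (z : Fin N × EuclideanSpace ℝ (Fin d)) :
    ‖particleForce k X (X z.1) - meanVelocity k μ z.2‖ₑ ≤ ENNReal.ofReal c *
      (‖X z.1 - z.2‖ₑ * ∫⁻ z', pairWeight α X z z' ∂Γ
        + ∫⁻ z', pairWeight α X z z' * ‖X z'.1 - z'.2‖ₑ ∂Γ) := by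
  have := hΓ.isProbabilityMeasure
  have hi1 : Integrable (fun z' : Fin N × EuclideanSpace ℝ (Fin d) => k (X z.1 - X z'.1)) Γ := by
    have : IsFiniteMeasure (Γ.map Prod.fst) := inferInstance
    exact (Integrable.of_finite (μ := Γ.map Prod.fst)
      (f := fun j => k (X z.1 - X j))).comp_measurable measurable_fst
  have hi2 : Integrable (fun z' : Fin N × EuclideanSpace ℝ (Fin d) => k (z.2 - z'.2)) Γ := by
    have := hμ.integrable_kernel hk z.2
    rw [← hΓ.map_snd] at this
    exact this.comp_measurable measurable_snd
  have e1 : particleForce k X (X z.1) = ∫ z', k (X z.1 - X z'.1) ∂Γ := by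
    have h1 := integral_map (μ := Γ) (φ := Prod.fst) measurable_fst.aemeasurable
      (f := fun j => k (X z.1 - X j)) (measurable_of_finite _).aestronglyMeasurable
    rw [← h1, hΓ.map_fst, uniformLabel, integral_smul_measure, integral_finsetSum_measure
      fun i _ => Integrable.of_finite]
    simp [particleForce]
  have e2 : meanVelocity k μ z.2 = ∫ z', k (z.2 - z'.2) ∂Γ := by
    rw [meanVelocity, ← hΓ.map_snd, integral_map measurable_snd.aemeasurable]
    exact (hk.measurable.comp (measurable_const.sub measurable_id)).aestronglyMeasurable
  rw [e1, e2, ← integral_sub hi1 hi2]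
  refine (enorm_integral_le_lintegral_enorm _).trans
    ((lintegral_mono (enorm_kernel_sub_le hk X z)).trans (le_of_eq ?_))
  have hwz : Measurable (pairWeight α X z) := (measurable_uncurry_pairWeight α X).of_uncurry_left
  have ham : Measurable fun z : Fin N × EuclideanSpace ℝ (Fin d) => ‖X z.1 - z.2‖ₑ :=
    (((measurable_of_finite X).comp measurable_fst).sub measurable_snd).enorm
  have hm1 : Measurable fun z' => ‖X z.1 - z.2‖ₑ * pairWeight α X z z' := hwz.const_mul _
  have hm2 : Measurable fun z' : Fin N × EuclideanSpace ℝ (Fin d) =>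
    pairWeight α X z z' * ‖X z'.1 - z'.2‖ₑ := hwz.mul ham
  have hm3 : Measurable fun z' : Fin N × EuclideanSpace ℝ (Fin d) =>
    ‖X z.1 - z.2‖ₑ * pairWeight α X z z' + pairWeight α X z z' * ‖X z'.1 - z'.2‖ₑ := hm1.add hm2
  rw [lintegral_const_mul _ hm3, lintegral_add_left hm1, lintegral_const_mul _ hwz]

/-- The force of the particles differs from the mean-field velocity, in `L^p` of a coupling, by at
most a multiple of the cost of the coupling. The kernel difference is bounded by the two
displacements times the sum of two weights, and the Schur test applies to the latter. -/
theorem IsLabelCoupling.eLpNorm_particleForce_sub_le [IsProbabilityMeasure μ]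
    {Γ : Measure (Fin N × EuclideanSpace ℝ (Fin d))} (hΓ : IsLabelCoupling Γ μ)
    (hk : SingularKernel α c k) (hC₁ : 0 ≤ C₁) (hμ : WeightBound α C₁ μ) (hN : 0 < N)
    {X : Fin N → EuclideanSpace ℝ (Fin d)} (hS0 : 0 ≤ S)
    (hS : ∀ i, (N : ℝ)⁻¹ * ∑ j, weight α (X i - X j) ≤ S) {p : ℝ≥0∞} (hp : 1 ≤ p) (hp' : p ≠ ⊤) :
    eLpNorm (fun z => particleForce k X (X z.1) - meanVelocity k μ z.2) p Γ ≤
      ENNReal.ofReal (2 * c * (S + C₁)) * eLpNorm (fun z => X z.1 - z.2) p Γ := by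
  have := hΓ.isProbabilityMeasure
  have hc := hk.const_nonneg
  set a : Fin N × EuclideanSpace ℝ (Fin d) → ℝ≥0∞ := fun z => ‖X z.1 - z.2‖ₑ
  set κ := ENNReal.ofReal (S + C₁) with hκ
  have ham : Measurable a :=
    (((measurable_of_finite X).comp measurable_fst).sub measurable_snd).enorm
  have hwm := measurable_uncurry_pairWeight α X
  have hrow := hΓ.lintegral_pairWeight_le hC₁ hμ hN hS0 hS
  have hcol : ∀ z', ∫⁻ z, pairWeight α X z z' ∂Γ ≤ κ := fun z' => by
    simp only [pairWeight_comm α X _ z']; exact hrow z'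
  have hschur := eLpNorm_lintegral_mul_le hwm hrow hcol ham hp hp'
  set b : Fin N × EuclideanSpace ℝ (Fin d) → ℝ≥0∞ := fun z => ∫⁻ z', pairWeight α X z z' * a z' ∂Γ
  have hpt : ∀ z, ‖particleForce k X (X z.1) - meanVelocity k μ z.2‖ₑ ≤
      ENNReal.ofReal c * (κ * a z + b z) := fun z => by
    refine (hΓ.enorm_particleForce_sub_le hk hμ X z).trans ?_
    rw [mul_comm κ]
    exact mul_le_mul' le_rfl (add_le_add (mul_le_mul' le_rfl (hrow z)) le_rfl)
  have hbm : Measurable b := (hwm.mul (ham.comp measurable_snd)).lintegral_prod_right'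
  have hmul : ∀ (C : ℝ) (g : Fin N × EuclideanSpace ℝ (Fin d) → ℝ≥0∞),
      eLpNorm (fun z => ENNReal.ofReal C * g z) p Γ ≤ ENNReal.ofReal C * eLpNorm g p Γ :=
    fun C g => eLpNorm_le_mul_eLpNorm_of_ae_le_mul' (c := C.toNNReal) (ae_of_all _ fun z => le_rfl) p
  have hea : eLpNorm a p Γ = eLpNorm (fun z => X z.1 - z.2) p Γ :=
    eLpNorm_congr_enorm_ae (ae_of_all _ fun z => enorm_enorm _)
  have hadd : eLpNorm (fun z => κ * a z + b z) p Γ ≤ κ * eLpNorm a p Γ + κ * eLpNorm a p Γ :=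
    (eLpNorm_add_le (ham.const_mul κ).aestronglyMeasurable hbm.aestronglyMeasurable hp).trans
      (add_le_add (hmul (S + C₁) a) hschur)
  have hmain : eLpNorm (fun z => particleForce k X (X z.1) - meanVelocity k μ z.2) p Γ ≤
      eLpNorm (fun z => ENNReal.ofReal c * (κ * a z + b z)) p Γ :=
    eLpNorm_mono_enorm fun z => by rw [enorm_eq_self]; exact hpt z
  refine hmain.trans ((hmul c _).trans ((mul_le_mul' le_rfl hadd).trans (le_of_eq ?_)))
  rw [hea, ← two_mul, hκ, mul_assoc 2 c, ENNReal.ofReal_mul zero_le_two, ENNReal.ofReal_mul hc]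
  simp only [ENNReal.ofReal_ofNat]
  ring

end Force

/-! ### Particle trajectories -/

/-- A continuity argument for finitely many functions: a bound by `b` up to time `t` that improves
itself to a bound by `a < b` at time `t` holds for all times. -/
theorem le_of_improving_bound {ι : Type*} [Finite ι] {g : ι → ℝ → ℝ} {T a b : ℝ} (hab : a < b)
    (hg : ∀ i, ContinuousOn (g i) (Set.Icc 0 T)) (h0 : ∀ i, g i 0 ≤ b)
    (h : ∀ t ∈ Set.Icc 0 T, (∀ s ∈ Set.Icc 0 t, ∀ i, g i s ≤ b) → ∀ i, g i t ≤ a) :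
    ∀ t ∈ Set.Icc 0 T, ∀ i, g i t ≤ a := by
  by_contra! hcon
  obtain ⟨t, ht, i, hi⟩ := hcon
  set A : Set ℝ := ⋃ i, Set.Icc 0 T ∩ g i ⁻¹' Set.Ici b
  have hA : IsClosed A :=
    isClosed_iUnion_of_finite fun i => (hg i).preimage_isClosed_of_isClosed isClosed_Icc isClosed_Ici
  have hAT : A ⊆ Set.Icc 0 T := Set.iUnion_subset fun i => Set.inter_subset_left
  have hne : A.Nonempty := by
    by_contra hne
    refine hi.not_ge (h t ht (fun s hs j => ?_) i)
    by_contra hsj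
    exact hne ⟨s, Set.mem_iUnion.2 ⟨j, ⟨hs.1, hs.2.trans ht.2⟩, (not_le.1 hsj).le⟩⟩
  obtain ⟨t₀, ht₀, hmin⟩ := (isCompact_Icc.of_isClosed_subset hA hAT).exists_isLeast hne
  have ht₀T := hAT ht₀
  obtain ⟨j, -, hj⟩ := Set.mem_iUnion.1 ht₀
  refine (hab.trans_le hj).not_ge (h t₀ ht₀T (fun s hs l => ?_) j)
  by_contra! hl
  have hsT : Set.Icc 0 s ⊆ Set.Icc 0 T := Set.Icc_subset_Icc le_rfl (hs.2.trans ht₀T.2)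
  obtain ⟨u, hu, hub⟩ := intermediate_value_Icc hs.1 ((hg l).mono hsT) ⟨h0 l, hl.le⟩
  have hus : u ≠ s := fun hus => hl.ne' (by rw [← hus, hub])
  have := hmin (Set.mem_iUnion.2 ⟨l, hsT hu, hub.ge⟩)
  exact hus (le_antisymm hu.2 (hs.2.trans this))

section Trajectory

variable {d N : ℕ} {α c S lam T : ℝ} {k : EuclideanSpace ℝ (Fin d) → EuclideanSpace ℝ (Fin d)}
  {X V : ℝ → Fin N → EuclideanSpace ℝ (Fin d)}

lemma norm_particleForce_le (hk : SingularKernel α c k) (hN : 0 < N)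
    {Y : Fin N → EuclideanSpace ℝ (Fin d)} {x : EuclideanSpace ℝ (Fin d)}
    (h : (N : ℝ)⁻¹ * ∑ j, weight α (x - Y j) ≤ S) : ‖particleForce k Y x‖ ≤ c * (1 + S) := by
  have hN' : (0 : ℝ) < N := by exact_mod_cast hN
  have hc := hk.const_nonneg
  rw [particleForce, norm_smul, Real.norm_of_nonneg (by positivity)]
  calc (N : ℝ)⁻¹ * ‖∑ j, k (x - Y j)‖ ≤ (N : ℝ)⁻¹ * ∑ j, c * (1 + weight α (x - Y j)) := by
        gcongr
        exact norm_sum_le_of_le _ fun j _ => hk.norm_le_one_add _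
    _ = c * (1 + (N : ℝ)⁻¹ * ∑ j, weight α (x - Y j)) := by
        rw [← Finset.mul_sum, Finset.sum_add_distrib]
        simp only [Finset.sum_const, Finset.card_univ, Fintype.card_fin, nsmul_eq_mul, mul_one]
        field_simp
    _ ≤ c * (1 + S) := by gcongr

lemma norm_particleForce_sub_le (hk : SingularKernel α c k)
    {Y : Fin N → EuclideanSpace ℝ (Fin d)} {x y : EuclideanSpace ℝ (Fin d)}
    (hx : (N : ℝ)⁻¹ * ∑ j, weight α (x - Y j) ≤ S) (hy : (N : ℝ)⁻¹ * ∑ j, weight α (y - Y j) ≤ S) :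
    ‖particleForce k Y x - particleForce k Y y‖ ≤ 2 * c * S * ‖x - y‖ := by
  have hc := hk.const_nonneg
  rw [particleForce, particleForce, ← smul_sub, ← Finset.sum_sub_distrib, norm_smul,
    Real.norm_of_nonneg (by positivity)]
  calc (N : ℝ)⁻¹ * ‖∑ j, (k (x - Y j) - k (y - Y j))‖
      ≤ (N : ℝ)⁻¹ * ∑ j, c * (‖x - y‖ * (weight α (x - Y j) + weight α (y - Y j))) := by
        gcongr
        refine norm_sum_le_of_le _ fun j _ => ?_
        have := hk.norm_sub_le (x - Y j) (y - Y j)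
        rwa [sub_sub_sub_cancel_right] at this
    _ = c * ‖x - y‖ * ((N : ℝ)⁻¹ * ∑ j, weight α (x - Y j)
          + (N : ℝ)⁻¹ * ∑ j, weight α (y - Y j)) := by
        rw [← Finset.mul_sum, ← Finset.mul_sum, Finset.sum_add_distrib]; ring
    _ ≤ c * ‖x - y‖ * (S + S) := by gcongr
    _ = _ := by ring

/-- Solutions of `X_i' = V_i`, `V_i' = lam (-V_i + (1/N) ∑ j, k(X_i - X_j))` on `[0, T]` for a kernel
that is defined everywhere. -/
structure IsTrajectory (k : EuclideanSpace ℝ (Fin d) → EuclideanSpace ℝ (Fin d)) (lam T : ℝ)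
    (X V : ℝ → Fin N → EuclideanSpace ℝ (Fin d)) : Prop where
  deriv_pos : ∀ t ∈ Set.Icc 0 T, ∀ i,
    HasDerivWithinAt (fun s => X s i) (V t i) (Set.Icc 0 T) t
  deriv_vel : ∀ t ∈ Set.Icc 0 T, ∀ i,
    HasDerivWithinAt (fun s => V s i) (lam • (-V t i + particleForce k (X t) (X t i)))
      (Set.Icc 0 T) t

lemma particleForce_puncture (K : EuclideanSpace ℝ (Fin d) → EuclideanSpace ℝ (Fin d))
    {Y : Fin N → EuclideanSpace ℝ (Fin d)} (hY : ∀ i j, i ≠ j → Y i ≠ Y j) (i : Fin N) :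
    particleForce (puncture K) Y (Y i)
      = (N : ℝ)⁻¹ • ∑ j ∈ Finset.univ.erase i, K (Y i - Y j) := by
  rw [particleForce, ← Finset.add_sum_erase _ _ (Finset.mem_univ i), sub_self, puncture_zero,
    zero_add]
  congr 1
  refine Finset.sum_congr rfl fun j hj => puncture_of_ne K (sub_ne_zero.2 ?_)
  exact hY i j (Finset.ne_of_mem_erase hj).symm

lemma IsParticleSolution.isTrajectory
    {K : EuclideanSpace ℝ (Fin d) → EuclideanSpace ℝ (Fin d)}
    {X₀ V₀ : Fin N → EuclideanSpace ℝ (Fin d)} (h : IsParticleSolution K lam X₀ V₀ T X V) :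
    IsTrajectory (puncture K) lam T X V where
  deriv_pos := h.deriv_pos
  deriv_vel t ht i := by
    rw [particleForce_puncture K (h.no_collision t ht)]
    exact h.deriv_vel t ht i

namespace IsTrajectory

lemma isParticleSolution {K : EuclideanSpace ℝ (Fin d) → EuclideanSpace ℝ (Fin d)}
    (h : IsTrajectory (puncture K) lam T X V)
    (hne : ∀ t ∈ Set.Icc 0 T, ∀ i j, i ≠ j → X t i ≠ X t j) :
    IsParticleSolution K lam (X 0) (V 0) T X V where
  initial_pos := rfl
  initial_vel := rfl
  no_collision := hne
  deriv_pos := h.deriv_pos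
  deriv_vel t ht i := by
    rw [← particleForce_puncture K (hne t ht)]
    exact h.deriv_vel t ht i

lemma mono {T₁ : ℝ} (h : IsTrajectory k lam T X V) (hT : T₁ ≤ T) : IsTrajectory k lam T₁ X V where
  deriv_pos t ht i := (h.deriv_pos t ⟨ht.1, ht.2.trans hT⟩ i).mono (Set.Icc_subset_Icc le_rfl hT)
  deriv_vel t ht i := (h.deriv_vel t ⟨ht.1, ht.2.trans hT⟩ i).mono (Set.Icc_subset_Icc le_rfl hT)

lemma of_truncate {δ : ℝ} (hδ : 0 < δ) (hk0 : k 0 = 0)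
    (h : IsTrajectory (SingularKernel.truncate δ k) lam T X V)
    (hsep : ∀ t ∈ Set.Icc 0 T, ∀ i j, i ≠ j → δ ≤ ‖X t i - X t j‖) : IsTrajectory k lam T X V where
  deriv_pos := h.deriv_pos
  deriv_vel t ht i := by
    have : particleForce k (X t) (X t i)
        = particleForce (SingularKernel.truncate δ k) (X t) (X t i) := by
      rw [particleForce, particleForce]
      congr 1
      refine Finset.sum_congr rfl fun j _ => ?_
      rcases eq_or_ne i j with rfl | hij
      · rw [sub_self, hk0, SingularKernel.truncate, hk0, smul_zero]
      · exact (SingularKernel.truncate_eq hδ (hsep t ht i j hij)).symm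
    rw [this]
    exact h.deriv_vel t ht i

lemma continuousOn_pos (h : IsTrajectory k lam T X V) (i : Fin N) :
    ContinuousOn (fun t => X t i) (Set.Icc 0 T) := fun t ht => (h.deriv_pos t ht i).continuousWithinAt

/-- The friction keeps the velocities bounded, uniformly in `lam`: `exp (lam t) V_i` has the
derivative `lam exp (lam t) F_i`. -/
theorem norm_vel_le (h : IsTrajectory k lam T X V) (hlam : 0 < lam) {B : ℝ} (hB : 0 ≤ B)
    (hF : ∀ t ∈ Set.Icc 0 T, ∀ i, ‖particleForce k (X t) (X t i)‖ ≤ B) :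
    ∀ t ∈ Set.Icc 0 T, ∀ i, ‖V t i‖ ≤ ‖V 0 i‖ + B := by
  intro t ht i
  have hexp : ∀ s, HasDerivAt (fun s => Real.exp (lam * s)) (lam * Real.exp (lam * s)) s := by
    intro s
    have := ((hasDerivAt_id s).const_mul lam).exp
    simpa [mul_comm] using this
  have hU : ∀ s ∈ Set.Icc 0 T, HasDerivWithinAt (fun s => Real.exp (lam * s) • V s i - V 0 i)
      ((lam * Real.exp (lam * s)) • particleForce k (X s) (X s i)) (Set.Icc 0 T) s := by
    intro s hs
    have := ((hexp s).hasDerivWithinAt.smul (h.deriv_vel s hs i)).sub_const (V 0 i)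
    refine this.congr_deriv ?_
    rw [smul_smul, mul_comm (Real.exp _), smul_add, smul_neg]
    abel
  have h1 := image_norm_le_of_norm_deriv_right_le_deriv_boundary'
    (f := fun s => Real.exp (lam * s) • V s i - V 0 i)
    (f' := fun s => (lam * Real.exp (lam * s)) • particleForce k (X s) (X s i))
    (B := fun s => B * (Real.exp (lam * s) - 1)) (B' := fun s => B * (lam * Real.exp (lam * s)))
    (a := 0) (b := T) (fun s hs => (hU s hs).continuousWithinAt)
    (fun s hs => hasDerivWithinAt_Ici_of_Icc (hU s (Set.Ico_subset_Icc_self hs)) hs)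
    (by simp) (by fun_prop) (fun s _ => (((hexp s).sub_const 1).const_mul B).hasDerivWithinAt)
    (fun s hs => ?_) ht
  · have h2 : Real.exp (lam * t) * ‖V t i‖ ≤ Real.exp (lam * t) * (‖V 0 i‖ + B) := by
      have h3 := norm_le_norm_add_norm_sub' (Real.exp (lam * t) • V t i) (V 0 i)
      rw [norm_smul, Real.norm_of_nonneg (Real.exp_pos _).le] at h3
      have h4 : 1 ≤ Real.exp (lam * t) := Real.one_le_exp (mul_nonneg hlam.le ht.1)
      have h5 := mul_le_mul_of_nonneg_right h4 (norm_nonneg (V 0 i))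
      nlinarith
    exact le_of_mul_le_mul_left h2 (Real.exp_pos _)
  · rw [norm_smul, Real.norm_of_nonneg (by positivity), mul_comm B]
    have := hF s (Set.Ico_subset_Icc_self hs) i
    gcongr

/-- **Lower bound for the distances.** For large friction the cone `|W| ≤ (lam / 2) |D|` for the
differences `D`, `W` of positions and velocities is invariant, as long as `D ≠ 0`, and inside it `D`
is comparable to `H = D + W / lam`, which satisfies `|H'| ≤ 2 L |H|`. -/
theorem norm_sub_ge (h : IsTrajectory k lam T X V) {L : ℝ} (hL : 0 ≤ L) (hlam : 4 * L < lam)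
    {i j : Fin N} (hne : ∀ t ∈ Set.Icc 0 T, X t i ≠ X t j)
    (hF : ∀ t ∈ Set.Icc 0 T, ‖particleForce k (X t) (X t i) - particleForce k (X t) (X t j)‖
      ≤ L * ‖X t i - X t j‖)
    (h0 : ‖V 0 i - V 0 j‖ ≤ lam / 2 * ‖X 0 i - X 0 j‖) :
    ∀ t ∈ Set.Icc 0 T, Real.exp (-(2 * L * t)) / 3 * ‖X 0 i - X 0 j‖ ≤ ‖X t i - X t j‖ := by
  have hlam0 : 0 < lam := by linarith
  set D : ℝ → EuclideanSpace ℝ (Fin d) := fun t => X t i - X t j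
  set W : ℝ → EuclideanSpace ℝ (Fin d) := fun t => V t i - V t j
  set F : ℝ → EuclideanSpace ℝ (Fin d) :=
    fun t => particleForce k (X t) (X t i) - particleForce k (X t) (X t j)
  have hD : ∀ t ∈ Set.Icc 0 T, HasDerivWithinAt D (W t) (Set.Icc 0 T) t :=
    fun t ht => (h.deriv_pos t ht i).sub (h.deriv_pos t ht j)
  have hW : ∀ t ∈ Set.Icc 0 T, HasDerivWithinAt W (lam • (-W t + F t)) (Set.Icc 0 T) t := by
    intro t ht
    refine ((h.deriv_vel t ht i).sub (h.deriv_vel t ht j)).congr_deriv ?_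
    rw [← smul_sub]
    congr 1
    simp only [W, F]; abel
  have hD0 : ∀ t ∈ Set.Icc 0 T, 0 < ‖D t‖ := fun t ht => norm_pos_iff.2 (sub_ne_zero.2 (hne t ht))
  have hcone : ∀ t ∈ Set.Icc 0 T, ‖W t‖ ≤ lam / 2 * ‖D t‖ := by
    intro t ht
    have h1 := image_le_of_deriv_right_lt_deriv_boundary' (f := fun s => ‖W s‖ ^ 2)
      (f' := fun s => 2 * inner ℝ (W s) (lam • (-W s + F s)))
      (B := fun s => (lam / 2) ^ 2 * ‖D s‖ ^ 2)
      (B' := fun s => (lam / 2) ^ 2 * (2 * inner ℝ (D s) (W s))) (a := 0) (b := T)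
      (fun s hs => (hW s hs).norm_sq.continuousWithinAt)
      (fun s hs => hasDerivWithinAt_Ici_of_Icc (hW s (Set.Ico_subset_Icc_self hs)).norm_sq hs)
      (by rw [← mul_pow]; exact pow_le_pow_left₀ (norm_nonneg _) h0 2)
      (fun s hs => ((hD s hs).norm_sq.const_mul _).continuousWithinAt)
      (fun s hs => hasDerivWithinAt_Ici_of_Icc
        ((hD s (Set.Ico_subset_Icc_self hs)).norm_sq.const_mul _) hs)
      (fun s hs heq => ?_) ht
    · rw [← mul_pow] at h1
      exact le_of_sq_le_sq h1 (by positivity)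
    · have hs' := Set.Ico_subset_Icc_self hs
      have hDs := hD0 s hs'
      have hWs : ‖W s‖ = lam / 2 * ‖D s‖ := by
        rw [← mul_pow] at heq
        exact (sq_eq_sq₀ (norm_nonneg _) (by positivity)).1 heq
      have h2 : inner ℝ (W s) (F s) ≤ ‖W s‖ * (L * ‖D s‖) :=
        (real_inner_le_norm _ _).trans (mul_le_mul_of_nonneg_left (hF s hs') (norm_nonneg _))
      have h3 : -(‖D s‖ * ‖W s‖) ≤ inner ℝ (D s) (W s) :=
        (abs_le.1 (abs_real_inner_le_norm _ _)).1
      rw [inner_smul_right, inner_add_right, inner_neg_right, real_inner_self_eq_norm_sq]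
      rw [hWs] at h2 h3 ⊢
      have h4 : lam * inner ℝ (W s) (F s) ≤ lam * (lam / 2 * ‖D s‖ * (L * ‖D s‖)) :=
        mul_le_mul_of_nonneg_left h2 hlam0.le
      have h5 : (lam / 2) ^ 2 * -(‖D s‖ * (lam / 2 * ‖D s‖))
          ≤ (lam / 2) ^ 2 * inner ℝ (D s) (W s) := mul_le_mul_of_nonneg_left h3 (by positivity)
      have h6 : 0 < lam ^ 2 * ‖D s‖ ^ 2 * (lam - 4 * L) :=
        mul_pos (by positivity) (by linarith)
      nlinarith
  set H : ℝ → EuclideanSpace ℝ (Fin d) := fun t => D t + lam⁻¹ • W t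
  have hHder : ∀ t ∈ Set.Icc 0 T, HasDerivWithinAt H (F t) (Set.Icc 0 T) t := by
    intro t ht
    refine ((hD t ht).add ((hW t ht).const_smul lam⁻¹)).congr_deriv ?_
    rw [smul_smul, inv_mul_cancel₀ hlam0.ne', one_smul]; abel
  have hWD : ∀ t ∈ Set.Icc 0 T, ‖lam⁻¹ • W t‖ ≤ ‖D t‖ / 2 := by
    intro t ht
    rw [norm_smul, Real.norm_of_nonneg (by positivity), inv_mul_le_iff₀ hlam0]
    linarith [hcone t ht]
  have hHD : ∀ t ∈ Set.Icc 0 T, ‖D t‖ ≤ 2 * ‖H t‖ := by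
    intro t ht
    have : ‖D t‖ ≤ ‖H t‖ + ‖lam⁻¹ • W t‖ := by
      have := norm_sub_le (H t) (lam⁻¹ • W t)
      rwa [add_sub_cancel_right] at this
    linarith [hWD t ht]
  intro t ht
  have h0T : (0 : ℝ) ∈ Set.Icc 0 T := ⟨le_rfl, ht.1.trans ht.2⟩
  have hder : ∀ s ∈ Set.Icc 0 T, HasDerivWithinAt (fun s => Real.exp (4 * L * s) * ‖H s‖ ^ 2)
      (Real.exp (4 * L * s) * (4 * L) * ‖H s‖ ^ 2
        + Real.exp (4 * L * s) * (2 * inner ℝ (H s) (F s))) (Set.Icc 0 T) s := by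
    intro s hs
    have he : HasDerivAt (fun s => Real.exp (4 * L * s)) (Real.exp (4 * L * s) * (4 * L)) s := by
      simpa using ((hasDerivAt_id s).const_mul (4 * L)).exp
    exact he.hasDerivWithinAt.mul (hHder s hs).norm_sq
  have hmono : MonotoneOn (fun s => Real.exp (4 * L * s) * ‖H s‖ ^ 2) (Set.Icc 0 T) := by
    refine monotoneOn_of_hasDerivWithinAt_nonneg (convex_Icc 0 T)
      (fun s hs => (hder s hs).continuousWithinAt)
      (fun s hs => (hder s (interior_subset hs)).mono interior_subset) fun s hs => ?_
    have hs' := interior_subset hs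
    have h1 : -(‖H s‖ * ‖F s‖) ≤ inner ℝ (H s) (F s) := (abs_le.1 (abs_real_inner_le_norm _ _)).1
    have h2 : ‖H s‖ * ‖F s‖ ≤ ‖H s‖ * (L * (2 * ‖H s‖)) := by
      refine mul_le_mul_of_nonneg_left ((hF s hs').trans ?_) (norm_nonneg _)
      exact mul_le_mul_of_nonneg_left (hHD s hs') hL
    have h3 : 0 ≤ Real.exp (4 * L * s) * (4 * L * ‖H s‖ ^ 2 + 2 * inner ℝ (H s) (F s)) :=
      mul_nonneg (Real.exp_pos _).le (by nlinarith)
    linarith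
  have h1 := hmono h0T ht ht.1
  simp only [mul_zero, Real.exp_zero, one_mul] at h1
  have h2 : ‖H 0‖ ≤ Real.exp (2 * L * t) * ‖H t‖ := by
    refine le_of_sq_le_sq ?_ (by positivity)
    rw [mul_pow, ← Real.exp_nat_mul]
    convert h1 using 3
    push_cast; ring
  have h3 : ‖H t‖ ≤ 3 / 2 * ‖D t‖ := by
    linarith [norm_add_le (D t) (lam⁻¹ • W t), hWD t ht]
  have h4 := hHD 0 h0T
  have h5 : Real.exp (-(2 * L * t)) * Real.exp (2 * L * t) = 1 := by
    rw [← Real.exp_add, neg_add_cancel, Real.exp_zero]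
  have h6 : ‖D 0‖ ≤ 3 * (Real.exp (2 * L * t) * ‖D t‖) := by
    have := mul_le_mul_of_nonneg_left h3 (Real.exp_pos (2 * L * t)).le
    linarith
  calc Real.exp (-(2 * L * t)) / 3 * ‖D 0‖
      ≤ Real.exp (-(2 * L * t)) / 3 * (3 * (Real.exp (2 * L * t) * ‖D t‖)) := by gcongr
    _ = (Real.exp (-(2 * L * t)) * Real.exp (2 * L * t)) * ‖D t‖ := by ring
    _ = ‖D t‖ := by rw [h5, one_mul]

end IsTrajectory

/-- Trajectories for bounded Lipschitz kernels. In the variables `X + V / lam` and `exp (lam t) V` the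
system is given by a bounded Lipschitz field. -/
theorem exists_isTrajectory {L : NNReal} {b : ℝ} (hk : LipschitzWith L k) (hb : ∀ x, ‖k x‖ ≤ b)
    (hlam : 0 < lam) (hT : 0 ≤ T) (X₀ V₀ : Fin N → EuclideanSpace ℝ (Fin d)) :
    ∃ X V : ℝ → Fin N → EuclideanSpace ℝ (Fin d),
      IsTrajectory k lam T X V ∧ X 0 = X₀ ∧ V 0 = V₀ := by
  have hb0 : 0 ≤ b := (norm_nonneg _).trans (hb 0)
  set G : (Fin N → EuclideanSpace ℝ (Fin d)) → Fin N → EuclideanSpace ℝ (Fin d) :=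
    fun Y i => particleForce k Y (Y i)
  have havg : ∀ {f : Fin N → EuclideanSpace ℝ (Fin d)} {C : ℝ}, 0 ≤ C → (∀ j, ‖f j‖ ≤ C) →
      ‖(N : ℝ)⁻¹ • ∑ j, f j‖ ≤ C := by
    intro f C hC hf
    rw [norm_smul, Real.norm_of_nonneg (by positivity)]
    have h1 : ‖∑ j, f j‖ ≤ N * C := by
      refine (norm_sum_le_of_le _ fun j _ => hf j).trans (le_of_eq ?_)
      simp
    calc (N : ℝ)⁻¹ * ‖∑ j, f j‖ ≤ (N : ℝ)⁻¹ * (N * C) := by gcongr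
      _ = ((N : ℝ)⁻¹ * N) * C := by ring
      _ ≤ 1 * C := by gcongr; exact inv_mul_le_one
      _ = C := one_mul C
  have hGb : ∀ Y, ‖G Y‖ ≤ b :=
    fun Y => (pi_norm_le_iff_of_nonneg hb0).2 fun i => havg hb0 fun j => hb _
  have hGlip : ∀ Y Y', ‖G Y - G Y'‖ ≤ 2 * L * ‖Y - Y'‖ := by
    intro Y Y'
    refine (pi_norm_le_iff_of_nonneg (by positivity)).2 fun i => ?_
    simp only [G, Pi.sub_apply, particleForce]
    rw [← smul_sub, ← Finset.sum_sub_distrib]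
    refine havg (by positivity) fun j => ?_
    have h1 := hk.norm_sub_le (Y i - Y j) (Y' i - Y' j)
    have h2 : ‖Y i - Y j - (Y' i - Y' j)‖ ≤ ‖Y - Y'‖ + ‖Y - Y'‖ := by
      rw [sub_sub_sub_comm]
      exact (norm_sub_le _ _).trans
        (add_le_add (norm_le_pi_norm (Y - Y') i) (norm_le_pi_norm (Y - Y') j))
    calc _ ≤ L * ‖Y i - Y j - (Y' i - Y' j)‖ := h1
      _ ≤ L * (‖Y - Y'‖ + ‖Y - Y'‖) := by gcongr
      _ = _ := by ring
  have hGc : Continuous G := by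
    have : LipschitzWith (2 * L) G := LipschitzWith.of_dist_le_mul fun Y Y' => by
      rw [dist_eq_norm, dist_eq_norm]; exact hGlip Y Y'
    exact this.continuous
  set pos : ℝ → (Fin N → EuclideanSpace ℝ (Fin d)) × (Fin N → EuclideanSpace ℝ (Fin d)) →
      Fin N → EuclideanSpace ℝ (Fin d) := fun t z => z.1 - lam⁻¹ • Real.exp (-(lam * t)) • z.2
  set u : ℝ → (Fin N → EuclideanSpace ℝ (Fin d)) × (Fin N → EuclideanSpace ℝ (Fin d)) →
      (Fin N → EuclideanSpace ℝ (Fin d)) × (Fin N → EuclideanSpace ℝ (Fin d)) :=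
    fun t z => (G (pos t z), (lam * Real.exp (lam * t)) • G (pos t z))
  set m : ℝ := 1 + lam * Real.exp (lam * T)
  have hm1 : 1 ≤ m := by simp only [m]; linarith [mul_pos hlam (Real.exp_pos (lam * T))]
  have hsmul : ∀ t ∈ Set.Icc 0 T, ∀ Y : Fin N → EuclideanSpace ℝ (Fin d),
      ‖(Y, (lam * Real.exp (lam * t)) • Y)‖ ≤ m * ‖Y‖ := by
    intro t ht Y
    refine norm_prod_le_iff.2 ⟨le_mul_of_one_le_left (norm_nonneg _) hm1, ?_⟩
    rw [norm_smul, Real.norm_of_nonneg (by positivity)]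
    refine mul_le_mul_of_nonneg_right ?_ (norm_nonneg _)
    have : lam * Real.exp (lam * t) ≤ lam * Real.exp (lam * T) := by
      gcongr
      exact ht.2
    simp only [m]; linarith
  have hpos : ∀ t ∈ Set.Icc 0 T, ∀ z z', ‖pos t z - pos t z'‖ ≤ (1 + lam⁻¹) * ‖z - z'‖ := by
    intro t ht z z'
    have h1 : pos t z - pos t z' = (z - z').1 - lam⁻¹ • Real.exp (-(lam * t)) • (z - z').2 := by
      simp only [pos, Prod.fst_sub, Prod.snd_sub, smul_sub]; abel
    rw [h1]
    refine (norm_sub_le _ _).trans ?_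
    rw [norm_smul, norm_smul, Real.norm_of_nonneg (by positivity),
      Real.norm_of_nonneg (Real.exp_pos _).le, add_mul, one_mul]
    have h2 : Real.exp (-(lam * t)) ≤ 1 :=
      Real.exp_le_one_iff.2 (neg_nonpos.2 (mul_nonneg hlam.le ht.1))
    refine add_le_add (norm_fst_le _) (mul_le_mul_of_nonneg_left ?_ (by positivity))
    calc _ ≤ 1 * ‖z - z'‖ := by gcongr; exact norm_snd_le _
      _ = _ := one_mul _
  have hu : IsLipschitzField T (m * (2 * L * (1 + lam⁻¹))) (m * b) u :=
    { lipschitz_nonneg := by positivity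
      bound_nonneg := by positivity
      continuousOn := fun z => by
        have : Continuous fun t => G (pos t z) := hGc.comp (by fun_prop)
        exact Continuous.continuousOn (by fun_prop)
      norm_sub_le := fun t ht z z' => by
        have h1 : u t z - u t z' = (G (pos t z) - G (pos t z'),
            (lam * Real.exp (lam * t)) • (G (pos t z) - G (pos t z'))) := by
          simp only [u, Prod.mk_sub_mk, smul_sub]
        rw [h1, mul_assoc]
        refine (hsmul t ht _).trans (mul_le_mul_of_nonneg_left ?_ (by linarith))
        refine (hGlip _ _).trans ?_
        rw [mul_assoc (2 * (L : ℝ))]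
        exact mul_le_mul_of_nonneg_left (hpos t ht z z') (by positivity)
      norm_le := fun t ht z =>
        (hsmul t ht _).trans (mul_le_mul_of_nonneg_left (hGb _) (by linarith)) }
  obtain ⟨Φ, hΦ⟩ := hu.exists_isFlow hT
  set z₀ : (Fin N → EuclideanSpace ℝ (Fin d)) × (Fin N → EuclideanSpace ℝ (Fin d)) :=
    (X₀ + lam⁻¹ • V₀, V₀)
  set A : ℝ → Fin N → EuclideanSpace ℝ (Fin d) := fun t => (Φ t z₀).1
  set V : ℝ → Fin N → EuclideanSpace ℝ (Fin d) := fun t => Real.exp (-(lam * t)) • (Φ t z₀).2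
  set X : ℝ → Fin N → EuclideanSpace ℝ (Fin d) := fun t => pos t (Φ t z₀)
  have hA : ∀ t ∈ Set.Icc 0 T, HasDerivWithinAt A (G (X t)) (Set.Icc 0 T) t := fun t ht =>
    (ContinuousLinearMap.fst ℝ (Fin N → EuclideanSpace ℝ (Fin d))
      (Fin N → EuclideanSpace ℝ (Fin d))).hasFDerivAt.comp_hasDerivWithinAt t (hΦ.hasDeriv z₀ t ht)
  have hV : ∀ t ∈ Set.Icc 0 T, HasDerivWithinAt V (lam • (-V t + G (X t))) (Set.Icc 0 T) t := by
    intro t ht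
    have h1 : HasDerivWithinAt (fun t => (Φ t z₀).2) ((lam * Real.exp (lam * t)) • G (X t))
        (Set.Icc 0 T) t :=
      (ContinuousLinearMap.snd ℝ (Fin N → EuclideanSpace ℝ (Fin d))
        (Fin N → EuclideanSpace ℝ (Fin d))).hasFDerivAt.comp_hasDerivWithinAt t
        (hΦ.hasDeriv z₀ t ht)
    have h2 : HasDerivAt (fun t => Real.exp (-(lam * t))) (Real.exp (-(lam * t)) * -lam) t := by
      simpa using ((hasDerivAt_id t).const_mul lam).neg.exp
    refine (h2.hasDerivWithinAt.smul h1).congr_deriv ?_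
    have h3 : Real.exp (-(lam * t)) * (lam * Real.exp (lam * t)) = lam := by
      rw [mul_left_comm, ← Real.exp_add, neg_add_cancel, Real.exp_zero, mul_one]
    simp only [V]
    rw [smul_smul, h3, smul_add, smul_neg, smul_smul, mul_neg, neg_smul, mul_comm (Real.exp _) lam, add_comm]
  have hX : ∀ t ∈ Set.Icc 0 T, HasDerivWithinAt X (V t) (Set.Icc 0 T) t := by
    intro t ht
    refine ((hA t ht).sub ((hV t ht).const_smul lam⁻¹)).congr_deriv ?_
    rw [smul_smul, inv_mul_cancel₀ hlam.ne', one_smul]; abel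
  refine ⟨X, V, ⟨fun t ht i => hasDerivWithinAt_pi.1 (hX t ht) i,
    fun t ht i => hasDerivWithinAt_pi.1 (hV t ht) i⟩, ?_, ?_⟩
  · simp [X, pos, hΦ.initial, z₀]
  · simp [V, hΦ.initial, z₀]

end Trajectory

/-! ### Stability of the mean-field limit -/

section Stability

variable {d N : ℕ} {α c C₁ S lam T ε C_V : ℝ} {p : ℝ≥0∞}
  {k : EuclideanSpace ℝ (Fin d) → EuclideanSpace ℝ (Fin d)}
  {ρ : ℝ → Measure (EuclideanSpace ℝ (Fin d))}
  {Φ : ℝ → EuclideanSpace ℝ (Fin d) → EuclideanSpace ℝ (Fin d)}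
  {X V : ℝ → Fin N → EuclideanSpace ℝ (Fin d)}
  {Γ : Measure (Fin N × EuclideanSpace ℝ (Fin d))}

/-- The measures `ρ t` are transported by the flow `Φ` of their own mean-field velocity, and their
potentials are bounded by `C₁`. -/
structure IsMeanFieldFlow (α C₁ T : ℝ) (k : EuclideanSpace ℝ (Fin d) → EuclideanSpace ℝ (Fin d))
    (ρ : ℝ → Measure (EuclideanSpace ℝ (Fin d)))
    (Φ : ℝ → EuclideanSpace ℝ (Fin d) → EuclideanSpace ℝ (Fin d)) : Prop where
  isProbabilityMeasure : ∀ t ∈ Set.Icc 0 T, IsProbabilityMeasure (ρ t)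
  weightBound : ∀ t ∈ Set.Icc 0 T, WeightBound α C₁ (ρ t)
  isFlow : IsFlow T (fun t => meanVelocity k (ρ t)) Φ
  measurable : ∀ t ∈ Set.Icc 0 T, Measurable (Φ t)
  map_eq : ∀ t ∈ Set.Icc 0 T, ρ t = (ρ 0).map (Φ t)

lemma IsMeanFieldFlow.mono {T₁ : ℝ} (h : IsMeanFieldFlow α C₁ T k ρ Φ) (hT : T₁ ≤ T) :
    IsMeanFieldFlow α C₁ T₁ k ρ Φ where
  isProbabilityMeasure t ht := h.isProbabilityMeasure t ⟨ht.1, ht.2.trans hT⟩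
  weightBound t ht := h.weightBound t ⟨ht.1, ht.2.trans hT⟩
  isFlow := h.isFlow.mono hT
  measurable t ht := h.measurable t ⟨ht.1, ht.2.trans hT⟩
  map_eq t ht := h.map_eq t ⟨ht.1, ht.2.trans hT⟩

/-- The coupling `Γ` at time `0`, transported by the flow. -/
lemma IsMeanFieldFlow.isLabelCoupling (h : IsMeanFieldFlow α C₁ T k ρ Φ)
    (hΓ : IsLabelCoupling Γ (ρ 0)) {t : ℝ} (ht : t ∈ Set.Icc 0 T) :
    IsLabelCoupling (Γ.map fun z => (z.1, Φ t z.2)) (ρ t) := by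
  rw [h.map_eq t ht]
  exact hΓ.map (h.measurable t ht)

lemma IsMeanFieldFlow.eLpNorm_map (h : IsMeanFieldFlow α C₁ T k ρ Φ) {t : ℝ}
    (ht : t ∈ Set.Icc 0 T) {f : Fin N × EuclideanSpace ℝ (Fin d) → EuclideanSpace ℝ (Fin d)}
    (hf : Measurable f) :
    eLpNorm f p (Γ.map fun z => (z.1, Φ t z.2)) = eLpNorm (fun z => f (z.1, Φ t z.2)) p Γ :=
  eLpNorm_map_measure hf.aestronglyMeasurable
    (measurable_fst.prodMk ((h.measurable t ht).comp measurable_snd)).aemeasurable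

lemma measurable_label_sub (Y : Fin N → EuclideanSpace ℝ (Fin d)) :
    Measurable fun z : Fin N × EuclideanSpace ℝ (Fin d) => Y z.1 - z.2 :=
  ((measurable_of_finite Y).comp measurable_fst).sub measurable_snd

lemma gronwallBound_mul_add_le {δ K b t : ℝ} :
    gronwallBound δ K (K * b) t + b = (δ + b) * Real.exp (K * t) := by
  rcases eq_or_ne K 0 with rfl | hK
  · simp [gronwallBound_K0]
  · rw [gronwallBound_of_K_ne_0 hK]
    field_simp
    ring

lemma eLpNorm_le_add_of_norm_le {Z F : Type*} [MeasurableSpace Z] [NormedAddCommGroup F]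
    {μ : Measure Z} {f g h : Z → F} (hp : 1 ≤ p) (hg : AEStronglyMeasurable g μ)
    (hh : AEStronglyMeasurable h μ) (hfgh : ∀ z, ‖f z‖ ≤ ‖g z‖ + ‖h z‖) :
    eLpNorm f p μ ≤ eLpNorm g p μ + eLpNorm h p μ := by
  have h1 : eLpNorm f p μ ≤ eLpNorm ((fun z => ‖g z‖) + fun z => ‖h z‖) p μ :=
    eLpNorm_mono_real hfgh
  have h2 := eLpNorm_add_le hg.norm hh.norm hp
  rw [eLpNorm_norm, eLpNorm_norm] at h2
  exact h1.trans h2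

lemma eLpNorm_vel_le [IsProbabilityMeasure Γ] (hp : 1 ≤ p) {B : ℝ} (hB : 0 ≤ B) (hlam : 0 < lam)
    (hlamε : lam⁻¹ ≤ ε) {v v₀ : Fin N → EuclideanSpace ℝ (Fin d)} (hCV : 0 ≤ C_V)
    (hv₀ : eLpNorm (fun z => v₀ z.1) p Γ ≤ ENNReal.ofReal C_V) (h : ∀ i, ‖v i‖ ≤ ‖v₀ i‖ + B) :
    eLpNorm (fun z : Fin N × EuclideanSpace ℝ (Fin d) => lam⁻¹ • v z.1) p Γ
      ≤ ENNReal.ofReal (ε * (C_V + B)) := by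
  have hm : Measurable fun z : Fin N × EuclideanSpace ℝ (Fin d) => ‖v₀ z.1‖ :=
    ((measurable_of_finite v₀).comp measurable_fst).norm
  have h1 : eLpNorm (fun z : Fin N × EuclideanSpace ℝ (Fin d) => v z.1) p Γ
      ≤ ENNReal.ofReal (C_V + B) := by
    have h2 : eLpNorm (fun z : Fin N × EuclideanSpace ℝ (Fin d) => v z.1) p Γ
        ≤ eLpNorm ((fun z : Fin N × EuclideanSpace ℝ (Fin d) => ‖v₀ z.1‖) + fun _ => B) p Γ :=
      eLpNorm_mono_real fun z => h z.1
    have h3 : eLpNorm (fun _ : Fin N × EuclideanSpace ℝ (Fin d) => B) p Γ ≤ ENNReal.ofReal B := by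
      have := eLpNorm_le_of_ae_bound (μ := Γ) (p := p)
        (f := fun _ : Fin N × EuclideanSpace ℝ (Fin d) => B) (C := B)
        (ae_of_all _ fun z => (Real.norm_of_nonneg hB).le)
      rwa [measure_univ, ENNReal.one_rpow, one_mul] at this
    have h4 := eLpNorm_norm (μ := Γ) (p := p)
      fun z : Fin N × EuclideanSpace ℝ (Fin d) => v₀ z.1
    refine h2.trans ((eLpNorm_add_le hm.aestronglyMeasurable aestronglyMeasurable_const hp).trans ?_)
    rw [h4, ENNReal.ofReal_add hCV hB]
    exact add_le_add hv₀ h3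
  have h5 : eLpNorm (lam⁻¹ • fun z : Fin N × EuclideanSpace ℝ (Fin d) => v z.1) p Γ
      ≤ ‖lam⁻¹‖ₑ * eLpNorm (fun z : Fin N × EuclideanSpace ℝ (Fin d) => v z.1) p Γ :=
    eLpNorm_const_smul_le
  refine LE.le.trans h5 ?_
  rw [Real.enorm_eq_ofReal (by positivity), ENNReal.ofReal_mul ((inv_pos.2 hlam).le.trans hlamε)]
  exact mul_le_mul' (ENNReal.ofReal_le_ofReal hlamε) h1

/-- **Stability estimate.** As long as the kernel sums are at most `S`, the displacement in `L^p`
along a coupling grows at most exponentially. It is applied to the positions `X + V / lam`, whose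
derivative is the force. -/
theorem IsTrajectory.eLpNorm_displacement_le (hk : SingularKernel α c k) (hC₁ : 0 ≤ C₁) (hS0 : 0 ≤ S)
    (hM : IsMeanFieldFlow α C₁ T k ρ Φ) (h : IsTrajectory k lam T X V) (hN : 0 < N)
    (hlam : 0 < lam) (hS : ∀ t ∈ Set.Icc 0 T, ∀ i, (N : ℝ)⁻¹ * ∑ j, weight α (X t i - X t j) ≤ S)
    (hΓ : IsLabelCoupling Γ (ρ 0)) (hp : 1 ≤ p) (hlamε : lam⁻¹ ≤ ε) (hCV : 0 ≤ C_V)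
    (hX₀ : eLpNorm (fun z => X 0 z.1 - z.2) p Γ ≤ ENNReal.ofReal ε)
    (hV₀ : eLpNorm (fun z => V 0 z.1) p Γ ≤ ENNReal.ofReal C_V) :
    ∀ t ∈ Set.Icc 0 T, eLpNorm (fun z => X t z.1 - Φ t z.2) p Γ ≤
      ENNReal.ofReal ((1 + 2 * C_V + c * (1 + S)) * ε * Real.exp (2 * c * (S + C₁) * t)) := by
  intro t₁ ht₁
  have hc := hk.const_nonneg
  have hε : 0 < ε := (inv_pos.2 hlam).trans_le hlamε
  have h0T : (0 : ℝ) ∈ Set.Icc 0 T := ⟨le_rfl, ht₁.1.trans ht₁.2⟩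
  have := hM.isProbabilityMeasure 0 h0T
  have := hΓ.isProbabilityMeasure
  set B := c * (1 + S)
  have hB : 0 ≤ B := by positivity
  have hF : ∀ t ∈ Set.Icc 0 T, ∀ i, ‖particleForce k (X t) (X t i)‖ ≤ B :=
    fun t ht i => norm_particleForce_le hk hN (hS t ht i)
  have hVm : ∀ t, Measurable fun z : Fin N × EuclideanSpace ℝ (Fin d) => lam⁻¹ • V t z.1 :=
    fun t => (measurable_of_finite fun i => lam⁻¹ • V t i).comp measurable_fst
  have hXm : ∀ t ∈ Set.Icc 0 T,
      Measurable fun z : Fin N × EuclideanSpace ℝ (Fin d) => X t z.1 - Φ t z.2 := fun t ht =>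
    ((measurable_of_finite (X t)).comp measurable_fst).sub
      ((hM.measurable t ht).comp measurable_snd)
  -- for `p = ∞` the conclusion is obtained from the finite exponents
  have hfin : ∀ p : ℝ≥0∞, 1 ≤ p → p ≠ ⊤ →
      eLpNorm (fun z => X 0 z.1 - z.2) p Γ ≤ ENNReal.ofReal ε →
      eLpNorm (fun z => V 0 z.1) p Γ ≤ ENNReal.ofReal C_V →
      eLpNorm (fun z => X t₁ z.1 - Φ t₁ z.2) p Γ ≤
        ENNReal.ofReal ((1 + 2 * C_V + B) * ε * Real.exp (2 * c * (S + C₁) * t₁)) := by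
    intro p hp hp' hX₀ hV₀
    set b := ε * (C_V + B)
    have hb : 0 ≤ b := by positivity
    have hVt : ∀ t ∈ Set.Icc 0 T, eLpNorm (fun z : Fin N × EuclideanSpace ℝ (Fin d) =>
        lam⁻¹ • V t z.1) p Γ ≤ ENNReal.ofReal b := fun t ht =>
      eLpNorm_vel_le hp hB hlam hlamε hCV hV₀ (h.norm_vel_le hlam hB hF t ht)
    set H : ℝ → Fin N × EuclideanSpace ℝ (Fin d) → EuclideanSpace ℝ (Fin d) :=
      fun t z => X t z.1 + lam⁻¹ • V t z.1 - Φ t z.2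
    have hHm : ∀ t ∈ Set.Icc 0 T, Measurable (H t) := fun t ht =>
      ((measurable_of_finite fun i => X t i + lam⁻¹ • V t i).comp measurable_fst).sub
        ((hM.measurable t ht).comp measurable_snd)
    have hXH : ∀ t ∈ Set.Icc 0 T, eLpNorm (fun z => X t z.1 - Φ t z.2) p Γ ≤
        eLpNorm (H t) p Γ
          + eLpNorm (fun z : Fin N × EuclideanSpace ℝ (Fin d) => lam⁻¹ • V t z.1) p Γ := by
      intro t ht
      refine eLpNorm_le_add_of_norm_le hp (hHm t ht).aestronglyMeasurable
        (hVm t).aestronglyMeasurable fun z => ?_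
      have := norm_sub_le (H t z) (lam⁻¹ • V t z.1)
      rwa [show H t z - lam⁻¹ • V t z.1 = X t z.1 - Φ t z.2 by simp only [H]; abel] at this
    have hgron := eLpNorm_le_gronwallBound (Γ := Γ) (T := T) (B := B + c * (1 + C₁))
      (δ := ε * (1 + C_V)) (L := 2 * c * (S + C₁)) (b := 2 * c * (S + C₁) * b) hp hp'
      (H := H)
      (G := fun t z => particleForce k (X t) (X t z.1) - meanVelocity k (ρ t) (Φ t z.2))
      (by positivity) (by positivity) (by positivity) (by positivity) hHm
      (fun t ht z => ?_) (fun t ht z => ?_) ?_ (fun t ht => ?_) t₁ ht₁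
    · refine LE.le.trans (hXH t₁ ht₁) ((add_le_add hgron (hVt t₁ ht₁)).trans ?_)
      rw [← ENNReal.ofReal_add _ hb, gronwallBound_mul_add_le]
      · refine ENNReal.ofReal_le_ofReal (le_of_eq ?_)
        simp only [b]; ring
      · refine le_trans ?_ (gronwallBound_mono ?_ ?_ ?_ ht₁.1)
        · rw [gronwallBound_x0]; positivity
        all_goals positivity
    · refine (((h.deriv_pos t ht z.1).add ((h.deriv_vel t ht z.1).const_smul lam⁻¹)).sub
        (hM.isFlow.hasDeriv z.2 t ht)).congr_deriv ?_
      rw [smul_smul, inv_mul_cancel₀ hlam.ne', one_smul]; abel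
    · have := hM.isProbabilityMeasure t ht
      exact (norm_sub_le _ _).trans (add_le_add (hF t ht z.1)
        ((hM.weightBound t ht).norm_meanVelocity_le hC₁ hk _))
    · have h1 : eLpNorm (H 0) p Γ ≤ eLpNorm (fun z => X 0 z.1 - z.2) p Γ
          + eLpNorm (fun z : Fin N × EuclideanSpace ℝ (Fin d) => lam⁻¹ • V 0 z.1) p Γ := by
        refine eLpNorm_le_add_of_norm_le hp (measurable_label_sub (X 0)).aestronglyMeasurable
          (hVm 0).aestronglyMeasurable fun z => ?_
        have := norm_add_le (X 0 z.1 - z.2) (lam⁻¹ • V 0 z.1)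
        rwa [show X 0 z.1 - z.2 + lam⁻¹ • V 0 z.1 = H 0 z by
          simp only [H, hM.isFlow.initial]; abel] at this
      refine h1.trans ?_
      rw [mul_add, mul_one, ENNReal.ofReal_add hε.le (by positivity)]
      refine add_le_add hX₀ ?_
      have := eLpNorm_vel_le hp le_rfl hlam hlamε hCV hV₀ (v := V 0) (fun i => by simp)
      rwa [add_zero] at this
    · have := hM.isProbabilityMeasure t ht
      have hgm : Measurable fun z : Fin N × EuclideanSpace ℝ (Fin d) =>
          particleForce k (X t) (X t z.1) - meanVelocity k (ρ t) z.2 :=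
        ((measurable_of_finite fun i => particleForce k (X t) (X t i)).comp measurable_fst).sub
          (((hM.weightBound t ht).lipschitzWith_meanVelocity hC₁ hk).continuous.measurable.comp
            measurable_snd)
      have h1 := (hM.isLabelCoupling hΓ ht).eLpNorm_particleForce_sub_le hk hC₁
        (hM.weightBound t ht) hN hS0 (hS t ht) hp hp'
      rw [hM.eLpNorm_map ht hgm, hM.eLpNorm_map ht (measurable_label_sub (X t))] at h1
      refine h1.trans ?_
      rw [ENNReal.ofReal_mul (by positivity : 0 ≤ 2 * c * (S + C₁)), ← mul_add]
      refine mul_le_mul' le_rfl ?_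
      exact LE.le.trans (hXH t ht) (add_le_add le_rfl (hVt t ht))
  rcases eq_or_ne p ⊤ with rfl | hp'
  · refine eLpNorm_top_le_of_forall (hXm t₁ ht₁).aestronglyMeasurable fun q hq hq' =>
      hfin q hq hq' (le_trans ?_ hX₀) (le_trans ?_ hV₀)
    · exact eLpNorm_le_eLpNorm_of_exponent_le le_top
        (measurable_label_sub (X 0)).aestronglyMeasurable
    · exact eLpNorm_le_eLpNorm_of_exponent_le le_top
        ((measurable_of_finite (V 0)).comp measurable_fst).aestronglyMeasurable
  · exact hfin p hp hp' hX₀ hV₀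

/-- Well-prepared particle systems: the friction is large, the initial displacement along `Γ` is at
most `ε`, the initial velocities are bounded and Lipschitz in the positions, and for all
configurations that the a priori estimates allow up to time `T` the kernel sums are at most
`S - 1`. -/
structure IsWellPrepared (α c C₁ S lam T ε C_V δ₀ : ℝ) (p : ℝ≥0∞)
    (ρ₀ : Measure (EuclideanSpace ℝ (Fin d)))
    (Φ : ℝ → EuclideanSpace ℝ (Fin d) → EuclideanSpace ℝ (Fin d))
    (Γ : Measure (Fin N × EuclideanSpace ℝ (Fin d)))
    (X₀ V₀ : Fin N → EuclideanSpace ℝ (Fin d)) : Prop where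
  card_pos : 0 < N
  lam_pos : 0 < lam
  lt_lam : 4 * (2 * c * S) < lam
  inv_lam_le : lam⁻¹ ≤ ε
  vel_nonneg : 0 ≤ C_V
  sep_pos : 0 < δ₀
  isLabelCoupling : IsLabelCoupling Γ ρ₀
  eLpNorm_pos_le : eLpNorm (fun z => X₀ z.1 - z.2) p Γ ≤ ENNReal.ofReal ε
  eLpNorm_vel_le : eLpNorm (fun z => V₀ z.1) p Γ ≤ ENNReal.ofReal C_V
  norm_vel_sub_le : ∀ i j, ‖V₀ i - V₀ j‖ ≤ lam / 2 * ‖X₀ i - X₀ j‖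
  le_norm_sub : ∀ i j, i ≠ j → δ₀ ≤ ‖X₀ i - X₀ j‖
  sum_weight_le : ∀ t ∈ Set.Icc 0 T, ∀ Y : Fin N → EuclideanSpace ℝ (Fin d),
    (∀ i j, i ≠ j → Real.exp (-(2 * (2 * c * S) * T)) / 3 * δ₀ ≤ ‖Y i - Y j‖) →
    eLpNorm (fun z => Y z.1 - Φ t z.2) p Γ ≤ ENNReal.ofReal
      ((1 + 2 * C_V + c * (1 + S)) * ε * Real.exp (2 * c * (S + C₁) * T)) →
    ∀ i, (N : ℝ)⁻¹ * ∑ j, weight α (Y i - Y j) ≤ S - 1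

namespace IsWellPrepared

variable {δ₀ T₁ : ℝ} {X₀ V₀ : Fin N → EuclideanSpace ℝ (Fin d)}

lemma sep_le_of_sum_weight_le (hk : SingularKernel α c k) (hS0 : 0 ≤ S)
    (hW : IsWellPrepared α c C₁ S lam T ε C_V δ₀ p (ρ 0) Φ Γ (X 0) (V 0))
    (h : IsTrajectory k lam T₁ X V) (hT : T₁ ≤ T)
    (hne : ∀ t ∈ Set.Icc 0 T₁, ∀ i j, i ≠ j → X t i ≠ X t j)
    (hS : ∀ t ∈ Set.Icc 0 T₁, ∀ i, (N : ℝ)⁻¹ * ∑ j, weight α (X t i - X t j) ≤ S) :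
    ∀ t ∈ Set.Icc 0 T₁, ∀ i j, i ≠ j →
      Real.exp (-(2 * (2 * c * S) * T)) / 3 * δ₀ ≤ ‖X t i - X t j‖ := by
  intro t ht i j hij
  have hc := hk.const_nonneg
  refine le_trans ?_ (h.norm_sub_ge (L := 2 * c * S) (by positivity) hW.lt_lam
    (fun s hs => hne s hs i j hij)
    (fun s hs => norm_particleForce_sub_le hk (hS s hs i) (hS s hs j))
    (hW.norm_vel_sub_le i j) t ht)
  have h1 : Real.exp (-(2 * (2 * c * S) * T)) ≤ Real.exp (-(2 * (2 * c * S) * t)) := by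
    refine Real.exp_le_exp.2 (neg_le_neg ?_)
    gcongr
    exact ht.2.trans hT
  have := hW.sep_pos
  gcongr
  exact hW.le_norm_sub i j hij

/-- **A priori bound.** The kernel sums of a well-prepared system stay below `S - 1`: a bound by `S`
gives the displacement and distance estimates, which improve it. -/
theorem sum_weight_le_of_isTrajectory (hk : SingularKernel α c k) (hC₁ : 0 ≤ C₁) (hS0 : 0 ≤ S)
    (hM : IsMeanFieldFlow α C₁ T k ρ Φ) (hp : 1 ≤ p)
    (hW : IsWellPrepared α c C₁ S lam T ε C_V δ₀ p (ρ 0) Φ Γ (X 0) (V 0))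
    (h : IsTrajectory k lam T₁ X V) (hT : T₁ ≤ T)
    (hne : ∀ t ∈ Set.Icc 0 T₁, ∀ i j, i ≠ j → X t i ≠ X t j) :
    ∀ t ∈ Set.Icc 0 T₁, ∀ i, (N : ℝ)⁻¹ * ∑ j, weight α (X t i - X t j) ≤ S - 1 := by
  intro t₁ ht₁
  have hc := hk.const_nonneg
  have hCV := hW.vel_nonneg
  have hδ := hW.sep_pos
  have hε : 0 < ε := (inv_pos.2 hW.lam_pos).trans_le hW.inv_lam_le
  have hT₁ : 0 ≤ T₁ := ht₁.1.trans ht₁.2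
  have hT0 : 0 ≤ T := hT₁.trans hT
  refine le_of_improving_bound (g := fun i t => (N : ℝ)⁻¹ * ∑ j, weight α (X t i - X t j))
    (b := S) (by linarith) (fun i => ?_) (fun i => ?_) (fun t ht hSt => ?_) t₁ ht₁
  · refine continuousOn_const.mul (continuousOn_finsetSum _ fun j _ => ?_)
    rcases eq_or_ne i j with rfl | hij
    · simp only [sub_self]; exact continuousOn_const
    · intro t ht
      have h1 : ContinuousWithinAt (fun t => X t i - X t j) (Set.Icc 0 T₁) t :=
        ((h.continuousOn_pos i).sub (h.continuousOn_pos j)) t ht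
      exact ContinuousAt.comp_continuousWithinAt (f := fun t => X t i - X t j)
        (continuousAt_weight (sub_ne_zero.2 (hne t ht i j hij))) h1
  · refine (hW.sum_weight_le 0 ⟨le_rfl, hT0⟩ (X 0) (fun i j hij => ?_) ?_ i).trans (by linarith)
    · refine le_trans (mul_le_of_le_one_left hδ.le ?_) (hW.le_norm_sub i j hij)
      have : Real.exp (-(2 * (2 * c * S) * T)) ≤ 1 :=
        Real.exp_le_one_iff.2 (neg_nonpos.2 (by positivity))
      linarith
    · simp only [hM.isFlow.initial]
      refine hW.eLpNorm_pos_le.trans (ENNReal.ofReal_le_ofReal ?_)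
      have h1 : 1 ≤ Real.exp (2 * c * (S + C₁) * T) := Real.one_le_exp (by positivity)
      have h2 : 1 ≤ 1 + 2 * C_V + c * (1 + S) := by
        have : 0 ≤ c * (1 + S) := by positivity
        linarith
      calc ε = 1 * ε * 1 := by ring
        _ ≤ _ := by gcongr
  · have htT : t ≤ T := ht.2.trans hT
    have ht0 : t ∈ Set.Icc 0 t := ⟨ht.1, le_rfl⟩
    have ht' := h.mono ht.2
    have hne' : ∀ s ∈ Set.Icc 0 t, ∀ i j, i ≠ j → X s i ≠ X s j :=
      fun s hs => hne s ⟨hs.1, hs.2.trans ht.2⟩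
    refine hW.sum_weight_le t ⟨ht.1, htT⟩ (X t)
      (hW.sep_le_of_sum_weight_le hk hS0 ht' htT hne' hSt t ht0) ?_
    refine (ht'.eLpNorm_displacement_le hk hC₁ hS0 (hM.mono htT) hW.card_pos hW.lam_pos hSt
      hW.isLabelCoupling hp hW.inv_lam_le hCV hW.eLpNorm_pos_le hW.eLpNorm_vel_le t ht0).trans
      (ENNReal.ofReal_le_ofReal ?_)
    gcongr

/-- Existence of collision-free trajectories: by the a priori distance bound, a trajectory for the
truncated kernel never enters the region where the kernel has been changed. -/
theorem exists_isTrajectory_ne (hk : SingularKernel α c k) (hC₁ : 0 ≤ C₁) (hS0 : 0 ≤ S)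
    (hT : 0 ≤ T) (hM : IsMeanFieldFlow α C₁ T k ρ Φ) (hp : 1 ≤ p)
    (hW : IsWellPrepared α c C₁ S lam T ε C_V δ₀ p (ρ 0) Φ Γ X₀ V₀) :
    ∃ X V : ℝ → Fin N → EuclideanSpace ℝ (Fin d), IsTrajectory k lam T X V ∧ X 0 = X₀ ∧ V 0 = V₀ ∧
      ∀ t ∈ Set.Icc 0 T, ∀ i j, i ≠ j → X t i ≠ X t j := by
  have hδ₀ := hW.sep_pos
  have hc := hk.const_nonneg
  set δ := Real.exp (-(2 * (2 * c * S) * T)) / 3 * δ₀ / 2 with hδdef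
  have hδ : 0 < δ := by positivity
  obtain ⟨L, hL⟩ := hk.exists_lipschitzWith_truncate hδ
  obtain ⟨X, V, h, hX, hV⟩ := exists_isTrajectory hL (hk.norm_truncate_le_const hδ) hW.lam_pos hT
    X₀ V₀
  subst hX hV
  have hmain : ∀ t ∈ Set.Icc 0 T, ∀ q : {q : Fin N × Fin N // q.1 ≠ q.2},
      -‖X t q.1.1 - X t q.1.2‖ ≤ -(2 * δ) := by
    refine le_of_improving_bound (g := fun (q : {q : Fin N × Fin N // q.1 ≠ q.2}) t =>
      -‖X t q.1.1 - X t q.1.2‖) (b := -δ) (by linarith) (fun q => ?_) (fun q => ?_)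
      fun t ht hs => ?_
    · exact ((h.continuousOn_pos _).sub (h.continuousOn_pos _)).norm.neg
    · have h1 := hW.le_norm_sub _ _ q.2
      have h2 : Real.exp (-(2 * (2 * c * S) * T)) ≤ 1 :=
        Real.exp_le_one_iff.2 (neg_nonpos.2 (by positivity))
      have h3 : δ ≤ δ₀ := by
        have := mul_le_mul_of_nonneg_right h2 hδ₀.le
        simp only [hδdef]; linarith
      linarith
    · have hsep : ∀ s ∈ Set.Icc 0 t, ∀ i j, i ≠ j → δ ≤ ‖X s i - X s j‖ :=
        fun s hst i j hij => neg_le_neg_iff.1 (hs s hst ⟨(i, j), hij⟩)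
      have hne : ∀ s ∈ Set.Icc 0 t, ∀ i j, i ≠ j → X s i ≠ X s j := fun s hst i j hij =>
        sub_ne_zero.1 (norm_pos_iff.1 (hδ.trans_le (hsep s hst i j hij)))
      have ht' := (h.mono ht.2).of_truncate hδ hk.map_zero hsep
      intro q
      refine neg_le_neg ?_
      have := hW.sep_le_of_sum_weight_le hk hS0 ht' ht.2 hne (fun s hst i =>
        (hW.sum_weight_le_of_isTrajectory hk hC₁ hS0 hM hp ht' ht.2 hne s hst i).trans
          (by linarith)) t ⟨ht.1, le_rfl⟩ _ _ q.2
      simp only [hδdef]; linarith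
  have hsep : ∀ t ∈ Set.Icc 0 T, ∀ i j, i ≠ j → 2 * δ ≤ ‖X t i - X t j‖ :=
    fun t ht i j hij => neg_le_neg_iff.1 (hmain t ht ⟨(i, j), hij⟩)
  refine ⟨X, V, h.of_truncate hδ hk.map_zero fun t ht i j hij => ?_, rfl, rfl,
    fun t ht i j hij => ?_⟩
  · linarith [hsep t ht i j hij]
  · refine sub_ne_zero.1 (norm_pos_iff.1 ?_)
    linarith [hsep t ht i j hij]

end IsWellPrepared

end Stability

/-! ### The smallness condition -/

section Smallness

/-- The two terms by which the kernel sums exceed the mean-field potential are small if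
`ε ^ θ (1 + 1 / x)` is, where `θ` is the rate exponent and `x = N ^ (1 / d) δ₀`. -/
lemma exists_rate_threshold {d : ℕ} {α A A₂ C : ℝ} {p q : ℝ≥0∞} (hα : 0 ≤ α) (hd : α + 1 < d)
    (hr : 0 < dualExponent q) (hrd : dualExponent q * (α + 1) < d) (hA : 0 < A) (hA₂ : 0 < A₂)
    (hC : 0 ≤ C) :
    ∃ κ > 0, ∀ ε x R : ℝ, 0 < ε → 0 < x → ε ^ rateExponent d α p q * (1 + 1 / x) ≤ κ →
      R = (2 * (A * ε)) ^ (dualExponent q / (dualExponent q + d * (p⁻¹).toReal)) →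
      R ^ ((d : ℝ) / dualExponent q - (α + 1)) + C * (R ^ ((d : ℝ) / dualExponent q)) ^
        (1 - (α + 1) / d) * (A₂ * x) ^ (-(α + 1)) ≤ 1 := by
  set r := dualExponent q
  set s := (p⁻¹).toReal
  have hs : 0 ≤ s := ENNReal.toReal_nonneg
  have hd0 : (0 : ℝ) < d := by linarith
  have hθdef : rateExponent d α p q = (d - α - 1) / ((α + 1) * (d * s + r)) := rfl
  set θ := rateExponent d α p q
  have hθ : 0 < θ := by
    rw [hθdef]
    exact div_pos (by linarith) (by positivity)
  set e := r / (r + d * s)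
  have he : 0 < e := by positivity
  set ν := e * ((d : ℝ) / r - (α + 1)) / θ
  have hν : 0 < ν := by
    refine div_pos (mul_pos he ?_) hθ
    rw [sub_pos, lt_div_iff₀ hr]; linarith
  set a := (2 * A) ^ θ
  have ha : 0 < a := by positivity
  have hlim : Tendsto (fun κ : ℝ => (a * κ) ^ ν + C * (a * κ / A₂) ^ (α + 1)) (𝓝[>] 0) (𝓝 0) := by
    have hcont : Continuous fun κ : ℝ => (a * κ) ^ ν + C * (a * κ / A₂) ^ (α + 1) :=
      ((continuous_const.mul continuous_id).rpow_const fun _ => Or.inr hν.le).add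
        (continuous_const.mul (((continuous_const.mul continuous_id).div_const _).rpow_const
          fun _ => Or.inr (by linarith)))
    have := (hcont.tendsto 0).mono_left (nhdsWithin_le_nhds (s := Set.Ioi 0))
    rwa [mul_zero, zero_div, Real.zero_rpow hν.ne', Real.zero_rpow (by linarith), mul_zero,
      add_zero] at this
  obtain ⟨κ, hκ1, hκ⟩ := ((hlim.eventually (gt_mem_nhds one_pos)).and self_mem_nhdsWithin).exists
  have hκ0 : 0 < κ := hκ
  refine ⟨κ, hκ0, fun ε x R hε hx h hR => le_trans ?_ hκ1.le⟩
  have hy : ε ^ θ ≤ κ := by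
    refine le_trans (le_mul_of_one_le_right (by positivity) ?_) h
    have : 0 < 1 / x := by positivity
    linarith
  have hyx : ε ^ θ / x ≤ κ := by
    refine le_trans ?_ h
    rw [mul_add, mul_one_div, mul_one]
    have : 0 < ε ^ θ := by positivity
    linarith
  have hpow : (2 * (A * ε)) ^ θ = a * ε ^ θ := by
    rw [← mul_assoc, Real.mul_rpow (by positivity) hε.le]
  have h2 : 0 < 2 * (A * ε) := by positivity
  refine add_le_add ?_ ?_
  · have e1 : R ^ ((d : ℝ) / r - (α + 1)) = (a * ε ^ θ) ^ ν := by
      rw [hR, ← hpow, ← Real.rpow_mul h2.le, ← Real.rpow_mul h2.le]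
      congr 1
      simp only [ν]
      field_simp
    rw [e1]
    gcongr
  · have e2 : (R ^ ((d : ℝ) / r)) ^ (1 - (α + 1) / d) = (a * ε ^ θ) ^ (α + 1) := by
      rw [hR, ← hpow, ← Real.rpow_mul h2.le, ← Real.rpow_mul h2.le, ← Real.rpow_mul h2.le]
      congr 1
      rw [hθdef]
      simp only [e]
      have : r + d * s ≠ 0 := by positivity
      have : d * s + r ≠ 0 := by positivity
      field_simp
      ring
    rw [e2, Real.rpow_neg (by positivity), mul_assoc, ← div_eq_mul_inv,
      ← Real.div_rpow (by positivity) (by positivity)]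
    have e3 : a * ε ^ θ / (A₂ * x) ≤ a * κ / A₂ := by
      calc a * ε ^ θ / (A₂ * x) = a * (ε ^ θ / x) / A₂ := by field_simp
        _ ≤ _ := by gcongr
    gcongr

/-- Kernel sums exceed the mean-field bound by at most `1` in the regime of small rates. -/
theorem exists_sum_weight_threshold {d : ℕ} {α A A₂ C₁ Cb : ℝ} {p q : ℝ≥0∞} (hα : 0 ≤ α)
    (hd : α + 1 < d) (hp : 1 ≤ p) (hr : 0 < dualExponent q) (hrd : dualExponent q * (α + 1) < d)
    (hA : 0 < A) (hA₂ : 0 < A₂) (hC₁ : 0 ≤ C₁) (hCb : 0 ≤ Cb) :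
    ∃ κ > 0, ∀ {N : ℕ} (Γ : Measure (Fin N × EuclideanSpace ℝ (Fin d)))
      (μ : Measure (EuclideanSpace ℝ (Fin d))) (Y : Fin N → EuclideanSpace ℝ (Fin d)) (ε δ₀ : ℝ),
      0 < N → IsLabelCoupling Γ μ → μ ≪ volume → WeightBound α C₁ μ →
      (∀ x, ∀ s > 0, μ (Metric.ball x s) ≤ ENNReal.ofReal (Cb * s ^ ((d : ℝ) / dualExponent q))) →
      0 < ε → 0 < δ₀ → (∀ i j, i ≠ j → A₂ * δ₀ ≤ ‖Y i - Y j‖) →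
      eLpNorm (fun z => Y z.1 - z.2) p Γ ≤ ENNReal.ofReal (A * ε) →
      ε ^ rateExponent d α p q * (1 + 1 / ((N : ℝ) ^ (1 / (d : ℝ)) * δ₀)) ≤ κ →
      ∀ i, (N : ℝ)⁻¹ * ∑ j, weight α (Y i - Y j) ≤ (3 / 2 : ℝ) ^ (α + 1) * C₁ + 1 := by
  have hd0 : 0 < d := by
    have : (0 : ℝ) < d := by linarith
    exact_mod_cast this
  have : Nonempty (Fin d) := ⟨⟨0, hd0⟩⟩
  obtain ⟨C, hC, hsum⟩ := exists_average_weight_le (E := EuclideanSpace ℝ (Fin d))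
    (r := dualExponent q) hα hC₁ hCb (by simpa using hd)
  obtain ⟨κ, hκ, hthr⟩ := exists_rate_threshold (p := p) hα hd hr hrd hA hA₂ hC
  refine ⟨κ, hκ, fun {N} Γ μ Y ε δ₀ hN hΓ hac hw hball hε hδ₀ hsep hcost hrate i => ?_⟩
  have hN' : (0 : ℝ) < N := by exact_mod_cast hN
  rw [finrank_euclideanSpace_fin] at hsum
  set R := (2 * (A * ε)) ^ (dualExponent q / (dualExponent q + d * (p⁻¹).toReal)) with hR
  have h1 := hsum Γ μ Y R (A₂ * δ₀) hN hΓ hac hw hball (by positivity) (by positivity) hsep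
    (measure_half_lt_norm_le (measurable_label_sub Y).aestronglyMeasurable hp (by positivity) hr
      (Nat.cast_nonneg d) hcost) i
  have h2 := hthr ε ((N : ℝ) ^ (1 / (d : ℝ)) * δ₀) R hε (by positivity) hrate hR
  rw [mul_left_comm] at h1
  linarith

lemma le_norm_sub_of_minDist {d N : ℕ} {X : Fin N → EuclideanSpace ℝ (Fin d)} {i j : Fin N}
    (h : i ≠ j) : (minDist X).toReal ≤ ‖X i - X j‖ := by
  refine ENNReal.toReal_le_of_le_ofReal (norm_nonneg _) ?_
  rw [← dist_eq_norm, ← edist_dist]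
  exact iInf_le_of_le i (iInf_le_of_le j (iInf_le _ h))

/-- What the smallness condition says about real numbers: the Wasserstein distance is finite, and
the minimal distance is positive. -/
theorem real_of_rate_lt {d N : ℕ} {X : Fin N → EuclideanSpace ℝ (Fin d)} {w : ℝ≥0∞} {l θ κ : ℝ}
    (hN : 2 ≤ N) (hl : 0 < l) (hθ : 0 < θ)
    (h : (w + ENNReal.ofReal (1 / l)) ^ θ * (1 + 1 / ((N : ℝ≥0∞) ^ (1 / (d : ℝ)) * minDist X))
      < ENNReal.ofReal κ) :
    w ≠ ⊤ ∧ 0 < (minDist X).toReal ∧ (w + ENNReal.ofReal (1 / l)).toReal ^ θ *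
      (1 + 1 / ((N : ℝ) ^ (1 / (d : ℝ)) * (minDist X).toReal)) ≤ κ := by
  set v := w + ENNReal.ofReal (1 / l) with hv
  have hv0 : v ≠ 0 := by
    have : 0 < ENNReal.ofReal (1 / l) := ENNReal.ofReal_pos.2 (by positivity)
    exact (this.trans_le le_add_self).ne'
  have hκ : 0 ≤ κ := by
    by_contra hκ
    rw [ENNReal.ofReal_of_nonpos (not_le.1 hκ).le] at h
    exact not_lt_bot h
  have hvθ : v ^ θ ≠ 0 := by simp [hv0, hθ.not_gt]
  have hvtop : v ≠ ⊤ := by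
    intro hvt
    have h1 : v ^ θ ≤ v ^ θ * (1 + 1 / ((N : ℝ≥0∞) ^ (1 / (d : ℝ)) * minDist X)) :=
      le_mul_of_one_le_right bot_le le_self_add
    rw [hvt, ENNReal.top_rpow_of_pos hθ] at h1
    rw [hvt, ENNReal.top_rpow_of_pos hθ] at h
    exact (h1.trans_lt h).not_ge le_top
  have hm0 : minDist X ≠ 0 := by
    intro hm
    rw [hm, mul_zero, one_div, ENNReal.inv_zero, add_top, ENNReal.mul_top hvθ] at h
    exact not_top_lt h
  have hmtop : minDist X ≠ ⊤ := by
    have h01 : (⟨0, by omega⟩ : Fin N) ≠ ⟨1, by omega⟩ := by simp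
    have h1 : minDist X ≤ edist (X ⟨0, by omega⟩) (X ⟨1, by omega⟩) :=
      iInf_le_of_le _ (iInf_le_of_le _ (iInf_le _ h01))
    exact (h1.trans_lt (edist_lt_top _ _)).ne
  have hN' : (0 : ℝ) < N := by positivity
  refine ⟨fun hw => hvtop (by simp [hv, hw]), ENNReal.toReal_pos hm0 hmtop, ?_⟩
  refine (ENNReal.ofReal_le_ofReal_iff hκ).1 (le_trans (le_of_eq ?_) h.le)
  have hm : 0 < (minDist X).toReal := ENNReal.toReal_pos hm0 hmtop
  have hNd : (N : ℝ≥0∞) ^ (1 / (d : ℝ)) = ENNReal.ofReal ((N : ℝ) ^ (1 / (d : ℝ))) := by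
    rw [← ENNReal.ofReal_rpow_of_pos hN', ENNReal.ofReal_natCast]
  rw [ENNReal.ofReal_mul (by positivity), ← ENNReal.ofReal_rpow_of_nonneg ENNReal.toReal_nonneg
    hθ.le, ENNReal.ofReal_toReal hvtop, ENNReal.ofReal_add zero_le_one (by positivity),
    ENNReal.ofReal_one, ENNReal.ofReal_div_of_pos (by positivity), ENNReal.ofReal_one,
    ENNReal.ofReal_mul (by positivity), ENNReal.ofReal_toReal hmtop, hNd]

lemma dualExponent_mul_lt {d : ℕ} {α : ℝ} {q : ℝ≥0∞} (hα : 0 ≤ α) (hd : α + 1 < d)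
    (hq : ENNReal.ofReal ((d : ℝ) / ((d : ℝ) - 1 - α)) < q) : dualExponent q * (α + 1) < d := by
  have hd1 : 0 < (d : ℝ) - 1 - α := by linarith
  have hd0 : (0 : ℝ) < d := by linarith
  have h1 : q⁻¹ < ENNReal.ofReal (((d : ℝ) - 1 - α) / d) := by
    rw [← inv_div, ENNReal.ofReal_inv_of_pos (by positivity)]
    exact ENNReal.inv_lt_inv.2 hq
  have h2 : (q⁻¹).toReal < ((d : ℝ) - 1 - α) / d :=
    (ENNReal.lt_ofReal_iff_toReal_lt h1.ne_top).1 h1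
  rw [lt_div_iff₀ hd0] at h2
  have h3 : (α + 1) / d < 1 - (q⁻¹).toReal := by
    rw [div_lt_iff₀ hd0]; linarith
  have h4 : 0 < (α + 1) / d := by positivity
  rw [dualExponent, inv_mul_lt_iff₀ (h4.trans h3)]
  rw [div_lt_iff₀ hd0] at h3
  exact h3

end Smallness

end MeanField

/-! ### Convergence of the particle system -/

theorem theorem2p3 (d : ℕ) (α : ℝ) (hα₀ : 0 ≤ α) (hα : α < (d : ℝ) - 1)
    (p : ℝ≥0∞) (hp : 1 ≤ p)
    (q : ℝ≥0∞) (hq : ENNReal.ofReal ((d : ℝ) / ((d : ℝ) - 1 - α)) < q)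
    (C_K M C_V : ℝ) :
    ∃ C : ℝ, 0 < C ∧
      ∀ (K : EuclideanSpace ℝ (Fin d) → EuclideanSpace ℝ (Fin d)),
      MeanField.IsKernel α C_K K →
      ∀ (ρ₀ : Measure (EuclideanSpace ℝ (Fin d))), IsProbabilityMeasure ρ₀ →
      MeanField.HasDensityBound q M ρ₀ →
      ∀ (lam : ℕ → ℝ), (∀ N, 0 < lam N) →
      ∀ (X₀ V₀ : (N : ℕ) → Fin N → EuclideanSpace ℝ (Fin d)),
      Tendsto (fun N : ℕ =>
        (MeanField.wasserstein p (MeanField.empiricalMeasure (X₀ N)) ρ₀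
            + ENNReal.ofReal (1 / lam N)) ^ MeanField.rateExponent d α p q
          * (1 + 1 / ((N : ℝ≥0∞) ^ (1 / (d : ℝ)) * MeanField.minDist (X₀ N))))
        atTop (𝓝 0) →
      (∀ N, ∀ i j : Fin N, ‖V₀ N i - V₀ N j‖ ≤ lam N / 2 * ‖X₀ N i - X₀ N j‖) →
      (∀ N : ℕ, ‖WithLp.toLp p (V₀ N)‖ ≤ C_V * (N : ℝ) ^ (p⁻¹).toReal) →
      ∀ T : ℝ, 0 ≤ T →
      ∀ ρ : ℝ → Measure (EuclideanSpace ℝ (Fin d)), MeanField.IsWeakSolution q K ρ₀ T ρ →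
      ∃ N₀ : ℕ, ∀ N ≥ N₀,
        (∃ X V : ℝ → Fin N → EuclideanSpace ℝ (Fin d),
          MeanField.IsParticleSolution K (lam N) (X₀ N) (V₀ N) T X V) ∧
        ∀ X V : ℝ → Fin N → EuclideanSpace ℝ (Fin d),
          MeanField.IsParticleSolution K (lam N) (X₀ N) (V₀ N) T X V →
          ∀ t ∈ Set.Icc 0 T,
            MeanField.wasserstein p (MeanField.empiricalMeasure (X t)) (ρ t) ≤
              ENNReal.ofReal C *
                (MeanField.wasserstein p (MeanField.empiricalMeasure (X₀ N)) ρ₀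
                  + ENNReal.ofReal (1 / lam N)) *
                ENNReal.ofReal (Real.exp (C * t)) := by
  have hd : α + 1 < d := by linarith
  have hd0 : (0 : ℝ) < d := by linarith
  have : Nonempty (Fin d) := ⟨⟨0, by exact_mod_cast hd0⟩⟩
  have hq1 : 1 < q := MeanField.one_lt_of_lt ((one_le_div (by linarith)).2 (by linarith)) hq
  have hr1 := MeanField.one_le_dualExponent hq1
  have hr0 : 0 < MeanField.dualExponent q := by linarith
  have hrd := MeanField.dualExponent_mul_lt hα₀ hd hq
  obtain ⟨C₁, hC₁, hweight⟩ := MeanField.exists_lintegral_weight_le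
    (E := EuclideanSpace ℝ (Fin d)) M hα₀ hr1 (by simpa using hrd)
  obtain ⟨Cb, hCb, hball⟩ := MeanField.exists_measure_ball_le
    (E := EuclideanSpace ℝ (Fin d)) M hr1
  rw [finrank_euclideanSpace_fin] at hball
  -- `c` is the constant of the kernel estimates; `S` exceeds the bound `(3 / 2) ^ (α + 1) * C₁` for
  -- the kernel sums by `2`, one unit for the excess and one for the continuity argument
  set c : ℝ := |C_K| * ((2 : ℝ) ^ (α + 1) + 4)
  have hc : 0 ≤ c := by positivity
  set S : ℝ := (3 / 2 : ℝ) ^ (α + 1) * C₁ + 2 with hSdef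
  have hS0 : 0 ≤ S := by positivity
  set D : ℝ := 1 + 2 * |C_V| + c * (1 + S)
  have hD : 1 ≤ D := by
    have : 0 ≤ 2 * |C_V| + c * (1 + S) := by positivity
    simp only [D]; linarith
  set G : ℝ := 2 * c * (S + C₁)
  refine ⟨max D G, by linarith [le_max_left D G], ?_⟩
  intro K hK ρ₀ hρ₀ hM lam hlam X₀ V₀ hlim hV₀sub hV₀ T hT ρ hρ
  -- the value of `K` at `0` enters neither the particle system nor the velocity
  have hk := hK.singularKernel hα₀
  obtain ⟨L, U, Φ, hu, hΦ, hmap⟩ := hρ.exists_flow hα₀ hd hq1 hrd hK hT hM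
  have hMF : MeanField.IsMeanFieldFlow α C₁ T (MeanField.puncture K) ρ Φ :=
    { isProbabilityMeasure := hρ.isProbabilityMeasure
      weightBound := fun t ht => hweight _ (hρ.isProbabilityMeasure t ht) (hmap t ht).2
      isFlow := hΦ
      measurable := fun t ht => (hΦ.continuous hu ht).measurable
      map_eq := fun t ht => by rw [hρ.initial]; exact (hmap t ht).1 }
  set θ := MeanField.rateExponent d α p q
  have hθ : 0 < θ := div_pos (by linarith) (by positivity)
  obtain ⟨κ, hκ, hsum⟩ := MeanField.exists_sum_weight_threshold (p := p)
    (A := D * Real.exp (G * T)) (A₂ := Real.exp (-(2 * (2 * c * S) * T)) / 3)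
    hα₀ hd hp hr0 hrd (by positivity) (by positivity) hC₁ hCb
  -- the second constraint on the rate makes the friction large
  set e₁ : ℝ := 1 / (4 * (2 * c * S) + 1)
  have he₁ : 0 < e₁ := by positivity
  set κ₁ := min κ (e₁ ^ θ)
  have hκ₁ : 0 < κ₁ := lt_min hκ (by positivity)
  obtain ⟨N₁, hN₁⟩ := eventually_atTop.1
    (hlim.eventually (gt_mem_nhds (ENNReal.ofReal_pos.2 hκ₁)))
  -- with two particles the minimal distance is finite
  refine ⟨max N₁ 2, fun N hN => ?_⟩
  have hN2 : 2 ≤ N := (le_max_right _ _).trans hN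
  have hN0 : 0 < N := by omega
  obtain ⟨hw, hδ₀, hrate⟩ := MeanField.real_of_rate_lt hN2 (hlam N) hθ
    (hN₁ N ((le_max_left _ _).trans hN))
  set w := MeanField.wasserstein p (MeanField.empiricalMeasure (X₀ N)) ρ₀
  set v := w + ENNReal.ofReal (1 / lam N) with hv
  set δ₀ := (MeanField.minDist (X₀ N)).toReal
  have hvtop : v ≠ ⊤ := ENNReal.add_ne_top.2 ⟨hw, ENNReal.ofReal_ne_top⟩
  have hlamv : (lam N)⁻¹ ≤ v.toReal := by
    rw [← ENNReal.ofReal_le_iff_le_toReal hvtop, hv, one_div]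
    exact le_add_self
  have hε : 0 < v.toReal := (inv_pos.2 (hlam N)).trans_le hlamv
  have hεθ : v.toReal ^ θ ≤ κ₁ := by
    refine le_trans (le_mul_of_one_le_right (by positivity) ?_) hrate
    have : 0 ≤ 1 / ((N : ℝ) ^ (1 / (d : ℝ)) * δ₀) := by positivity
    linarith
  have hεe : v.toReal ≤ e₁ :=
    (Real.rpow_le_rpow_iff hε.le he₁.le hθ).1 (hεθ.trans (min_le_right _ _))
  have hsep : ∀ i j : Fin N, i ≠ j → δ₀ ≤ ‖X₀ N i - X₀ N j‖ :=
    fun i j hij => MeanField.le_norm_sub_of_minDist hij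
  have hinj : Function.Injective (X₀ N) := fun i j hij => by
    by_contra hne
    have := hsep i j hne
    rw [hij, sub_self, norm_zero] at this
    linarith
  obtain ⟨Γ, hΓ, hcost⟩ := MeanField.exists_isLabelCoupling hN0 hinj (p := p) (μ := ρ₀)
    (ENNReal.lt_add_right hw (ENNReal.ofReal_pos.2 (one_div_pos.2 (hlam N))).ne')
  have hΓ' : MeanField.IsLabelCoupling Γ (ρ 0) := by rwa [hρ.initial]
  have hW : MeanField.IsWellPrepared α c C₁ S (lam N) T v.toReal |C_V| δ₀ p (ρ 0) Φ Γ
      (X₀ N) (V₀ N) :=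
    { card_pos := hN0
      lam_pos := hlam N
      lt_lam := by
        have h1 : (lam N)⁻¹ ≤ 1 / (4 * (2 * c * S) + 1) := hlamv.trans hεe
        rw [one_div, inv_le_inv₀ (hlam N) (by positivity)] at h1
        linarith
      inv_lam_le := hlamv
      vel_nonneg := abs_nonneg _
      sep_pos := hδ₀
      isLabelCoupling := hΓ'
      eLpNorm_pos_le := by rw [ENNReal.ofReal_toReal hvtop]; exact hcost.le
      eLpNorm_vel_le := hΓ.eLpNorm_fst_le hN0 hp ((hV₀ N).trans (by gcongr; exact le_abs_self _))
      norm_vel_sub_le := hV₀sub N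
      le_norm_sub := hsep
      sum_weight_le := fun t ht Y hY hYΦ i => by
        have h1 := hsum (Γ.map fun z => (z.1, Φ t z.2)) (ρ t) Y v.toReal δ₀ hN0
          (hMF.isLabelCoupling hΓ' ht) ((hmap t ht).2.absolutelyContinuous hr0)
          (hMF.weightBound t ht) (hball _ (hmap t ht).2) hε hδ₀ hY
          (by
            rw [hMF.eLpNorm_map ht (MeanField.measurable_label_sub Y), mul_right_comm]
            exact hYΦ)
          (hrate.trans (min_le_left _ _)) i
        rw [hSdef]
        linarith }
  refine ⟨?_, fun X V hXV t ht => ?_⟩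
  · obtain ⟨X, V, h, hX, hV, hne⟩ := hW.exists_isTrajectory_ne hk hC₁ hS0 hT hMF hp
    refine ⟨X, V, ?_⟩
    rw [← hX, ← hV]
    exact h.isParticleSolution hne
  · have h := hXV.isTrajectory
    rw [← hXV.initial_pos, ← hXV.initial_vel] at hW
    have hSX := hW.sum_weight_le_of_isTrajectory hk hC₁ hS0 hMF hp h le_rfl hXV.no_collision
    have hstab := h.eLpNorm_displacement_le hk hC₁ hS0 hMF hN0 (hlam N)
      (fun s hs i => (hSX s hs i).trans (by linarith)) hΓ' hp hlamv (abs_nonneg _)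
      hW.eLpNorm_pos_le hW.eLpNorm_vel_le t ht
    have h1 := (hMF.isLabelCoupling hΓ' ht).wasserstein_le (p := p) (X t)
    rw [hMF.eLpNorm_map ht (MeanField.measurable_label_sub (X t))] at h1
    refine h1.trans (hstab.trans ?_)
    conv_rhs => rw [← ENNReal.ofReal_toReal hvtop, ← ENNReal.ofReal_mul (by positivity),
      ← ENNReal.ofReal_mul (by positivity)]
    refine ENNReal.ofReal_le_ofReal ?_
    have h2 : Real.exp (G * t) ≤ Real.exp (max D G * t) :=
      Real.exp_le_exp.2 (mul_le_mul_of_nonneg_right (le_max_right _ _) ht.1)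
    have h3 : D ≤ max D G := le_max_left _ _
    gcongr
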